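/- **Theorem 2 (convergence of Markovian Accelerated Mirror Descent with batching).** Let $1\le p\le 2$, let $\|\cdot\|=\|\cdot\|_p$ on $\mathbb R^d$ and let $\|\cdot\|_*$ be the dual norm. Let $\mathcal X\subset\mathbb R^d$ be nonempty, convex and compact. Let $\omega:\mathcal X\to\mathbb R$ be $1$-strongly convex with respect to $\|\cdot\|$ and let $\omega'$ be a selection of subgradients of $\omega$ (relative to $\mathcal X$) that is continuous on $\mathcal X$. Put $V(x,y)=\omega(y)-\omega(x)-\langle\omega'(x),y-x\rangle$, $D^2=\sup_{x,y\in\mathcal X}V(x,y)<\infty$, and $P_x(\xi)=\arg\min_{y\in\mathcal X}\{V(x,y)+\langle\xi,y\rangle\}$. Let $\mathsf Z$ be a Polish space, let $\{Z_t\}_{t\ge0}$ be a stationary Markov chain on $\mathsf Z$ with transition kernel $Q$ and invariant distribution $\pi$, and suppose that it is uniformly geometrically ergodic with mixing time $\tau_{\rm mix}\ge1$ and prefactor $C$: $|Q^t(z_0,A)-\pi(A)|\le C\,2^{-t/\tau_{\rm mix}}$ for all $t\ge1$, $z_0\in\mathsf Z$ and all measurable $A\subset\mathsf Z$. Let $f(x)=\mathbb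 E_{Z\sim\pi}[F(x,Z)]$ on $\mathcal X$, where $F(\cdot,z)$ is differentiable at the points of $\mathcal X$ for every $z$, and $f^*=\min_{\mathcal X}f$. Assume that, for all $x,y\in\mathcal X$ and $z\in\mathsf Z$: * $f$ is differentiable at $x$ and $\|\nabla f(x)-\nabla f(y)\|_*\le L\|x-y\|$, with $L>0$; * $f(y)\le f(x)-\langle\nabla f(y),x-y\rangle$; * $\mathbb E_\pi[\nabla F(x,Z)]=\nabla f(x)$ and $\|\nabla F(x,z)-\nabla f(x)\|_*^2\le\sigma^2$. Let $B\in\mathbb N$, $B\ge1$, let $M\ge1$ be real, and let $J_0,J_1,\dots$ be i.i.d. with $\mathbb P\{J_t=j\}=2^{-j}$, $j\ge1$, independent of the chain. Starting from $x^0=x_f^0\in\mathcal X$ and $N_0=0$, iterate for $t=0,1,2,\dots$ $$x_g^t=\beta_t^{-1}x^t+(1-\beta_t^{-1})x_f^t,\qquad g^t_j=\frac1{2^jB}\sum_{i=1}^{2^jB}\nabla F(x_g^t,Z_{N_t+i}),$$ $$g^t=g^t_0+\begin{cases}2^{J_t}(g^t_{J_t}-g^t_{J_t-1}),&2^{J_t}\le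 M,\\0,&\text{otherwise,}\end{cases}$$ $$x^{t+1}=P_{x^t}(\gamma_tg^t),\qquad N_{t+1}=N_t+2^{J_t}B,\qquad x_f^{t+1}=\beta_t^{-1}x^{t+1}+(1-\beta_t^{-1})x_f^t.$$ Assume that the stepsizes $\gamma_t>0$ and momentums $\beta_t$ satisfy $\beta_0=1$ and, for all $t\ge0$, $0\le(\beta_{t+1}-1)\gamma_{t+1}\le\beta_t\gamma_t$ and $\beta_t\ge2\gamma_tL$. Then for all $T\ge0$ $$(\beta_T-1)\gamma_T\,\mathbb E[f(x_f^T)-f^*]=\widetilde{\mathcal O}\Big(D^2+\tau_{\rm mix}B^{-1}\big(TM^{-1}+\log M\big)\sigma^2\sum_{t=0}^{T-1}\gamma_t^2\Big),$$ where $\widetilde{\mathcal O}$ hides factors logarithmic in $T$ and in the dimension $d$. Precisely, there is a constant $K>0$, depending only on the prefactor $C$, such that $f(x_f^T)-f^*$ is integrable and $$(\beta_T-1)\gamma_T\,\mathbb E[f(x_f^T)-f^*]\le K\log(T+2)\Big(D^2+\log(d+2)\,\tau_{\rm mix}B^{-1}\big(TM^{-1}+\log M\big)\sigma^2\sum_{t=0}^{T-1}\gamma_t^2\Big).$$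 -/

import Mathlib

open MeasureTheory ProbabilityTheory
open scoped ENNReal

namespace MAMD

section Chain

variable {S Ω : Type*} [MeasurableSpace S] [MeasurableSpace Ω]

/-- `Z` is, under `P`, a stationary Markov chain with transition kernel `Q` and invariant
distribution `π`: the distribution `π` is invariant for `Q`, `Z 0` has law `π`, and the conditional
distribution of `Z (n + 1)` given `(Z 0, …, Z n)` is `Q (Z n)`. -/
structure IsStationaryMarkovChain (Q : Kernel S S) (π : Measure S) (Z : ℕ → Ω → S)
    (P : Measure Ω) : Prop where
  measurable : ∀ n, Measurable (Z n)
  invariant : Kernel.Invariant Q π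
  initial : P.map (Z 0) = π
  transition : ∀ n : ℕ,
    HasCondDistrib (Z (n + 1)) (fun ω (i : Fin (n + 1)) => Z i ω)
      (Q.comap (fun h : Fin (n + 1) → S => h (Fin.last n)) (measurable_pi_apply _)) P

/-- Uniform geometric ergodicity with mixing time `τ` and prefactor `C`: uniformly in the starting
point, the law of the chain after `t` steps is within `C (1/2)^(t/τ)` of `π` in total variation.
(`Q ^ t` is the `t`-step transition kernel.) -/
def UniformlyGeometricallyErgodic (Q : Kernel S S) (π : Measure S) (C τ : ℝ) : Prop :=
  ∀ t : ℕ, 0 < t → ∀ z : S, ∀ A : Set S, MeasurableSet A →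
    |((Q ^ t) z).real A - π.real A| ≤ C * (1 / 2 : ℝ) ^ ((t : ℝ) / τ)

/-- `J 0, J 1, …` are i.i.d. geometric variables with parameter `1/2` on `{1, 2, …}`, and the whole
sequence is independent of the chain `Z`. -/
structure IsIndepGeometric (J : ℕ → Ω → ℕ) (Z : ℕ → Ω → S) (P : Measure Ω) : Prop where
  measurable : ∀ t, Measurable (J t)
  law : ∀ t j : ℕ, 1 ≤ j → P {ω | J t ω = j} = (2⁻¹ : ℝ≥0∞) ^ j
  iIndep : iIndepFun J P
  indep_chain : IndepFun (fun ω t => J t ω) (fun ω n => Z n ω) P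

end Chain

section Algorithm

variable {E S : Type*} [NormedAddCommGroup E] [NormedSpace ℝ E]

/-- The Bregman divergence `V(x, y) = ω(y) - ω(x) - ⟨ω'(x), y - x⟩`. -/
def bregman (w : E → ℝ) (w' : E → E →L[ℝ] ℝ) (x y : E) : ℝ :=
  w y - w x - w' x (y - x)

/-- `(w, w')` is a distance-generating function on `X`: `w` is `1`-strongly convex on `X` with
respect to the norm of `E`, and `w'` selects, continuously on `X`, a subgradient of `w` relative to
`X` at each point of `X`. (Lower semicontinuity of `w` on `X` follows.) -/
structure IsDistanceGenerating (X : Set E) (w : E → ℝ) (w' : E → E →L[ℝ] ℝ) : Prop where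
  strongConvexOn : StrongConvexOn X 1 w
  subgradient : ∀ x ∈ X, ∀ y ∈ X, w x + w' x (y - x) ≤ w y
  continuousOn : ContinuousOn w' X

/-- `u` is a value of the prox mapping `P_x(ξ) = argmin_{y ∈ X} {V(x, y) + ⟨ξ, y⟩}`. -/
def IsProx (X : Set E) (w : E → ℝ) (w' : E → E →L[ℝ] ℝ) (x : E) (ξ : E →L[ℝ] ℝ) (u : E) : Prop :=
  u ∈ X ∧ IsMinOn (fun y => bregman w w' x y + ξ y) X u

/-- The stochastic gradient `∇F(x, z)`: the derivative of `F(·, z)` at `x`, as an element of the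
dual space (which carries the dual norm). -/
noncomputable def stochGrad (F : E → S → ℝ) (x : E) (z : S) : E →L[ℝ] ℝ :=
  fderiv ℝ (fun u => F u z) x

/-- The batch average `g_j = 2^{-j} B^{-1} ∑_{i=1}^{2^j B} ∇F(x, z_{N+i})`. -/
noncomputable def batchGrad (F : E → S → ℝ) (B : ℕ) (z : ℕ → S) (N : ℕ) (x : E) (j : ℕ) :
    E →L[ℝ] ℝ :=
  ((2 : ℝ) ^ j * B)⁻¹ • ∑ i ∈ Finset.Icc 1 (2 ^ j * B), stochGrad F x (z (N + i))

open Classical in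
/-- The randomized multilevel estimator `g = g_0 + 2^J (g_J - g_{J-1})` if `2^J ≤ M`, and `g = g_0`
otherwise. -/
noncomputable def multilevelGrad (F : E → S → ℝ) (B : ℕ) (M : ℝ) (z : ℕ → S) (N : ℕ) (x : E)
    (J : ℕ) : E →L[ℝ] ℝ :=
  batchGrad F B z N x 0 +
    if (2 : ℝ) ^ J ≤ M then
      (2 : ℝ) ^ J • (batchGrad F B z N x J - batchGrad F B z N x (J - 1))
    else 0

/-- The sample counter: `N_0 = 0`, `N_{t+1} = N_t + 2^{J_t} B`. -/
def sampleCount (B : ℕ) (J : ℕ → ℕ) : ℕ → ℕ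
  | 0 => 0
  | t + 1 => sampleCount B J t + 2 ^ J t * B

/-- The sequences `x, xg, xf` are the iterates of Markovian Accelerated Mirror Descent with batching
along the noise realisation `z` and the realisation `J` of the levels, with stepsizes `γ`,
momentums `β`, batchsize `B`, batchsize limit `M` and starting point `x0`. -/
structure IsRun (X : Set E) (w : E → ℝ) (w' : E → E →L[ℝ] ℝ) (F : E → S → ℝ) (γ β : ℕ → ℝ)
    (B : ℕ) (M : ℝ) (x0 : E) (z : ℕ → S) (J : ℕ → ℕ) (x xg xf : ℕ → E) : Prop where
  x_zero : x 0 = x0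
  xf_zero : xf 0 = x0
  xg_eq : ∀ t, xg t = (β t)⁻¹ • x t + (1 - (β t)⁻¹) • xf t
  x_succ : ∀ t, IsProx X w w' (x t)
    (γ t • multilevelGrad F B M z (sampleCount B J t) (xg t) (J t)) (x (t + 1))
  xf_succ : ∀ t, xf (t + 1) = (β t)⁻¹ • x (t + 1) + (1 - (β t)⁻¹) • xf t

end Algorithm

section Problem

variable {E S : Type*} [NormedAddCommGroup E] [NormedSpace ℝ E]

/-- `f` is `L`-smooth on `X`: differentiable at the points of `X`, with a gradient that is
`L`-Lipschitz on `X` from the norm of `E` to the dual norm. -/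
def IsSmoothOn (X : Set E) (f : E → ℝ) (L : ℝ) : Prop :=
  (∀ x ∈ X, DifferentiableAt ℝ f x) ∧
    ∀ x ∈ X, ∀ y ∈ X, ‖fderiv ℝ f x - fderiv ℝ f y‖ ≤ L * ‖x - y‖

/-- First-order convexity on `X`: `f(y) ≤ f(x) - ⟨∇f(y), x - y⟩` for `x, y ∈ X`. -/
def IsGradConvexOn (X : Set E) (f : E → ℝ) : Prop :=
  ∀ x ∈ X, ∀ y ∈ X, f y ≤ f x - fderiv ℝ f y (x - y)

variable [MeasurableSpace E] [MeasurableSpace S]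

/-- `F` is a first-order stochastic oracle for `f` on `X`: `f(x) = E_π F(x, Z)`, each `F(·, z)` is
differentiable, `E_π ∇F(x, Z) = ∇f(x)`, and `‖∇F(x, z) - ∇f(x)‖_*² ≤ σ²` for all `z`. -/
structure IsOracle (X : Set E) (π : Measure S) (F : E → S → ℝ) (f : E → ℝ) (σ : ℝ) : Prop where
  measurable : Measurable (fun q : E × S => F q.1 q.2)
  integrable : ∀ x ∈ X, Integrable (F x) π
  objective : ∀ x ∈ X, f x = ∫ z, F x z ∂π
  differentiable : ∀ x ∈ X, ∀ z, DifferentiableAt ℝ (fun u => F u z) x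
  unbiased : ∀ x ∈ X, ∫ z, stochGrad F x z ∂π = fderiv ℝ f x
  noise : ∀ x ∈ X, ∀ z, ‖stochGrad F x z - fderiv ℝ f x‖ ^ 2 ≤ σ ^ 2

end Problem

end MAMD

open MeasureTheory ProbabilityTheory
open scoped ENNReal

/-! Along each realisation, accelerated mirror descent satisfies a potential inequality
(`mirror_step`). From step `t` to `t+1`, the weighted gap plus the Bregman distance to a minimiser
`u` grows by at most `2γ²‖ξ‖² - γ ξ(x - u)`, where `ξ` is the error of the gradient estimator. Since
`(β_{t+1}-1)γ_{t+1} ≤ β_t γ_t` and `β_0 = 1`, this telescopes (`IsRun.gap_le`). It remains to bound,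
in expectation, the second moment of `ξ` and its correlation with `x - u`, which is known before the
step's samples are drawn (`multilevelGrad_error`).

Averaging over the level `J`, independent of the past and of the chain, telescopes the estimator to
the batch average at the top level `K = ⌊log₂ M⌋`. Its bias is therefore that of about `MB` samples,
of order `τ/(MB)`. For the second moment, level `j` has probability `2^{-j}` and weight `4^j`, while
the squared batch error is of order `2^{-j}`. Every level then contributes the same amount, and
there are `O(log M)` levels.

The squared batch error is measured in the dual norm, which need not be Euclidean. Up to a factor
`e`, that norm is an `ℓ_r` norm with `2 ≤ r ≤ log(d+2) + 2`, whose square is smooth with constant `κ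
= O(log d)` (`exists_isTwoSmooth_dual`). Smoothness expands `‖R + Y‖²` with a cross term `ψ(R)(Y)`,
where `ψ` is Lipschitz. For a martingale the mean of the cross term would vanish. Here `ψ(R_m)` is
split into its increments, each bounded and known at an earlier time, and mixing makes their
correlations with the new noise term decay geometrically in the lag. The correlations sum to `O(τ)`,
so `E‖R_m‖² = O(κ τ m)` (`IsStationaryMarkovChain.setIntegral_sq_norm_sum_le`).

The batches start at random times `N_t`. These depend only on past levels, which are independent of
the chain, so the Markov property survives adding those levels to the history, and one argues
separately on each event `N_t = n`. Finally Young's inequality with weight `T` turns the bias into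
`D²` plus a term of order `τ T/(MB)`. -/

namespace MAMD

/-! ### Smoothness of squared norms and of `ℓ_q` -/

section Smoothness

/-- The square of the norm of `V` is uniformly smooth of power type `2`, with constant `κ`. -/
def IsTwoSmooth (V : Type*) [NormedAddCommGroup V] (κ : ℝ) : Prop :=
  ∀ s y : V, ‖s + y‖ ^ 2 + ‖s - y‖ ^ 2 ≤ 2 * ‖s‖ ^ 2 + 2 * κ * ‖y‖ ^ 2

/-- Twice `‖s‖` times a norming functional of `s` is a subgradient of `‖·‖²`. Inserting its lower
bound at `s - y` into the smoothness inequality gives the upper bound at `s + y`; playing upper and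
lower bounds at two points against each other gives the Lipschitz property. -/
theorem exists_lipschitz_subgradient {V : Type*} [NormedAddCommGroup V] [NormedSpace ℝ V] {κ : ℝ}
    (hκ : 0 ≤ κ) (hV : IsTwoSmooth V κ) :
    ∃ ψ : V → V →L[ℝ] ℝ, ψ 0 = 0 ∧
      (∀ s y, ‖s + y‖ ^ 2 ≤ ‖s‖ ^ 2 + ψ s y + 2 * κ * ‖y‖ ^ 2) ∧
      ∀ s s', ‖ψ s' - ψ s‖ ≤ 8 * κ * ‖s' - s‖ := by
  choose j hj hjs using fun s : V => exists_dual_vector'' ℝ s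
  have hsub : ∀ s s' : V, ‖s‖ ^ 2 + ((2 * ‖s‖) • j s) (s' - s) ≤ ‖s'‖ ^ 2 := by
    intro s s'
    have h1 : j s s' ≤ ‖s'‖ := by
      refine (le_abs_self _).trans ((j s).le_opNorm s' |>.trans ?_)
      nlinarith [hj s, norm_nonneg s']
    have h2 : j s s = ‖s‖ := by simpa using hjs s
    have h3 : ((2 * ‖s‖) • j s) (s' - s) = 2 * ‖s‖ * (j s s' - ‖s‖) := by
      simp [h2]
    rw [h3]
    nlinarith [sq_nonneg (‖s'‖ - ‖s‖), mul_le_mul_of_nonneg_left h1 (norm_nonneg s)]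
  have hup : ∀ s y : V, ‖s + y‖ ^ 2 ≤ ‖s‖ ^ 2 + ((2 * ‖s‖) • j s) y + 2 * κ * ‖y‖ ^ 2 := by
    intro s y
    have h1 := hsub s (s - y)
    have h2 := hV s y
    have h3 : ((2 * ‖s‖) • j s) (s - y - s) = - ((2 * ‖s‖) • j s) y := by
      rw [← map_neg]; congr 1; abel
    linarith
  refine ⟨fun s => (2 * ‖s‖) • j s, by simp, hup, ?_⟩
  intro s s'
  set φ := (2 * ‖s'‖) • j s' - (2 * ‖s‖) • j s with hφ
  have key : ∀ h : V, φ h ≤ 2 * κ * ‖s' - s + h‖ ^ 2 := by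
    intro h
    have h1 := hsub s' (s' + h)
    have h2 := hup s (s' - s + h)
    have h3 := hsub s s'
    have e1 : s + (s' - s + h) = s' + h := by abel
    have e2 : s' + h - s' = h := by abel
    rw [e1, map_add] at h2
    rw [e2] at h1
    simp only [hφ, sub_apply]
    linarith
  have key2 : ∀ h : V, φ h ≤ 8 * κ * ‖s' - s‖ * ‖h‖ := by
    intro h
    rcases eq_or_ne h 0 with rfl | hh
    · simp
    rcases eq_or_ne s' s with rfl | hs
    · simp [hφ]
    have hh' : 0 < ‖h‖ := norm_pos_iff.2 hh
    have hs' : 0 < ‖s' - s‖ := norm_pos_iff.2 (sub_ne_zero.2 hs)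
    -- Rescaling `h` to length `‖s' - s‖` balances `key`: the right side becomes at most `2κ(2‖s' -
    -- s‖)²`, whence the constant `8κ`.
    have h1 := key ((‖s' - s‖ / ‖h‖) • h)
    have h2 : ‖s' - s + (‖s' - s‖ / ‖h‖) • h‖ ≤ 2 * ‖s' - s‖ := by
      refine (norm_add_le _ _).trans ?_
      rw [norm_smul, Real.norm_of_nonneg (by positivity), div_mul_cancel₀ _ hh'.ne']
      linarith
    have h3 : ‖s' - s + (‖s' - s‖ / ‖h‖) • h‖ ^ 2 ≤ (2 * ‖s' - s‖) ^ 2 := by gcongr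
    rw [map_smul, smul_eq_mul] at h1
    have h4 : ‖s' - s‖ / ‖h‖ * φ h ≤ 8 * κ * ‖s' - s‖ ^ 2 := by nlinarith
    have h5 : φ h = ‖h‖ / ‖s' - s‖ * (‖s' - s‖ / ‖h‖ * φ h) := by field_simp
    rw [h5]
    calc _ ≤ ‖h‖ / ‖s' - s‖ * (8 * κ * ‖s' - s‖ ^ 2) := by gcongr
      _ = _ := by field_simp
  refine ContinuousLinearMap.opNorm_le_bound _ (by positivity) fun h => ?_
  rw [Real.norm_eq_abs, abs_le]
  refine ⟨?_, key2 h⟩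
  have := key2 (-h)
  rw [map_neg, norm_neg] at this
  linarith

/-- If `a² ≤ q b²`, both `(a ± b)²` are already below `a² + 3q b²`. Otherwise put `u = b/a`, with `q
u² < 1`: the normalised left side is at most `2 cosh(qu) ≤ 2 exp(q u²)^{q/2}`, and `exp t ≤ 1 + 3t`
for `0 ≤ t ≤ 1`. -/
theorem rpow_abs_add_add_rpow_abs_sub_le {q : ℝ} (hq : 2 ≤ q) (a b : ℝ) :
    |a + b| ^ q + |a - b| ^ q ≤ 2 * (a ^ 2 + 3 * q * b ^ 2) ^ (q / 2) := by
  have hq0 : (0 : ℝ) ≤ q / 2 := by linarith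
  have hpow : ∀ c : ℝ, |c| ^ q = (c ^ 2) ^ (q / 2) := by
    intro c
    rw [← sq_abs, ← Real.rpow_natCast, ← Real.rpow_mul (abs_nonneg c)]
    congr 1; push_cast; ring
  rcases le_or_gt (a ^ 2) (q * b ^ 2) with h | h
  · have hab : 2 * (|a| * |b|) ≤ 2 * q * b ^ 2 := by
      have : |a| * |b| ≤ q * b ^ 2 := by
        apply abs_le_of_sq_le_sq' _ (by positivity) |>.2
        rw [mul_pow, sq_abs, sq_abs]
        nlinarith [sq_nonneg b, mul_le_mul_of_nonneg_right h (sq_nonneg b),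
          mul_nonneg (mul_nonneg (sq_nonneg b) (sq_nonneg b)) (by nlinarith : (0:ℝ) ≤ q ^ 2 - q)]
      linarith
    have h1 : ∀ c : ℝ, |c| ≤ |a| + |b| → |c| ^ q ≤ (a ^ 2 + 3 * q * b ^ 2) ^ (q / 2) := by
      intro c hc
      rw [hpow]
      refine Real.rpow_le_rpow (by positivity) ?_ hq0
      have : c ^ 2 ≤ (|a| + |b|) ^ 2 := by rw [← sq_abs c]; gcongr
      rw [add_sq, sq_abs, sq_abs] at this
      nlinarith [sq_nonneg b]
    linarith [h1 _ (abs_add_le a b), h1 _ (abs_sub a b)]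
  · have ha : 0 < |a| := by
      rw [abs_pos]; rintro rfl
      nlinarith [sq_nonneg b]
    set u := b / a with hu
    have hb : b = a * u := by rw [hu]; field_simp [abs_pos.1 ha]
    have hu1 : q * u ^ 2 < 1 := by
      have : 0 < a ^ 2 := by rw [← sq_abs]; positivity
      rw [hu, div_pow, mul_div_assoc', div_lt_one this]; exact h
    have hu2 : |u| < 1 := by
      rw [← sq_lt_one_iff_abs_lt_one]; nlinarith [sq_nonneg u]
    have hu3 := abs_lt.1 hu2
    have e1 : |a + b| ^ q = |a| ^ q * (1 + u) ^ q := by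
      rw [← Real.mul_rpow ha.le (by linarith), hb, ← mul_one_add, abs_mul,
        abs_of_nonneg (by linarith : 0 ≤ 1 + u)]
    have e2 : |a - b| ^ q = |a| ^ q * (1 - u) ^ q := by
      rw [← Real.mul_rpow ha.le (by linarith), hb, ← mul_one_sub, abs_mul,
        abs_of_nonneg (by linarith : 0 ≤ 1 - u)]
    have e3 : (a ^ 2 + 3 * q * b ^ 2) ^ (q / 2) = |a| ^ q * (1 + 3 * q * u ^ 2) ^ (q / 2) := by
      rw [hpow, ← Real.mul_rpow (by positivity) (by positivity), hb]
      congr 1; ring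
    have l1 : ∀ v : ℝ, 0 ≤ 1 + v → (1 + v) ^ q ≤ Real.exp (q * v) := by
      intro v hv
      rw [mul_comm, Real.exp_mul]
      refine Real.rpow_le_rpow hv ?_ (by linarith)
      linarith [Real.add_one_le_exp v]
    have l2 : (1 + u) ^ q + (1 - u) ^ q ≤ 2 * Real.cosh (q * u) := by
      have h1 := l1 u (by linarith)
      have h2 := l1 (-u) (by linarith)
      rw [Real.cosh_eq]
      rw [mul_neg, ← sub_eq_add_neg] at h2
      linarith
    have l3 : Real.cosh (q * u) ≤ (1 + 3 * q * u ^ 2) ^ (q / 2) := by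
      refine (Real.cosh_le_exp_half_sq _).trans ?_
      have : (q * u) ^ 2 / 2 = (q * u ^ 2) * (q / 2) := by ring
      rw [this, Real.exp_mul]
      refine Real.rpow_le_rpow (Real.exp_pos _).le ?_ hq0
      have hn : 0 ≤ q * u ^ 2 := by positivity
      have := (abs_le.1 (Real.abs_exp_sub_one_sub_id_le
        (x := q * u ^ 2) (by rw [abs_of_nonneg hn]; exact hu1.le))).2
      nlinarith
    rw [e1, e2, e3]
    have : 0 ≤ |a| ^ q := by positivity
    nlinarith

/-- The scalar inequality is summed over coordinates, Minkowski in `ℓ_{q/2}` is applied to the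
squared coordinates, and convexity of `t ↦ t^{q/2}` passes from the mean of `q`-th powers to the
mean of squares. -/
theorem isTwoSmooth_piLp {ι : Type*} [Fintype ι] {q : ℝ} (hq : 2 ≤ q)
    [Fact (1 ≤ ENNReal.ofReal q)] :
    IsTwoSmooth (PiLp (ENNReal.ofReal q) (fun _ : ι => ℝ)) (3 * q) := by
  intro x y
  have hq0 : 0 < q := by linarith
  have hr : (ENNReal.ofReal q).toReal = q := ENNReal.toReal_ofReal hq0.le
  have hr0 : 0 < (ENNReal.ofReal q).toReal := by rw [hr]; exact hq0
  have hnq : ∀ z : PiLp (ENNReal.ofReal q) (fun _ : ι => ℝ), ‖z‖ ^ q = ∑ i, |z i| ^ q := by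
    intro z
    rw [PiLp.norm_eq_sum hr0, hr, ← Real.rpow_mul (by positivity), one_div_mul_cancel hq0.ne',
      Real.rpow_one]
    simp
  have hn2 : ∀ z : PiLp (ENNReal.ofReal q) (fun _ : ι => ℝ),
      (‖z‖ ^ 2) ^ (q / 2) = ‖z‖ ^ q := by
    intro z
    rw [← Real.rpow_natCast, ← Real.rpow_mul (norm_nonneg z)]
    congr 1; push_cast; ring
  have hn3 : ∀ z : PiLp (ENNReal.ofReal q) (fun _ : ι => ℝ),
      (∑ i, (z i ^ 2) ^ (q / 2)) ^ (1 / (q / 2)) = ‖z‖ ^ 2 := by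
    intro z
    have : ∑ i, (z i ^ 2) ^ (q / 2) = (‖z‖ ^ 2) ^ (q / 2) := by
      rw [hn2, hnq]
      refine Finset.sum_congr rfl fun i _ => ?_
      rw [← sq_abs, ← Real.rpow_natCast, ← Real.rpow_mul (abs_nonneg _)]
      congr 1; push_cast; ring
    rw [this, ← Real.rpow_mul (by positivity), mul_one_div_cancel (by linarith), Real.rpow_one]
  set R := ‖x‖ ^ 2 + 3 * q * ‖y‖ ^ 2 with hR
  have hR0 : 0 ≤ R := by positivity
  have h1 : ‖x + y‖ ^ q + ‖x - y‖ ^ q ≤ 2 * R ^ (q / 2) := by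
    rw [hnq, hnq, ← Finset.sum_add_distrib]
    calc ∑ i, (|(x + y) i| ^ q + |(x - y) i| ^ q)
        ≤ ∑ i, 2 * (x i ^ 2 + 3 * q * y i ^ 2) ^ (q / 2) := by
          refine Finset.sum_le_sum fun i _ => ?_
          exact rpow_abs_add_add_rpow_abs_sub_le hq _ _
      _ = 2 * ∑ i, (x i ^ 2 + 3 * q * y i ^ 2) ^ (q / 2) := by rw [Finset.mul_sum]
      _ ≤ 2 * R ^ (q / 2) := by
          refine mul_le_mul_of_nonneg_left ?_ zero_le_two
          have h2 := Real.Lp_add_le_of_nonneg (s := Finset.univ) (p := q / 2) (by linarith)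
            (f := fun i => x i ^ 2) (g := fun i => 3 * q * y i ^ 2)
            (fun i _ => by positivity) (fun i _ => by positivity)
          have h3 : (∑ i, (3 * q * y i ^ 2) ^ (q / 2)) ^ (1 / (q / 2)) = 3 * q * ‖y‖ ^ 2 := by
            rw [← hn3 y]
            have : ∀ i, (3 * q * y i ^ 2) ^ (q / 2)
                = (3 * q) ^ (q / 2) * (y i ^ 2) ^ (q / 2) := fun i =>
              Real.mul_rpow (by positivity) (by positivity)
            simp_rw [this]
            rw [← Finset.mul_sum, Real.mul_rpow (by positivity)
              (Finset.sum_nonneg fun i _ => by positivity),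
              ← Real.rpow_mul (by positivity), mul_one_div_cancel (by linarith), Real.rpow_one]
          rw [hn3 x, h3, ← hR] at h2
          have hs : 0 ≤ ∑ i, (x i ^ 2 + 3 * q * y i ^ 2) ^ (q / 2) :=
            Finset.sum_nonneg fun i _ => by positivity
          calc ∑ i, (x i ^ 2 + 3 * q * y i ^ 2) ^ (q / 2)
              = ((∑ i, (x i ^ 2 + 3 * q * y i ^ 2) ^ (q / 2)) ^ (1 / (q / 2))) ^ (q / 2) := by
                rw [← Real.rpow_mul hs, one_div_mul_cancel (by linarith), Real.rpow_one]
            _ ≤ R ^ (q / 2) := Real.rpow_le_rpow (by positivity) h2 (by linarith)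
  have hconv := convexOn_rpow (p := q / 2) (by linarith)
  have h4 := hconv.2
    (show ‖x + y‖ ^ 2 ∈ Set.Ici (0 : ℝ) from Set.mem_Ici.2 (by positivity))
    (show ‖x - y‖ ^ 2 ∈ Set.Ici (0 : ℝ) from Set.mem_Ici.2 (by positivity))
    (show (0 : ℝ) ≤ 1 / 2 by norm_num) (show (0 : ℝ) ≤ 1 / 2 by norm_num) (by norm_num)
  simp only [smul_eq_mul] at h4
  rw [hn2, hn2] at h4
  have h5 : (1 / 2 * ‖x + y‖ ^ 2 + 1 / 2 * ‖x - y‖ ^ 2) ^ (q / 2) ≤ R ^ (q / 2) := by linarith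
  rw [Real.rpow_le_rpow_iff (by positivity) hR0 (by linarith)] at h5
  rw [hR] at h5
  linarith

/-- Each coordinate is at most the `ℓ_a` norm `s`, so `|x_i|^b ≤ |x_i|^a s^{b-a}`. -/
theorem rpow_sum_rpow_antitone {ι : Type*} [Fintype ι] {a b : ℝ} (ha : 0 < a) (hab : a ≤ b)
    (x : ι → ℝ) :
    (∑ i, |x i| ^ b) ^ (1 / b) ≤ (∑ i, |x i| ^ a) ^ (1 / a) := by
  have hb : 0 < b := ha.trans_le hab
  set s := (∑ i, |x i| ^ a) ^ (1 / a) with hs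
  have hS : 0 ≤ ∑ i, |x i| ^ a := Finset.sum_nonneg fun i _ => by positivity
  have hs0 : 0 ≤ s := by positivity
  have hsa : s ^ a = ∑ i, |x i| ^ a := by
    rw [hs, ← Real.rpow_mul hS, one_div_mul_cancel ha.ne', Real.rpow_one]
  have hle : ∀ i, |x i| ≤ s := by
    intro i
    rw [← Real.rpow_le_rpow_iff (abs_nonneg _) hs0 ha, hsa]
    exact Finset.single_le_sum (f := fun i => |x i| ^ a) (fun i _ => by positivity)
      (Finset.mem_univ i)
  have h1 : ∑ i, |x i| ^ b ≤ s ^ b := by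
    calc ∑ i, |x i| ^ b = ∑ i, |x i| ^ a * |x i| ^ (b - a) := by
          refine Finset.sum_congr rfl fun i _ => ?_
          rw [← Real.rpow_add_of_nonneg (abs_nonneg _) ha.le (by linarith)]; congr 1; ring
      _ ≤ ∑ i, |x i| ^ a * s ^ (b - a) := by
          refine Finset.sum_le_sum fun i _ => ?_
          exact mul_le_mul_of_nonneg_left
            (Real.rpow_le_rpow (abs_nonneg _) (hle i) (by linarith)) (by positivity)
      _ = s ^ b := by
          rw [← Finset.sum_mul, ← hsa, ← Real.rpow_add_of_nonneg hs0 ha.le (by linarith)]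
          congr 1; ring
  calc _ ≤ (s ^ b) ^ (1 / b) :=
        Real.rpow_le_rpow (Finset.sum_nonneg fun i _ => by positivity) h1 (by positivity)
    _ = s := by rw [← Real.rpow_mul hs0, mul_one_div_cancel hb.ne', Real.rpow_one]

end Smoothness

/-! ### Comparing the dual of `ℓ_p` with a smooth `ℓ_r` -/

section DualNorm

variable {d : ℕ} {p : ℝ≥0∞} [Fact (1 ≤ p)]

/-- The vector of the values of a functional on the standard basis, as an element of `ℓ_r`. -/
noncomputable def dualCoords (p : ℝ≥0∞) [Fact (1 ≤ p)] (r : ℝ≥0∞) [Fact (1 ≤ r)] (d : ℕ) :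
    (PiLp p (fun _ : Fin d => ℝ) →L[ℝ] ℝ) →L[ℝ] PiLp r (fun _ : Fin d => ℝ) :=
  LinearMap.toContinuousLinearMap
    { toFun := fun φ => WithLp.toLp r fun i => φ (WithLp.toLp p (Pi.single i 1))
      map_add' := fun φ φ' => by ext i; simp
      map_smul' := fun c φ => by ext i; simp }

theorem dualCoords_apply (r : ℝ≥0∞) [Fact (1 ≤ r)] (φ : PiLp p (fun _ : Fin d => ℝ) →L[ℝ] ℝ)
    (i : Fin d) : dualCoords p r d φ i = φ (WithLp.toLp p (Pi.single i 1)) := rfl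

theorem apply_eq_sum_dualCoords (r : ℝ≥0∞) [Fact (1 ≤ r)]
    (φ : PiLp p (fun _ : Fin d => ℝ) →L[ℝ] ℝ) (x : PiLp p (fun _ : Fin d => ℝ)) :
    φ x = ∑ i, dualCoords p r d φ i * x i := by
  have hx : x = ∑ i, x i • (WithLp.toLp p (Pi.single i (1 : ℝ)) : PiLp p (fun _ : Fin d => ℝ)) := by
    ext j
    simp [Finset.sum_apply, Pi.single_apply]
  conv_lhs => rw [hx]
  simp [dualCoords_apply, mul_comm]

/-- Hölder with exponents `r, r'`, followed by `‖x‖_{r'} ≤ ‖x‖_p` because `p ≤ r'`. -/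
theorem norm_le_norm_dualCoords {r r' : ℝ} (hr : r.HolderConjugate r') (hp : p ≠ ∞)
    (hpr : p.toReal ≤ r') [Fact (1 ≤ ENNReal.ofReal r)]
    (φ : PiLp p (fun _ : Fin d => ℝ) →L[ℝ] ℝ) :
    ‖φ‖ ≤ ‖dualCoords p (ENNReal.ofReal r) d φ‖ := by
  have hp0 : 0 < p.toReal :=
    ENNReal.toReal_pos (zero_lt_one.trans_le (Fact.out : 1 ≤ p)).ne' hp
  have hr0 : 0 < r := hr.pos
  have hrr : (ENNReal.ofReal r).toReal = r := ENNReal.toReal_ofReal hr0.le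
  refine ContinuousLinearMap.opNorm_le_bound _ (norm_nonneg _) fun x => ?_
  rw [apply_eq_sum_dualCoords (ENNReal.ofReal r) φ x, Real.norm_eq_abs]
  refine (Finset.abs_sum_le_sum_abs _ _).trans ?_
  have h1 := Real.inner_le_Lp_mul_Lq Finset.univ
    (fun i => |dualCoords p (ENNReal.ofReal r) d φ i|) (fun i => |x i|) hr
  simp only [abs_abs] at h1
  have h2 := rpow_sum_rpow_antitone hp0 hpr (fun i => x i)
  rw [PiLp.norm_eq_sum (by rw [hrr]; exact hr0), PiLp.norm_eq_sum hp0 x, hrr]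
  simp only [abs_mul, Real.norm_eq_abs]
  refine h1.trans (mul_le_mul_of_nonneg_left h2 ?_)
  exact Real.rpow_nonneg (Finset.sum_nonneg fun i _ => by positivity) _

/-- The functional is tested on the vector of equality in Hölder, `sign(a_i)|a_i|^{r-1}`. -/
theorem norm_dualCoords_le_of_conjugate {r : ℝ} (hr : r.HolderConjugate p.toReal)
    [Fact (1 ≤ ENNReal.ofReal r)] (φ : PiLp p (fun _ : Fin d => ℝ) →L[ℝ] ℝ) :
    ‖dualCoords p (ENNReal.ofReal r) d φ‖ ≤ ‖φ‖ := by
  have hr0 : 0 < r := hr.pos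
  have hp0 : 0 < p.toReal := hr.symm.pos
  have hrr : (ENNReal.ofReal r).toReal = r := ENNReal.toReal_ofReal hr0.le
  set a := dualCoords p (ENNReal.ofReal r) d φ with ha
  let x : PiLp p (fun _ : Fin d => ℝ) :=
    WithLp.toLp p fun i => (SignType.sign (a i) : ℝ) * |a i| ^ (r - 1)
  set s := ∑ i, |a i| ^ r with hs
  have hs0 : 0 ≤ s := Finset.sum_nonneg fun i _ => by positivity
  have hna : ‖a‖ = s ^ (1 / r) := by
    rw [PiLp.norm_eq_sum (by rw [hrr]; exact hr0), hrr]; simp [hs]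
  rcases hs0.eq_or_lt with h0 | h0
  · rw [hna, ← h0, Real.zero_rpow (by positivity)]; positivity
  have hφx : φ x = s := by
    rw [apply_eq_sum_dualCoords (ENNReal.ofReal r) φ x, hs]
    refine Finset.sum_congr rfl fun i _ => ?_
    have : a i * ((SignType.sign (a i) : ℝ) * |a i| ^ (r - 1)) = |a i| ^ r := by
      rw [← mul_assoc, self_mul_sign]
      conv_lhs => enter [1]; rw [← Real.rpow_one |a i|]
      rw [← Real.rpow_add_of_nonneg (abs_nonneg _) zero_le_one (by linarith [hr.lt])]
      congr 1; ring
    exact this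
  have hx : ‖x‖ ≤ s ^ (1 / p.toReal) := by
    rw [PiLp.norm_eq_sum hp0]
    refine Real.rpow_le_rpow (Finset.sum_nonneg fun i _ => by positivity) ?_ (by positivity)
    refine Finset.sum_le_sum fun i _ => ?_
    have h1 : ‖x i‖ ≤ |a i| ^ (r - 1) := by
      show ‖(SignType.sign (a i) : ℝ) * |a i| ^ (r - 1)‖ ≤ _
      rw [norm_mul, Real.norm_of_nonneg (Real.rpow_nonneg (abs_nonneg _) _)]
      refine mul_le_of_le_one_left (Real.rpow_nonneg (abs_nonneg _) _) ?_
      rcases lt_trichotomy (a i) 0 with h | h | h <;> simp [h]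
    calc ‖x i‖ ^ p.toReal ≤ (|a i| ^ (r - 1)) ^ p.toReal := by gcongr
      _ = |a i| ^ r := by
        rw [← Real.rpow_mul (abs_nonneg _), hr.sub_one_mul_conj]
  have h3 : s ≤ ‖φ‖ * s ^ (1 / p.toReal) := by
    calc s = φ x := hφx.symm
      _ ≤ ‖φ‖ * ‖x‖ := (le_abs_self _).trans (φ.le_opNorm x)
      _ ≤ _ := by gcongr
  have h4 : s = s ^ (1 / r) * s ^ (1 / p.toReal) := by
    rw [← Real.rpow_add h0, one_div, one_div, hr.inv_add_inv_eq_one, Real.rpow_one]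
  rw [hna]
  have h5 : 0 < s ^ (1 / p.toReal) := Real.rpow_pos_of_pos h0 _
  refine le_of_mul_le_mul_right ?_ h5
  rw [← h4]; exact h3

/-- Basis vectors have norm one, so every coordinate is at most `‖φ‖`. Summing `d` of them costs
`d^{1/r}`, which is at most `e` once `r ≥ log(d+2)`. -/
theorem norm_dualCoords_le_exp_mul {r : ℝ} (hr : Real.log (d + 2) ≤ r) (hr1 : 1 ≤ r)
    [Fact (1 ≤ ENNReal.ofReal r)] (φ : PiLp p (fun _ : Fin d => ℝ) →L[ℝ] ℝ) :
    ‖dualCoords p (ENNReal.ofReal r) d φ‖ ≤ Real.exp 1 * ‖φ‖ := by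
  have hr0 : 0 < r := by linarith
  have hrr : (ENNReal.ofReal r).toReal = r := ENNReal.toReal_ofReal hr0.le
  have h1 : ∀ i, ‖dualCoords p (ENNReal.ofReal r) d φ i‖ ≤ ‖φ‖ := by
    intro i
    rw [dualCoords_apply]
    refine (φ.le_opNorm _).trans (mul_le_of_le_one_right (norm_nonneg _) ?_)
    have := PiLp.norm_single p (fun _ : Fin d => ℝ) i (1 : ℝ)
    exact this.le.trans (by simp)
  rw [PiLp.norm_eq_sum (by rw [hrr]; exact hr0), hrr]
  calc (∑ i, ‖dualCoords p (ENNReal.ofReal r) d φ i‖ ^ r) ^ (1 / r)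
      ≤ (∑ _i : Fin d, ‖φ‖ ^ r) ^ (1 / r) := by
        refine Real.rpow_le_rpow (Finset.sum_nonneg fun i _ => by positivity) ?_ (by positivity)
        exact Finset.sum_le_sum fun i _ => Real.rpow_le_rpow (norm_nonneg _) (h1 i) hr0.le
    _ = (d : ℝ) ^ (1 / r) * ‖φ‖ := by
        rw [Finset.sum_const, Finset.card_univ, Fintype.card_fin, nsmul_eq_mul,
          Real.mul_rpow (by positivity) (by positivity), ← Real.rpow_mul (norm_nonneg _),
          mul_one_div_cancel hr0.ne', Real.rpow_one]
    _ ≤ Real.exp 1 * ‖φ‖ := by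
        refine mul_le_mul_of_nonneg_right ?_ (norm_nonneg _)
        calc (d : ℝ) ^ (1 / r) ≤ ((d : ℝ) + 2) ^ (1 / r) := by gcongr; linarith
          _ = Real.exp (Real.log (d + 2) * (1 / r)) := Real.rpow_def_of_pos (by positivity) _
          _ ≤ Real.exp 1 := by
            gcongr
            rw [mul_one_div, div_le_one hr0]; exact hr

/-- For `1 ≤ p ≤ 2`, the dual of `ℓ_p` in dimension `d` is, up to a factor `e`, a space whose squared
norm is smooth with constant `O(log d)`. -/
theorem exists_isTwoSmooth_dual (d : ℕ) (p : ℝ≥0∞) [Fact (1 ≤ p)] (hp : p ≤ 2) :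
    ∃ (r : ℝ≥0∞) (_ : Fact (1 ≤ r)) (κ : ℝ), 0 ≤ κ ∧ κ ≤ 12 * Real.log (d + 2) ∧
      IsTwoSmooth (PiLp r (fun _ : Fin d => ℝ)) κ ∧
      ∀ φ : PiLp p (fun _ : Fin d => ℝ) →L[ℝ] ℝ, ‖φ‖ ≤ ‖dualCoords p r d φ‖ ∧
        ‖dualCoords p r d φ‖ ≤ Real.exp 1 * ‖φ‖ := by
  have hp1 : 1 ≤ p := Fact.out
  have hpt : p ≠ ∞ := (hp.trans_lt (by simp)).ne
  have hpr1 : 1 ≤ p.toReal := by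
    have := ENNReal.toReal_mono hpt hp1; simpa using this
  have hpr2 : p.toReal ≤ 2 := by
    have := ENNReal.toReal_mono (by simp) hp; simpa using this
  have hlog : Real.log 2 ≤ Real.log (d + 2) :=
    Real.log_le_log (by norm_num) (by linarith [Nat.cast_nonneg (α := ℝ) d])
  have hlog2 := Real.log_two_gt_d9
  have he : (1 : ℝ) ≤ Real.exp 1 := Real.one_le_exp zero_le_one
  set r₀ := Real.log (d + 2) + 2 with hr₀
  have hfact : ∀ r : ℝ, 2 ≤ r → Fact (1 ≤ ENNReal.ofReal r) := fun r hr =>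
    ⟨by rw [← ENNReal.ofReal_one]; exact ENNReal.ofReal_le_ofReal (by linarith)⟩
  -- The natural choice of `r` is the conjugate exponent of `p`, but its smoothness constant blows
  -- up as `p → 1`; it is therefore capped at `r₀`. In both cases `κ = 3r ≤ 3(log(d+2) + 2) ≤ 12
  -- log(d+2)`.
  by_cases h : 1 < p.toReal ∧ p.toReal.conjExponent ≤ r₀
  · obtain ⟨h1, h2⟩ := h
    have hc := Real.HolderConjugate.conjExponent h1
    have hq2 : 2 ≤ p.toReal.conjExponent := by
      rw [Real.conjExponent, le_div_iff₀ (by linarith)]; linarith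
    have := hfact _ hq2
    refine ⟨ENNReal.ofReal p.toReal.conjExponent, inferInstance, 3 * p.toReal.conjExponent,
      by linarith, by linarith, isTwoSmooth_piLp hq2, fun φ => ⟨?_, ?_⟩⟩
    · exact norm_le_norm_dualCoords hc.symm hpt le_rfl φ
    · refine (norm_dualCoords_le_of_conjugate hc.symm φ).trans ?_
      exact le_mul_of_one_le_left (norm_nonneg _) he
  · have hr2 : 2 ≤ r₀ := by linarith
    have := hfact _ hr2
    have hc := Real.HolderConjugate.conjExponent (by linarith : 1 < r₀)
    refine ⟨ENNReal.ofReal r₀, inferInstance, 3 * r₀, by linarith, by linarith,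
      isTwoSmooth_piLp hr2, fun φ => ⟨?_, ?_⟩⟩
    · refine norm_le_norm_dualCoords hc hpt ?_ φ
      rcases hpr1.eq_or_lt with h1 | h1
      · rw [← h1]; exact hc.symm.lt.le
      · have h2 : r₀ < p.toReal.conjExponent := by
          by_contra h3; exact h ⟨h1, not_lt.1 h3⟩
        rw [Real.conjExponent, lt_div_iff₀ (by linarith)] at h2
        rw [Real.conjExponent, le_div_iff₀ (by linarith)]
        nlinarith
    · exact norm_dualCoords_le_exp_mul (by linarith) (by linarith) φ

end DualNorm

/-! ### Bregman geometry and one step of accelerated mirror descent -/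

section MirrorDescent

variable {E : Type*} [NormedAddCommGroup E] [NormedSpace ℝ E] {X : Set E} {w : E → ℝ}
  {w' : E → E →L[ℝ] ℝ}

/-- The subgradient inequality at `(1-s)x + sy`, combined with strong convexity, gives the bound
with a factor `1 - s`, which is removed as `s → 0`. -/
theorem half_sq_norm_le_bregman (hw : IsDistanceGenerating X w w') {x y : E} (hx : x ∈ X)
    (hy : y ∈ X) : 1 / 2 * ‖y - x‖ ^ 2 ≤ bregman w w' x y := by
  have key : ∀ s : ℝ, 0 < s → s < 1 → (1 - s) * (1 / 2 * ‖y - x‖ ^ 2) ≤ bregman w w' x y := by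
    intro s hs0 hs1
    have h1 := hw.strongConvexOn.2 hx hy (show (0 : ℝ) ≤ 1 - s by linarith) hs0.le (by ring)
    have hmem : (1 - s) • x + s • y ∈ X :=
      hw.strongConvexOn.1 hx hy (by linarith) hs0.le (by ring)
    have h2 := hw.subgradient x hx _ hmem
    have h3 : (1 - s) • x + s • y - x = s • (y - x) := by module
    rw [h3, map_smul, smul_eq_mul] at h2
    simp only [smul_eq_mul] at h1
    rw [norm_sub_rev] at h1
    unfold bregman
    have h4 : s * ((1 - s) * (1 / 2 * ‖y - x‖ ^ 2)) ≤ s * (w y - w x - w' x (y - x)) := by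
      nlinarith
    exact le_of_mul_le_mul_left h4 hs0
  by_contra hcon
  rw [not_le] at hcon
  set A := 1 / 2 * ‖y - x‖ ^ 2
  set v := bregman w w' x y
  have hv : 0 ≤ v := by
    have := hw.subgradient x hx y hy
    simp only [v, bregman]; linarith
  have hA : 0 < A := by linarith
  -- For this `s`, `(1 - s)A` is the midpoint of `v` and `A`, which exceeds `v`: a contradiction.
  have := key ((A - v) / (2 * A)) (by apply div_pos <;> linarith)
    (by rw [div_lt_one (by linarith)]; linarith)
  have h2 : (1 - (A - v) / (2 * A)) * A = (A + v) / 2 := by field_simp; ring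
  linarith

theorem bregman_nonneg (hw : IsDistanceGenerating X w w') {x y : E} (hx : x ∈ X)
    (hy : y ∈ X) : 0 ≤ bregman w w' x y :=
  (by positivity : (0 : ℝ) ≤ 1 / 2 * ‖y - x‖ ^ 2).trans (half_sq_norm_le_bregman hw hx hy)

/-- `w` need not be differentiable, so the optimality condition is obtained from the subgradients at
`u + s(y - u)`, where minimality gives the sign, and continuity of `w'` carries it to `s = 0`. -/
theorem isMinOn_variational (hw : IsDistanceGenerating X w w') {ζ : E →L[ℝ] ℝ}
    {u y : E} (hu : u ∈ X) (hmin : IsMinOn (fun v => w v + ζ v) X u) (hy : y ∈ X) :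
    0 ≤ (w' u + ζ) (y - u) := by
  have hseg : ∀ s : ℝ, 0 < s → s ≤ 1 → u + s • (y - u) ∈ X := by
    intro s h0 h1
    exact hw.strongConvexOn.1.add_smul_sub_mem hu hy ⟨h0.le, h1⟩
  have key : ∀ s : ℝ, 0 < s → s ≤ 1 → 0 ≤ (w' (u + s • (y - u)) + ζ) (y - u) := by
    intro s h0 h1
    have h2 := hw.subgradient _ (hseg s h0 h1) u hu
    have h3 : w u + ζ u ≤ w (u + s • (y - u)) + ζ (u + s • (y - u)) := hmin (hseg s h0 h1)
    have h4 : u - (u + s • (y - u)) = (-s) • (y - u) := by module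
    rw [h4, map_smul, smul_eq_mul] at h2
    rw [map_add ζ, map_smul, smul_eq_mul] at h3
    have h5 : 0 ≤ s * (w' (u + s • (y - u)) + ζ) (y - u) := by
      rw [add_apply]; linarith
    exact nonneg_of_mul_nonneg_right h5 h0
  have hlim : Filter.Tendsto (fun s : ℝ => (w' (u + s • (y - u)) + ζ) (y - u))
      (nhdsWithin 0 (Set.Ioc 0 1)) (nhds ((w' u + ζ) (y - u))) := by
    have h1 : Filter.Tendsto (fun s : ℝ => u + s • (y - u)) (nhdsWithin 0 (Set.Ioc 0 1))
        (nhdsWithin u X) := by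
      refine tendsto_nhdsWithin_iff.2 ⟨?_, ?_⟩
      · have : Continuous fun s : ℝ => u + s • (y - u) := by fun_prop
        have h := this.tendsto 0
        simp only [zero_smul, add_zero] at h
        exact h.mono_left nhdsWithin_le_nhds
      · filter_upwards [self_mem_nhdsWithin] with s hs using hseg s hs.1 hs.2
    have h2 := (hw.continuousOn u hu).tendsto.comp h1
    have h3 : Continuous fun φ : E →L[ℝ] ℝ => (φ + ζ) (y - u) := by fun_prop
    exact (h3.tendsto _).comp h2
  have hne : (nhdsWithin (0 : ℝ) (Set.Ioc 0 1)).NeBot := by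
    rw [nhdsWithin_Ioc_eq_nhdsGT zero_lt_one]; infer_instance
  refine ge_of_tendsto hlim ?_
  filter_upwards [self_mem_nhdsWithin] with s hs using key s hs.1 hs.2

/-- The prox value depends on `x` and `ξ` only through `ξ - w' x`; this is what makes it a
continuous function of a single functional later on. -/
theorem isProx_iff {x u : E} {ξ : E →L[ℝ] ℝ} :
    IsProx X w w' x ξ u ↔ u ∈ X ∧ IsMinOn (fun y => w y + (ξ - w' x) y) X u := by
  have h : ∀ y, bregman w w' x y + ξ y = w y + (ξ - w' x) y + (w' x x - w x) := by
    intro y; simp only [bregman, map_sub, sub_apply]; ring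
  simp only [IsProx, isMinOn_iff, h, add_le_add_iff_right]

theorem IsProx.three_point (hw : IsDistanceGenerating X w w') {x u y : E} {ξ : E →L[ℝ] ℝ}
    (hu : IsProx X w w' x ξ u) (hy : y ∈ X) :
    ξ (u - y) ≤ bregman w w' x y - bregman w w' u y - bregman w w' x u := by
  rw [isProx_iff] at hu
  have h := isMinOn_variational hw hu.1 hu.2 hy
  simp only [bregman, add_apply, sub_apply, map_sub] at h ⊢
  linarith

/-- Adding the two variational inequalities bounds the sum of the two Bregman distances, at least
`‖u - u'‖²`, by `(ζ - ζ')(u' - u)`. This yields both uniqueness and continuity of the prox map. -/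
theorem norm_sub_le_of_isMinOn (hw : IsDistanceGenerating X w w') {ζ ζ' : E →L[ℝ] ℝ} {u u' : E}
    (hu : u ∈ X) (hmin : IsMinOn (fun v => w v + ζ v) X u) (hu' : u' ∈ X)
    (hmin' : IsMinOn (fun v => w v + ζ' v) X u') : ‖u - u'‖ ≤ ‖ζ - ζ'‖ := by
  have h1 := isMinOn_variational hw hu hmin hu'
  have h2 := isMinOn_variational hw hu' hmin' hu
  have h3 := half_sq_norm_le_bregman hw hu hu'
  have h4 := half_sq_norm_le_bregman hw hu' hu
  have h5 : (ζ - ζ') (u' - u) ≤ ‖ζ - ζ'‖ * ‖u - u'‖ := by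
    rw [norm_sub_rev u u']
    exact (le_abs_self _).trans ((ζ - ζ').le_opNorm _)
  rw [norm_sub_rev u' u] at h3
  have h6 : ‖u - u'‖ * ‖u - u'‖ ≤ ‖ζ - ζ'‖ * ‖u - u'‖ := by
    simp only [bregman, add_apply, sub_apply, map_sub] at h1 h2 h3 h4 h5 ⊢
    linarith
  rcases (norm_nonneg (u - u')).eq_or_lt with h0 | h0
  · rw [← h0]; exact norm_nonneg _
  · exact le_of_mul_le_mul_right h6 h0

theorem IsDistanceGenerating.continuousOn_fun (hw : IsDistanceGenerating X w w') :
    ContinuousOn w X := by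
  intro x hx
  rw [ContinuousWithinAt, tendsto_iff_dist_tendsto_zero]
  have hlow : ∀ y ∈ X, dist (w y) (w x) ≤ (‖w' x‖ + ‖w' y‖) * ‖y - x‖ := by
    intro y hy
    have h1 := hw.subgradient x hx y hy
    have h2 := hw.subgradient y hy x hx
    have h3 := (abs_le.1 ((w' x).le_opNorm (y - x))).1
    have h4 := (abs_le.1 ((w' y).le_opNorm (x - y))).1
    rw [norm_sub_rev x y] at h4
    have h5 : 0 ≤ ‖w' x‖ * ‖y - x‖ := by positivity
    have h6 : 0 ≤ ‖w' y‖ * ‖y - x‖ := by positivity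
    rw [Real.dist_eq, abs_le]
    constructor <;> linarith
  have hlim : Filter.Tendsto (fun y => (‖w' x‖ + ‖w' y‖) * ‖y - x‖) (nhdsWithin x X) (nhds 0) := by
    have h1 : ContinuousWithinAt (fun y => (‖w' x‖ + ‖w' y‖) * ‖y - x‖) X x := by
      refine ContinuousWithinAt.mul (continuousWithinAt_const.add (hw.continuousOn x hx).norm) ?_
      fun_prop
    have := h1.tendsto
    simpa using this
  refine squeeze_zero' (Filter.Eventually.of_forall fun _ => dist_nonneg) ?_ hlim
  filter_upwards [self_mem_nhdsWithin] with y hy using hlow y hy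

variable {f : E → ℝ} {L : ℝ}

/-- Convexity is used twice through the midpoint `m`, with gradients at `y` and `m`, each weighted
by one half. Replacing them by the gradient at `x` costs `L/2` and `L/4`, hence `3/4` instead of the
sharp `1/2`, with no integration along the segment. -/
theorem IsSmoothOn.le_add (hX : Convex ℝ X) (hf : IsSmoothOn X f L)
    (hc : IsGradConvexOn X f) {x y : E} (hx : x ∈ X) (hy : y ∈ X) :
    f y ≤ f x + fderiv ℝ f x (y - x) + 3 / 4 * L * ‖y - x‖ ^ 2 := by
  set m := x + (1 / 2 : ℝ) • (y - x) with hm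
  have hmX : m ∈ X := hX.add_smul_sub_mem hx hy ⟨by norm_num, by norm_num⟩
  have h1 := hc m hmX y hy
  have h2 := hc x hx m hmX
  have e1 : m - y = (-(1 / 2 : ℝ)) • (y - x) := by rw [hm]; module
  have e2 : x - m = (-(1 / 2 : ℝ)) • (y - x) := by rw [hm]; module
  rw [e1, map_smul, smul_eq_mul] at h1
  rw [e2, map_smul, smul_eq_mul] at h2
  have h3 : (fderiv ℝ f y - fderiv ℝ f x) (y - x) ≤ L * ‖y - x‖ * ‖y - x‖ :=
    (le_abs_self _).trans (((fderiv ℝ f y - fderiv ℝ f x).le_opNorm _).trans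
      (mul_le_mul_of_nonneg_right (hf.2 y hy x hx) (norm_nonneg _)))
  have h4 : (fderiv ℝ f m - fderiv ℝ f x) (y - x) ≤ L * ‖m - x‖ * ‖y - x‖ :=
    (le_abs_self _).trans (((fderiv ℝ f m - fderiv ℝ f x).le_opNorm _).trans
      (mul_le_mul_of_nonneg_right (hf.2 m hmX x hx) (norm_nonneg _)))
  have e3 : m - x = (1 / 2 : ℝ) • (y - x) := by rw [hm]; module
  rw [e3, norm_smul, Real.norm_of_nonneg (by norm_num)] at h4
  simp only [sub_apply] at h3 h4
  linarith

/-- Since `xf' - xg = β⁻¹(x' - x)`, the condition `2γL ≤ β` reduces the smoothness term to `3/8‖x' -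
x‖²`. The prox inequality supplies `-1/2‖x' - x‖²`, and the spare `1/8` absorbs the gradient error
by Young. The error is then paired with `x - u` instead of `x' - u`, and `x` is known before the
samples. -/
theorem mirror_step (hX : Convex ℝ X) (hw : IsDistanceGenerating X w w')
    (hf : IsSmoothOn X f L) (hc : IsGradConvexOn X f) {β γ : ℝ} (hβ : 1 ≤ β) (hγ : 0 < γ)
    (hβγ : 2 * γ * L ≤ β) {x x' xg xf xf' u : E} {G : E →L[ℝ] ℝ} (hx : x ∈ X) (hxg : xg ∈ X)
    (hxf : xf ∈ X) (hxf' : xf' ∈ X) (hu : u ∈ X) (hxge : xg = β⁻¹ • x + (1 - β⁻¹) • xf)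
    (hx' : IsProx X w w' x (γ • G) x') (hxfe : xf' = β⁻¹ • x' + (1 - β⁻¹) • xf) :
    β * γ * (f xf' - f u) + bregman w w' x' u ≤ (β - 1) * γ * (f xf - f u) + bregman w w' x u +
      (2 * γ ^ 2 * ‖G - fderiv ℝ f xg‖ ^ 2 + γ * (fderiv ℝ f xg - G) (x - u)) := by
  have hβ0 : 0 < β := by linarith
  set g := fderiv ℝ f xg with hg
  have h1 := hf.le_add hX hc hxg hxf'
  have e1 : xf' - xg = β⁻¹ • (x' - x) := by rw [hxge, hxfe]; module
  rw [← hg, e1, map_smul, smul_eq_mul, norm_smul, Real.norm_of_nonneg (by positivity)] at h1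
  have h2 : β * γ * f xf' ≤ β * γ * f xg + γ * g (x' - x) + 3 / 8 * ‖x' - x‖ ^ 2 := by
    have h := mul_le_mul_of_nonneg_left h1 (by positivity : 0 ≤ β * γ)
    have e : β * γ * (f xg + β⁻¹ * g (x' - x) + 3 / 4 * L * (β⁻¹ * ‖x' - x‖) ^ 2)
        = β * γ * f xg + γ * g (x' - x) + 3 / 8 * (2 * γ * L / β) * ‖x' - x‖ ^ 2 := by
      field_simp; ring
    rw [e] at h
    have h' : 2 * γ * L / β ≤ 1 := (div_le_one hβ0).2 hβγ
    have := mul_le_mul_of_nonneg_right h' (sq_nonneg ‖x' - x‖)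
    linarith
  have h3 := hx'.three_point hw hu
  have h4 := half_sq_norm_le_bregman hw hx hx'.1
  have h5 : γ * (g - G) (x' - x) ≤ 2 * γ ^ 2 * ‖G - g‖ ^ 2 + 1 / 8 * ‖x' - x‖ ^ 2 := by
    have h := (le_abs_self _).trans ((g - G).le_opNorm (x' - x))
    rw [norm_sub_rev] at h
    have := mul_le_mul_of_nonneg_left h hγ.le
    nlinarith [sq_nonneg (2 * γ * ‖G - g‖ - 1 / 2 * ‖x' - x‖)]
  have h6 := hc u hu xg hxg
  have h7 := hc xf hxf xg hxg
  -- This form of the coupling lets convexity be applied at `xg` towards both `u` and `xf`, the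
  -- latter with weight `β - 1`.
  have e2 : u - x = (u - xg) + (β - 1) • (xf - xg) := by
    have : β • xg = x + (β - 1) • xf := by
      rw [hxge, smul_add, smul_smul, smul_smul, mul_inv_cancel₀ hβ0.ne', one_smul, mul_sub,
        mul_inv_cancel₀ hβ0.ne', mul_one]
    have h' : x = β • xg - (β - 1) • xf := by rw [this]; abel
    conv_lhs => rw [h']
    module
  have h8 : γ * g (u - x) ≤ γ * (f u - f xg) + (β - 1) * γ * (f xf - f xg) := by
    rw [e2, map_add, map_smul, smul_eq_mul]
    nlinarith [mul_nonneg (by linarith : (0 : ℝ) ≤ β - 1) hγ.le]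
  simp only [smul_apply, smul_eq_mul, map_sub, sub_apply] at *
  nlinarith

end MirrorDescent

/-! ### Telescoping along a run -/

section Run

variable {E S : Type*} [NormedAddCommGroup E] [NormedSpace ℝ E] {X : Set E} {w : E → ℝ}
  {w' : E → E →L[ℝ] ℝ} {F : E → S → ℝ} {γ β : ℕ → ℝ} {B : ℕ} {M : ℝ} {x0 : E} {z : ℕ → S}
  {J : ℕ → ℕ} {x xg xf : ℕ → E}

theorem IsRun.mem (hrun : IsRun X w w' F γ β B M x0 z J x xg xf) (hX : Convex ℝ X) (hx0 : x0 ∈ X)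
    (hβ : ∀ t, 1 ≤ β t) (t : ℕ) : x t ∈ X ∧ xf t ∈ X ∧ xg t ∈ X := by
  have hcomb : ∀ t, ∀ a ∈ X, ∀ b ∈ X, (β t)⁻¹ • a + (1 - (β t)⁻¹) • b ∈ X := by
    intro t a ha b hb
    have := inv_le_one_of_one_le₀ (hβ t)
    exact hX ha hb (inv_nonneg.2 (by linarith [hβ t])) (by linarith) (by ring)
  have h : x t ∈ X ∧ xf t ∈ X := by
    induction t with
    | zero => rw [hrun.x_zero, hrun.xf_zero]; exact ⟨hx0, hx0⟩
    | succ t ih =>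
      refine ⟨(hrun.x_succ t).1, ?_⟩
      rw [hrun.xf_succ]
      exact hcomb t _ (hrun.x_succ t).1 _ ih.2
  refine ⟨h.1, h.2, ?_⟩
  rw [hrun.xg_eq]
  exact hcomb t _ h.1 _ h.2

theorem IsRun.gap_le (hrun : IsRun X w w' F γ β B M x0 z J x xg xf) (hX : Convex ℝ X)
    (hw : IsDistanceGenerating X w w') {f : E → ℝ} {L : ℝ}
    (hf : IsSmoothOn X f L) (hc : IsGradConvexOn X f) (hx0 : x0 ∈ X) (hγ : ∀ t, 0 < γ t)
    (hβ : ∀ t, 1 ≤ β t) (hβ0 : β 0 = 1)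
    (hβγ : ∀ t, (β (t + 1) - 1) * γ (t + 1) ≤ β t * γ t) (hL' : ∀ t, 2 * γ t * L ≤ β t)
    {u : E} (hu : u ∈ X) (hmin : ∀ y ∈ X, f u ≤ f y) (T : ℕ) :
    (β T - 1) * γ T * (f (xf T) - f u) ≤ bregman w w' x0 u + ∑ t ∈ Finset.range T,
      (2 * γ t ^ 2 * ‖multilevelGrad F B M z (sampleCount B J t) (xg t) (J t)
          - fderiv ℝ f (xg t)‖ ^ 2 +
        γ t * (fderiv ℝ f (xg t) - multilevelGrad F B M z (sampleCount B J t) (xg t) (J t))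
          (x t - u)) := by
  -- The induction must carry the nonnegative Bregman term at time `T`, which is dropped only at the
  -- end.
  suffices h : (β T - 1) * γ T * (f (xf T) - f u) + bregman w w' (x T) u ≤
      bregman w w' x0 u + ∑ t ∈ Finset.range T,
      (2 * γ t ^ 2 * ‖multilevelGrad F B M z (sampleCount B J t) (xg t) (J t)
          - fderiv ℝ f (xg t)‖ ^ 2 +
        γ t * (fderiv ℝ f (xg t) - multilevelGrad F B M z (sampleCount B J t) (xg t) (J t))
          (x t - u)) by
    have := bregman_nonneg hw (hrun.mem hX hx0 hβ T).1 hu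
    linarith
  induction T with
  | zero => simp [hβ0, hrun.x_zero]
  | succ T ih =>
    obtain ⟨m1, m2, m3⟩ := hrun.mem hX hx0 hβ T
    obtain ⟨m1', m2', -⟩ := hrun.mem hX hx0 hβ (T + 1)
    have hs := mirror_step hX hw hf hc (hβ T) (hγ T) (hL' T) m1 m3 m2 m2' hu (hrun.xg_eq T)
      (hrun.x_succ T) (hrun.xf_succ T)
    rw [Finset.sum_range_succ]
    have := mul_le_mul_of_nonneg_right (hβγ T) (sub_nonneg.2 (hmin _ m2'))
    linarith

end Run

/-! ### Markov property relative to an enlarged history -/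

section MarkovProperty

variable {S Ω α : Type*} [MeasurableSpace S] [MeasurableSpace α]

/-- The information generated by the variable `U` and the first `n + 1` states of the chain. -/
@[reducible] def history (U : Ω → α) (Z : ℕ → Ω → S) (n : ℕ) : MeasurableSpace Ω :=
  MeasurableSpace.comap (fun ω => (U ω, fun i : Fin (n + 1) => Z i ω)) inferInstance

theorem history_mono (U : Ω → α) (Z : ℕ → Ω → S) {m n : ℕ} (h : m ≤ n) :
    history U Z m ≤ history U Z n := by
  have hφ : Measurable fun q : α × (Fin (n + 1) → S) =>
      (q.1, fun i : Fin (m + 1) => q.2 (Fin.castLE (by omega) i)) := by fun_prop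
  rintro _ ⟨R, hR, rfl⟩
  exact ⟨_, hφ hR, rfl⟩

theorem measurable_history_fst (U : Ω → α) (Z : ℕ → Ω → S) (n : ℕ) :
    Measurable[history U Z n] U :=
  measurable_fst.comp (comap_measurable _)

theorem measurable_history_chain (U : Ω → α) (Z : ℕ → Ω → S) {m n : ℕ} (h : m ≤ n) :
    Measurable[history U Z n] (Z m) :=
  ((measurable_pi_apply (⟨m, by omega⟩ : Fin (n + 1))).comp measurable_snd).comp
    (comap_measurable (fun ω => (U ω, fun i : Fin (n + 1) => Z i ω)))

variable [MeasurableSpace Ω]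

theorem history_le {U : Ω → α} {Z : ℕ → Ω → S} (hU : Measurable U) (hZ : ∀ n, Measurable (Z n))
    (n : ℕ) : history U Z n ≤ ‹MeasurableSpace Ω› :=
  Measurable.comap_le (hU.prodMk (measurable_pi_lambda _ fun i => hZ i))

variable {Q : Kernel S S} [IsMarkovKernel Q] {π : Measure S} {Z : ℕ → Ω → S} {P : Measure Ω}
  [IsProbabilityMeasure P]

/-- By independence, the law of the states up to `n + 1` given `U` does not depend on `U`, and it
disintegrates along `Q`; the first `n + 1` states can then be moved to the conditioning side. -/
theorem IsStationaryMarkovChain.hasCondDistrib_of_indepFun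
    (hZ : IsStationaryMarkovChain Q π Z P) {U : Ω → α} (hU : Measurable U)
    (hUZ : IndepFun U (fun ω n => Z n ω) P) (n : ℕ) :
    HasCondDistrib (Z (n + 1)) (fun ω => (U ω, fun i : Fin (n + 1) => Z i ω))
      (Q.comap (fun q : α × (Fin (n + 1) → S) => q.2 (Fin.last n)) (by fun_prop)) P := by
  set κ : Kernel (Fin (n + 1) → S) S :=
    Q.comap (fun h : Fin (n + 1) → S => h (Fin.last n)) (measurable_pi_apply _) with hκ
  have hh : Measurable fun ω => (fun i : Fin (n + 1) => Z i ω) :=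
    measurable_pi_lambda _ fun i => hZ.measurable i
  have hmeas : Measurable fun ω => ((fun i : Fin (n + 1) => Z i ω), Z (n + 1) ω) :=
    hh.prodMk (hZ.measurable _)
  have hind : IndepFun U (fun ω => ((fun i : Fin (n + 1) => Z i ω), Z (n + 1) ω)) P := by
    have hφ : Measurable fun z : ℕ → S => ((fun i : Fin (n + 1) => z i), z (n + 1)) := by fun_prop
    exact hUZ.comp measurable_id hφ
  have : IsProbabilityMeasure (P.map fun ω => (fun i : Fin (n + 1) => Z i ω)) :=
    Measure.isProbabilityMeasure_map hh.aemeasurable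
  have : IsProbabilityMeasure (P.map U) := Measure.isProbabilityMeasure_map hU.aemeasurable
  have h1 : HasCondDistrib (fun ω => ((fun i : Fin (n + 1) => Z i ω), Z (n + 1) ω)) U
      (Kernel.const α (P.map fun ω => (fun i : Fin (n + 1) => Z i ω)) ⊗ₖ
        (Q.comap (fun q : α × (Fin (n + 1) → S) => q.2 (Fin.last n)) (by fun_prop))) P := by
    refine ⟨(hU.prodMk hmeas).aemeasurable, ?_⟩
    rw [(indepFun_iff_map_prod_eq_prod_map_map hU.aemeasurable hmeas.aemeasurable).1 hind,
      (hZ.transition n).map_eq, ← Measure.compProd_const]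
    congr 1
    ext a s hs
    rw [Kernel.const_apply, Measure.compProd_apply hs, Kernel.compProd_apply hs, Kernel.const_apply]
    rfl
  exact h1.of_compProd

theorem IsStationaryMarkovChain.setLIntegral_succ (hZ : IsStationaryMarkovChain Q π Z P)
    {U : Ω → α} (hU : Measurable U) (hUZ : IndepFun U (fun ω n => Z n ω) P) {n : ℕ} {A : Set Ω}
    (hA : MeasurableSet[history U Z n] A) {g : S → ℝ≥0∞} (hg : Measurable g) :
    ∫⁻ ω in A, g (Z (n + 1) ω) ∂P = ∫⁻ ω in A, ∫⁻ z, g z ∂(Q (Z n ω)) ∂P := by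
  have hAm := history_le hU hZ.measurable n A hA
  obtain ⟨R, hR, rfl⟩ := hA
  set H : Ω → α × (Fin (n + 1) → S) := fun ω => (U ω, fun i : Fin (n + 1) => Z i ω) with hH
  have hHm : Measurable H := hU.prodMk (measurable_pi_lambda _ fun i => hZ.measurable i)
  have h := hZ.hasCondDistrib_of_indepFun hU hUZ n
  have hu : Measurable fun q : (α × (Fin (n + 1) → S)) × S =>
      R.indicator (fun _ => (1 : ℝ≥0∞)) q.1 * g q.2 :=
    ((measurable_const.indicator hR).comp measurable_fst).mul (hg.comp measurable_snd)
  have h1 : ∫⁻ q, R.indicator (fun _ => (1 : ℝ≥0∞)) q.1 * g q.2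
      ∂(P.map fun ω => (H ω, Z (n + 1) ω)) = ∫⁻ ω in H ⁻¹' R, g (Z (n + 1) ω) ∂P := by
    rw [lintegral_map hu (hHm.prodMk (hZ.measurable _)), ← lintegral_indicator hAm]
    refine lintegral_congr fun ω => ?_
    by_cases hω : H ω ∈ R
    · simp [Set.indicator, hω]
    · simp [Set.indicator, hω]
  rw [← h1, h.map_eq, Measure.lintegral_compProd hu,
    lintegral_map (Measurable.lintegral_kernel_prod_right' hu) hHm, ← lintegral_indicator hAm]
  refine lintegral_congr fun ω => ?_
  have hQ : (Q.comap (fun q : α × (Fin (n + 1) → S) => q.2 (Fin.last n)) (by fun_prop)) (H ω)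
      = Q (Z n ω) := by
    rw [Kernel.comap_apply]; simp [hH]
  rw [hQ]
  by_cases hω : H ω ∈ R
  · simp [Set.indicator, hω]
  · simp [Set.indicator, hω]

theorem IsStationaryMarkovChain.setLIntegral_add (hZ : IsStationaryMarkovChain Q π Z P)
    {U : Ω → α} (hU : Measurable U) (hUZ : IndepFun U (fun ω n => Z n ω) P) {m : ℕ} {A : Set Ω}
    (hA : MeasurableSet[history U Z m] A) (k : ℕ) {g : S → ℝ≥0∞} (hg : Measurable g) :
    ∫⁻ ω in A, g (Z (m + k) ω) ∂P = ∫⁻ ω in A, ∫⁻ z, g z ∂((Q ^ k) (Z m ω)) ∂P := by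
  induction k generalizing g with
  | zero =>
    refine lintegral_congr fun ω => ?_
    have : (Q ^ 0) (Z m ω) = Measure.dirac (Z m ω) := by
      rw [pow_zero]; exact Kernel.id_apply _
    rw [this, lintegral_dirac' _ hg]; rfl
  | succ k ih =>
    rw [← add_assoc, hZ.setLIntegral_succ hU hUZ (history_mono U Z (Nat.le_add_right m k) A hA) hg,
      ih (Measurable.lintegral_kernel hg)]
    refine lintegral_congr fun ω => ?_
    have : Q ^ (k + 1) = Q.comp (Q ^ k) := pow_succ' Q k
    rw [this, Kernel.lintegral_comp _ _ _ hg]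

instance isMarkovKernel_pow (Q : Kernel S S) [IsMarkovKernel Q] (k : ℕ) :
    IsMarkovKernel (Q ^ k) := by
  induction k with
  | zero => rw [pow_zero]; exact inferInstanceAs (IsMarkovKernel Kernel.id)
  | succ k ih =>
    have : Q ^ (k + 1) = Q.comp (Q ^ k) := pow_succ' Q k
    rw [this]; infer_instance

/-- The integrand may also depend on a quantity `W` known at time `m`. The joint law of `((W, Z_m),
Z_{m+k})` on `A` is identified on rectangles, where the part concerning `W` is absorbed into the
event. -/
theorem IsStationaryMarkovChain.setIntegral_add (hZ : IsStationaryMarkovChain Q π Z P)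
    {U : Ω → α} (hU : Measurable U) (hUZ : IndepFun U (fun ω n => Z n ω) P) {m : ℕ} {A : Set Ω}
    (hA : MeasurableSet[history U Z m] A) (k : ℕ) {δ : Type*} [MeasurableSpace δ] {W : Ω → δ}
    (hW : Measurable[history U Z m] W) {u : δ × S → ℝ} (hu : Measurable u) {b : ℝ}
    (hb : ∀ ω z, |u (W ω, z)| ≤ b) :
    ∫ ω in A, u (W ω, Z (m + k) ω) ∂P = ∫ ω in A, ∫ z, u (W ω, z) ∂((Q ^ k) (Z m ω)) ∂P := by
  have hle := history_le hU hZ.measurable m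
  have hWm : Measurable W := hW.mono hle le_rfl
  have hZm := hZ.measurable
  set κ : Kernel (δ × S) S := (Q ^ k).comap Prod.snd measurable_snd with hκ
  have : IsFiniteMeasure ((P.restrict A).map fun ω => (W ω, Z m ω)) := inferInstance
  have hlaw : (P.restrict A).map (fun ω => ((W ω, Z m ω), Z (m + k) ω))
      = ((P.restrict A).map fun ω => (W ω, Z m ω)) ⊗ₘ κ := by
    refine Measure.ext_prod_iff.2 fun {s t} hs ht => ?_
    have hpre : MeasurableSet[history U Z m] ((fun ω => (W ω, Z m ω)) ⁻¹' s) :=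
      (hW.prodMk (measurable_history_chain U Z le_rfl)) hs
    have hAm := hle A hA
    rw [Measure.map_apply (by fun_prop) (hs.prod ht), Measure.compProd_apply_prod hs ht,
      setLIntegral_map hs (Kernel.measurable_coe κ ht) (by fun_prop),
      Measure.restrict_restrict (hle _ hpre)]
    have h1 := hZ.setLIntegral_add hU hUZ (hpre.inter hA) k
      (g := t.indicator fun _ => 1) (measurable_const.indicator ht)
    have h2 : ∀ ω, ∫⁻ z, t.indicator (fun _ => (1 : ℝ≥0∞)) z ∂((Q ^ k) (Z m ω))
        = κ (W ω, Z m ω) t := by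
      intro ω
      rw [lintegral_indicator ht, setLIntegral_const, one_mul, hκ, Kernel.comap_apply]
    simp_rw [h2] at h1
    rw [← h1]
    have h3 : ∀ ω, t.indicator (fun _ => (1 : ℝ≥0∞)) (Z (m + k) ω)
        = ((Z (m + k)) ⁻¹' t).indicator (fun _ => 1) ω := fun ω => rfl
    simp_rw [h3]
    rw [lintegral_indicator (hZm _ ht), setLIntegral_const, one_mul,
      Measure.restrict_apply (hZm _ ht), Measure.restrict_apply
        ((by fun_prop : Measurable fun ω => ((W ω, Z m ω), Z (m + k) ω)) (hs.prod ht))]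
    congr 1
    ext ω
    simp only [Set.mem_inter_iff, Set.mem_preimage, Set.mem_prod]
    tauto
  have hv : Measurable fun q : (δ × S) × S => u (q.1.1, q.2) := by fun_prop
  have hmm : Measurable fun ω => ((W ω, Z m ω), Z (m + k) ω) := by fun_prop
  have hint : Integrable (fun q : (δ × S) × S => u (q.1.1, q.2))
      ((P.restrict A).map (fun ω => ((W ω, Z m ω), Z (m + k) ω))) := by
    rw [integrable_map_measure hv.aestronglyMeasurable hmm.aemeasurable]
    exact Integrable.of_bound (hv.comp hmm).aestronglyMeasurable b
      (Filter.Eventually.of_forall fun ω => by simpa using hb ω _)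
  have e1 : ∫ ω in A, u (W ω, Z (m + k) ω) ∂P = ∫ q, u (q.1.1, q.2)
      ∂((P.restrict A).map (fun ω => ((W ω, Z m ω), Z (m + k) ω))) := by
    rw [integral_map hmm.aemeasurable hv.aestronglyMeasurable]
  have hint' := hint
  rw [hlaw] at hint'
  rw [e1, hlaw, Measure.integral_compProd hint', integral_map (by fun_prop)]
  · rfl
  · exact (hv.stronglyMeasurable.integral_kernel_prod_right').aestronglyMeasurable

end MarkovProperty

/-! ### Mixing estimates -/

section TotalVariation

variable {S : Type*} [MeasurableSpace S]

/-- Layer cake: `u + b` takes values in `[0, 2b]`, so its integral is the integral over that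
interval of the masses of superlevel sets, which differ by at most `ε`. -/
theorem abs_integral_sub_integral_le {μ ν : Measure S} [IsProbabilityMeasure μ]
    [IsProbabilityMeasure ν] {ε : ℝ} (h : ∀ A, MeasurableSet A → |μ.real A - ν.real A| ≤ ε)
    {u : S → ℝ} (hu : Measurable u) {b : ℝ} (hb : ∀ z, |u z| ≤ b) :
    |∫ z, u z ∂μ - ∫ z, u z ∂ν| ≤ 2 * b * ε := by
  have hS : Nonempty S := by
    by_contra hS
    rw [not_nonempty_iff] at hS
    have h1 : μ Set.univ = 0 := by rw [Set.univ_eq_empty_iff.2 hS, measure_empty]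
    rw [measure_univ] at h1; exact one_ne_zero h1
  have hb0 : 0 ≤ b := (abs_nonneg _).trans (hb hS.some)
  have hint : ∀ ρ : Measure S, IsProbabilityMeasure ρ → Integrable u ρ := fun ρ _ =>
    Integrable.of_bound hu.aestronglyMeasurable b (Filter.Eventually.of_forall fun z => by simpa using hb z)
  have hform : ∀ ρ : Measure S, IsProbabilityMeasure ρ →
      ∫ z, u z ∂ρ + b = ∫ s in Set.Ioc 0 (2 * b), ρ.real {z | s ≤ u z + b} := by
    intro ρ hρ
    have h1 : ∫ z, (u z + b) ∂ρ = ∫ z, u z ∂ρ + b := by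
      rw [integral_add (hint ρ hρ) (integrable_const _)]; simp
    rw [← h1]
    refine Integrable.integral_eq_integral_Ioc_meas_le (M := 2 * b)
      ((hint ρ hρ).add (integrable_const _)) (Filter.Eventually.of_forall fun z => ?_)
      (Filter.Eventually.of_forall fun z => ?_)
    · have := (abs_le.1 (hb z)).1; simp only [Pi.zero_apply]; linarith
    · have := (abs_le.1 (hb z)).2; simp only; linarith
  have hanti : ∀ ρ : Measure S, IsProbabilityMeasure ρ →
      IntegrableOn (fun s => ρ.real {z | s ≤ u z + b}) (Set.Ioc 0 (2 * b)) := by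
    intro ρ hρ
    have hA : Antitone fun s => ρ.real {z | s ≤ u z + b} := fun s t hst =>
      measureReal_mono fun z hz => hst.trans hz
    refine Integrable.of_bound hA.measurable.aestronglyMeasurable 1
      (Filter.Eventually.of_forall fun s => ?_)
    rw [Real.norm_of_nonneg measureReal_nonneg]
    exact measureReal_le_one
  have h1 : ∫ z, u z ∂μ - ∫ z, u z ∂ν
      = ∫ s in Set.Ioc 0 (2 * b), (μ.real {z | s ≤ u z + b} - ν.real {z | s ≤ u z + b}) := by
    rw [integral_sub (hanti μ inferInstance) (hanti ν inferInstance), ← hform μ inferInstance,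
      ← hform ν inferInstance]
    ring
  rw [h1, ← Real.norm_eq_abs]
  refine (norm_setIntegral_le_of_norm_le_const (C := ε) measure_Ioc_lt_top fun s _ => ?_).trans ?_
  · exact h _ (measurableSet_le measurable_const (hu.add_const b))
  · rw [Real.volume_real_Ioc_of_le (by linarith)]
    linarith

end TotalVariation

section Mixing

variable {S Ω α : Type*} [MeasurableSpace S] [MeasurableSpace α] [MeasurableSpace Ω]
  {Q : Kernel S S} [IsMarkovKernel Q] {π : Measure S} [IsProbabilityMeasure π] {Z : ℕ → Ω → S}
  {P : Measure Ω} [IsProbabilityMeasure P]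

/-- A bounded function that is centred under `π` in its second variable is almost centred along the
chain, `k` steps after the time at which its first variable is known. -/
theorem IsStationaryMarkovChain.abs_setIntegral_le (hZ : IsStationaryMarkovChain Q π Z P)
    {C τ : ℝ} (hQ : UniformlyGeometricallyErgodic Q π C τ)
    {U : Ω → α} (hU : Measurable U) (hUZ : IndepFun U (fun ω n => Z n ω) P) {m : ℕ} {A : Set Ω}
    (hA : MeasurableSet[history U Z m] A) {k : ℕ} (hk : 0 < k) {δ : Type*} [MeasurableSpace δ]
    {W : Ω → δ} (hW : Measurable[history U Z m] W) {u : δ × S → ℝ} (hu : Measurable u) {b : ℝ}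
    (hb : ∀ ω z, |u (W ω, z)| ≤ b) (hπ : ∀ ω, ∫ z, u (W ω, z) ∂π = 0) :
    |∫ ω in A, u (W ω, Z (m + k) ω) ∂P|
      ≤ 2 * b * (C * (1 / 2 : ℝ) ^ ((k : ℝ) / τ)) * P.real A := by
  rw [hZ.setIntegral_add hU hUZ hA k hW hu hb, ← Real.norm_eq_abs]
  refine norm_setIntegral_le_of_norm_le_const (measure_lt_top _ _) fun ω _ => ?_
  have h := abs_integral_sub_integral_le (μ := (Q ^ k) (Z m ω)) (ν := π)
    (fun A hA => hQ k hk (Z m ω) A hA) (hu.comp (measurable_const.prodMk measurable_id)) (hb ω)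
  simpa [hπ ω] using h

/-- Bernoulli's inequality for the exponent `1/τ ≤ 1` gives a ratio of at most `1 - 1/(2τ)`, so the
geometric series is at most `2τ`. -/
theorem sum_geometric_mixing_le {τ : ℝ} (hτ : 1 ≤ τ) (n : ℕ) :
    ∑ k ∈ Finset.range n, (1 / 2 : ℝ) ^ (((k + 1 : ℕ) : ℝ) / τ) ≤ 2 * τ := by
  set ρ : ℝ := (1 / 2 : ℝ) ^ (1 / τ) with hρ
  have hρ0 : 0 < ρ := Real.rpow_pos_of_pos (by norm_num) _
  have hρ1 : ρ ≤ 1 - 1 / (2 * τ) := by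
    have h2 : 1 + (1 / τ) * (-(1 / 2) : ℝ) ≥ (1 + (-(1 / 2) : ℝ)) ^ (1 / τ) :=
      rpow_one_add_le_one_add_mul_self (by norm_num) (by positivity)
        ((div_le_one (by linarith)).2 hτ)
    have h3 : (1 + (-(1 / 2) : ℝ)) = 1 / 2 := by norm_num
    rw [h3] at h2
    calc ρ ≤ _ := h2
      _ = _ := by field_simp; ring
  have hlt : ρ < 1 := hρ1.trans_lt (by have : 0 < 1 / (2 * τ) := by positivity
                                       linarith)
  have hterm : ∀ k : ℕ, (1 / 2 : ℝ) ^ ((k : ℝ) / τ) = ρ ^ k := by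
    intro k
    rw [hρ, ← Real.rpow_natCast, ← Real.rpow_mul (by norm_num)]
    congr 1; ring
  simp_rw [hterm]
  have h1 : ∑ k ∈ Finset.range n, ρ ^ (k + 1) ≤ ∑ k ∈ Finset.range n, ρ ^ k :=
    Finset.sum_le_sum fun k _ => pow_le_pow_of_le_one hρ0.le hlt.le (Nat.le_succ k)
  have h2 : (∑ k ∈ Finset.range n, ρ ^ k) * (1 - ρ) ≤ 1 := by
    rw [geom_sum_mul_neg]; linarith [pow_pos hρ0 n]
  have h3 : 1 / (2 * τ) ≤ 1 - ρ := by linarith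
  have h4 : 0 ≤ ∑ k ∈ Finset.range n, ρ ^ k := Finset.sum_nonneg fun _ _ => by positivity
  have h5 := (mul_le_mul_of_nonneg_left h3 h4).trans h2
  rw [mul_one_div, div_le_one (by positivity)] at h5
  linarith

end Mixing

/-! ### Bias and second moment of sums along the chain -/

section PartialSums

variable {S Ω α δ : Type*} [MeasurableSpace S] [MeasurableSpace α] [MeasurableSpace δ]
  {Z : ℕ → Ω → S} {U : Ω → α} {W : Ω → δ} {n : ℕ}

theorem measurable_history_sum {V : Type*} [NormedAddCommGroup V] [MeasurableSpace V]
    [BorelSpace V] [SecondCountableTopology V] (hW : Measurable[history U Z n] W) {Y : δ × S → V}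
    (hY : Measurable Y) {m k : ℕ} (h : n + m ≤ k) :
    Measurable[history U Z k] fun ω => ∑ i ∈ Finset.range m, Y (W ω, Z (n + (i + 1)) ω) := by
  refine Finset.measurable_fun_sum _ fun i hi => ?_
  rw [Finset.mem_range] at hi
  refine hY.comp (Measurable.prodMk ?_ (measurable_history_chain U Z (by omega)))
  exact hW.mono (history_mono U Z (by omega)) le_rfl

theorem norm_sum_range_le {V : Type*} [NormedAddCommGroup V] {Y : ℕ → V} {s : ℝ}
    (hs : ∀ i, ‖Y i‖ ≤ s) (m : ℕ) : ‖∑ i ∈ Finset.range m, Y i‖ ≤ m * s :=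
  (norm_sum_le_of_le _ fun i _ => hs i).trans (by simp)

variable [MeasurableSpace Ω] {Q : Kernel S S} [IsMarkovKernel Q] {π : Measure S} [IsProbabilityMeasure π]
  {P : Measure Ω} [IsProbabilityMeasure P] {C τ : ℝ} {A : Set Ω}

/-- The biases of the terms decay geometrically, so the bound does not grow with `m`: averaging over
`m` samples will divide the bias by `m`. -/
theorem IsStationaryMarkovChain.abs_setIntegral_sum_le (hZ : IsStationaryMarkovChain Q π Z P)
    (hQ : UniformlyGeometricallyErgodic Q π C τ) (hC : 0 ≤ C) (hτ : 1 ≤ τ)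
    (hU : Measurable U) (hUZ : IndepFun U (fun ω n => Z n ω) P)
    (hA : MeasurableSet[history U Z n] A) (hW : Measurable[history U Z n] W) {u : δ × S → ℝ}
    (hu : Measurable u) {b : ℝ} (hb0 : 0 ≤ b) (hb : ∀ ω z, |u (W ω, z)| ≤ b)
    (hπ : ∀ ω, ∫ z, u (W ω, z) ∂π = 0) (m : ℕ) :
    |∫ ω in A, ∑ i ∈ Finset.range m, u (W ω, Z (n + (i + 1)) ω) ∂P|
      ≤ 4 * b * C * τ * P.real A := by
  have hWm : Measurable W := hW.mono (history_le hU hZ.measurable n) le_rfl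
  have hZm := hZ.measurable
  rw [integral_finsetSum]
  · calc _ ≤ ∑ i ∈ Finset.range m, |∫ ω in A, u (W ω, Z (n + (i + 1)) ω) ∂P| :=
        Finset.abs_sum_le_sum_abs _ _
      _ ≤ ∑ i ∈ Finset.range m,
          2 * b * (C * (1 / 2 : ℝ) ^ (((i + 1 : ℕ) : ℝ) / τ)) * P.real A :=
        Finset.sum_le_sum fun i _ =>
          hZ.abs_setIntegral_le hQ hU hUZ hA i.succ_pos hW hu hb hπ
      _ = 2 * b * C * (∑ i ∈ Finset.range m, (1 / 2 : ℝ) ^ (((i + 1 : ℕ) : ℝ) / τ))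
          * P.real A := by
        rw [Finset.mul_sum, Finset.sum_mul]; exact Finset.sum_congr rfl fun i _ => by ring
      _ ≤ 2 * b * C * (2 * τ) * P.real A := by
        gcongr
        exact sum_geometric_mixing_le hτ m
      _ = _ := by ring
  · intro i _
    refine Integrable.of_bound (hu.comp (hWm.prodMk (hZm _))).aestronglyMeasurable b (Filter.Eventually.of_forall fun ω => ?_)
    simpa using hb ω _

/-- Induction on `m` with the smoothness expansion: each step adds `2κs²` and a cross term whose
integral, by mixing, is at most `32κs²Cτ` times the mass of `A`. -/
theorem IsStationaryMarkovChain.setIntegral_sq_norm_sum_le (hZ : IsStationaryMarkovChain Q π Z P)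
    (hQ : UniformlyGeometricallyErgodic Q π C τ) (hC : 0 ≤ C) (hτ : 1 ≤ τ)
    (hU : Measurable U) (hUZ : IndepFun U (fun ω n => Z n ω) P)
    (hA : MeasurableSet[history U Z n] A) (hW : Measurable[history U Z n] W)
    {V : Type*} [NormedAddCommGroup V] [NormedSpace ℝ V] [FiniteDimensional ℝ V]
    [MeasurableSpace V] [BorelSpace V] [SecondCountableTopology V] {κ : ℝ} (hκ : 0 ≤ κ)
    (hV : IsTwoSmooth V κ) {Y : δ × S → V} (hY : Measurable Y) {s : ℝ} (hs0 : 0 ≤ s)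
    (hs : ∀ ω z, ‖Y (W ω, z)‖ ≤ s) (hπ : ∀ ω, ∫ z, Y (W ω, z) ∂π = 0) (m : ℕ) :
    ∫ ω in A, ‖∑ i ∈ Finset.range m, Y (W ω, Z (n + (i + 1)) ω)‖ ^ 2 ∂P
      ≤ 2 * κ * s ^ 2 * (1 + 16 * C * τ) * m * P.real A := by
  obtain ⟨ψ, hψ0, hψ, hψL⟩ := exists_lipschitz_subgradient hκ hV
  have hψc : Continuous ψ := by
    have : LipschitzWith (8 * κ).toNNReal ψ := LipschitzWith.of_dist_le_mul fun a b => by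
      rw [dist_eq_norm, dist_eq_norm, Real.coe_toNNReal _ (by positivity)]
      exact hψL b a
    exact this.continuous
  have hWm : Measurable W := hW.mono (history_le hU hZ.measurable n) le_rfl
  have hZm := hZ.measurable
  set R : ℕ → Ω → V := fun m ω => ∑ i ∈ Finset.range m, Y (W ω, Z (n + (i + 1)) ω) with hR
  have hRm : ∀ m, Measurable (R m) := fun m =>
    (measurable_history_sum (U := U) hW hY le_rfl).mono (history_le hU hZ.measurable _) le_rfl
  have hRb : ∀ m ω, ‖R m ω‖ ≤ m * s := fun m ω => norm_sum_range_le (fun i => hs ω _) m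
  have hRs : ∀ m ω, R (m + 1) ω = R m ω + Y (W ω, Z (n + (m + 1)) ω) := fun m ω =>
    Finset.sum_range_succ _ _
  have hcont : Continuous fun q : (V × V) × V => (ψ q.1.1 - ψ q.1.2) q.2 := by fun_prop
  have hum : Measurable fun q : (δ × V × V) × S =>
      (ψ q.1.2.1 - ψ q.1.2.2) (Y (q.1.1, q.2)) :=
    hcont.measurable.comp (f := fun q : (δ × V × V) × S => ((q.1.2.1, q.1.2.2), Y (q.1.1, q.2)))
      (by fun_prop)
  have hΔ : ∀ j ω, ‖ψ (R (j + 1) ω) - ψ (R j ω)‖ ≤ 8 * κ * s := by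
    intro j ω
    refine (hψL _ _).trans ?_
    rw [hRs, add_sub_cancel_left]
    exact mul_le_mul_of_nonneg_left (hs _ _) (by positivity)
  have hub : ∀ j ω z, |(ψ (R (j + 1) ω) - ψ (R j ω)) (Y (W ω, z))| ≤ 8 * κ * s * s := by
    intro j ω z
    exact (ContinuousLinearMap.le_opNorm _ _).trans
      (mul_le_mul (hΔ j ω) (hs ω z) (norm_nonneg _) (by positivity))
  have hint : ∀ ω, Integrable (fun z => Y (W ω, z)) π := fun ω =>
    Integrable.of_bound (hY.comp measurable_prodMk_left).aestronglyMeasurable s (Filter.Eventually.of_forall fun z => hs ω z)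
  have hcross : ∀ m, ∫ ω in A, ψ (R m ω) (Y (W ω, Z (n + (m + 1)) ω)) ∂P
      ≤ 32 * κ * s ^ 2 * C * τ * P.real A := by
    intro m
    -- `ψ(R_m)` is too recent, and too large, to be paired directly with the next noise. Its
    -- increments have norm at most `8κs`, and the `j`-th is known at time `n + j + 1`, a lag `m -
    -- j` before the noise.
    have e1 : ∀ ω, ψ (R m ω) (Y (W ω, Z (n + (m + 1)) ω)) = ∑ j ∈ Finset.range m,
        (ψ (R (j + 1) ω) - ψ (R j ω)) (Y (W ω, Z (n + (m + 1)) ω)) := by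
      intro ω
      rw [← sum_apply, Finset.sum_range_sub (fun j => ψ (R j ω))]
      have : R 0 ω = 0 := Finset.sum_range_zero _
      rw [this, hψ0, sub_zero]
    simp_rw [e1]
    rw [integral_finsetSum]
    · calc _ ≤ ∑ j ∈ Finset.range m, 2 * (8 * κ * s * s) *
            (C * (1 / 2 : ℝ) ^ (((m - 1 - j + 1 : ℕ) : ℝ) / τ)) * P.real A := by
            refine Finset.sum_le_sum fun j hj => ?_
            rw [Finset.mem_range] at hj
            have hWj : Measurable[history U Z (n + (j + 1))]
                fun ω => (W ω, R (j + 1) ω, R j ω) := by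
              refine Measurable.prodMk (hW.mono (history_mono U Z (by omega)) le_rfl) ?_
              exact Measurable.prodMk (measurable_history_sum hW hY le_rfl)
                (measurable_history_sum hW hY (by omega))
            have h := hZ.abs_setIntegral_le hQ hU hUZ
              (history_mono U Z (by omega : n ≤ n + (j + 1)) A hA)
              (Nat.succ_pos (m - 1 - j)) hWj hum (hub j) (fun ω => by
                have := ContinuousLinearMap.integral_comp_comm
                  (ψ (R (j + 1) ω) - ψ (R j ω)) (hint ω)
                rw [hπ ω, map_zero] at this
                exact this)
            have e2 : n + (j + 1) + (m - 1 - j).succ = n + (m + 1) := by omega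
            rw [e2] at h
            exact (le_abs_self _).trans h
        _ = 16 * κ * s ^ 2 * C * (∑ j ∈ Finset.range m,
            (1 / 2 : ℝ) ^ (((m - 1 - j + 1 : ℕ) : ℝ) / τ)) * P.real A := by
          rw [Finset.mul_sum, Finset.sum_mul]; exact Finset.sum_congr rfl fun i _ => by ring
        _ ≤ 16 * κ * s ^ 2 * C * (2 * τ) * P.real A := by
          rw [Finset.sum_range_reflect (fun k : ℕ => (1 / 2 : ℝ) ^ (((k + 1 : ℕ) : ℝ) / τ)) m]
          gcongr
          exact sum_geometric_mixing_le hτ m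
        _ = _ := by ring
    · intro j _
      refine Integrable.of_bound ?_ (8 * κ * s * s) (Filter.Eventually.of_forall fun ω => hub j ω _)
      exact (hum.comp (f := fun ω => ((W ω, R (j + 1) ω, R j ω), Z (n + (m + 1)) ω))
        (by fun_prop)).aestronglyMeasurable
  have hsqint : ∀ m, Integrable (fun ω => ‖R m ω‖ ^ 2) (P.restrict A) := fun m =>
    Integrable.of_bound (((hRm m).norm.pow_const 2).aestronglyMeasurable) ((m * s) ^ 2)
      (Filter.Eventually.of_forall fun ω => by
        rw [norm_pow, norm_norm]
        exact pow_le_pow_left₀ (norm_nonneg _) (hRb m ω) 2)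
  have hcrint : ∀ m, Integrable (fun ω => ψ (R m ω) (Y (W ω, Z (n + (m + 1)) ω)))
      (P.restrict A) := by
    intro m
    have hc : Continuous fun q : V × V => ψ q.1 q.2 := by fun_prop
    refine Integrable.of_bound (hc.measurable.comp
      (f := fun ω => (R m ω, Y (W ω, Z (n + (m + 1)) ω)))
      (by fun_prop)).aestronglyMeasurable (8 * κ * (m * s) * s)
      (Filter.Eventually.of_forall fun ω => ?_)
    refine (ContinuousLinearMap.le_opNorm _ _).trans
      (mul_le_mul ?_ (hs ω _) (norm_nonneg _) (by positivity))
    have := hψL 0 (R m ω)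
    rw [hψ0, sub_zero, sub_zero] at this
    exact this.trans (mul_le_mul_of_nonneg_left (hRb m ω) (by positivity))
  change ∫ ω in A, ‖R m ω‖ ^ 2 ∂P ≤ _
  induction m with
  | zero => simp [hR]
  | succ m ih =>
    have h1 : ∫ ω in A, ‖R (m + 1) ω‖ ^ 2 ∂P ≤ ∫ ω in A, (‖R m ω‖ ^ 2 +
        ψ (R m ω) (Y (W ω, Z (n + (m + 1)) ω)) + 2 * κ * s ^ 2) ∂P := by
      refine integral_mono (hsqint _) (((hsqint _).add (hcrint _)).add (integrable_const _))
        fun ω => ?_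
      simp only [hRs]
      refine (hψ _ _).trans ?_
      gcongr
      exact hs ω _
    have h3 := integral_add ((hsqint m).add (hcrint m))
      (integrable_const (μ := P.restrict A) (2 * κ * s ^ 2))
    have h4 := integral_add (hsqint m) (hcrint m)
    rw [setIntegral_const, smul_eq_mul] at h3
    simp only [Pi.add_apply] at h3
    have h2 := hcross m
    push_cast
    linarith

end PartialSums

/-! ### Quantities known at a random time -/

theorem measurable_select {Ω β : Type*} {mΩ : MeasurableSpace Ω} [MeasurableSpace β]
    {g : ℕ → Ω → β} (hg : ∀ n, Measurable (g n)) {N : Ω → ℕ} (hN : Measurable N) :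
    Measurable fun ω => g (N ω) ω := by
  have h : Measurable fun q : ℕ × Ω => g q.1 q.2 := measurable_from_prod_countable_right hg
  exact h.comp (hN.prodMk measurable_id)

section Adapted

variable {S Ω α α' δ ε : Type*} [MeasurableSpace S] [MeasurableSpace α] [MeasurableSpace α']
  [MeasurableSpace δ] [MeasurableSpace ε] {Z : ℕ → Ω → S} {U : Ω → α} {U' : Ω → α'}
  {N N' : Ω → ℕ} {W : Ω → δ} {W' : Ω → ε}

/-- `W` is determined by `U` and the states of the chain up to the random time `N`. -/
def AdaptedAt (U : Ω → α) (Z : ℕ → Ω → S) (N : Ω → ℕ) (W : Ω → δ) : Prop :=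
  ∀ n, ∃ Wn : Ω → δ, Measurable[history U Z n] Wn ∧ ∀ ω, N ω = n → W ω = Wn ω

theorem AdaptedAt.comp (hW : AdaptedAt U Z N W) {g : δ → ε} (hg : Measurable g) :
    AdaptedAt U Z N fun ω => g (W ω) := by
  intro n
  obtain ⟨Wn, h1, h2⟩ := hW n
  exact ⟨fun ω => g (Wn ω), hg.comp h1, fun ω hω => congrArg g (h2 ω hω)⟩

theorem AdaptedAt.measurable {m : MeasurableSpace Ω} (hm : ∀ n, history U Z n ≤ m)
    (hN : Measurable[m] N) (hW : AdaptedAt U Z N W) : Measurable[m] W := by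
  choose g hg1 hg2 using hW
  have : W = fun ω => g (N ω) ω := by
    funext ω; exact hg2 _ ω rfl
  rw [this]
  exact measurable_select (fun n => (hg1 n).mono (hm n) le_rfl) hN

/-- Off the event `N = n` the representative is replaced by a value actually taken by `W`, so bounds
and centring that hold for `W` everywhere hold for `Wn` everywhere. -/
theorem AdaptedAt.exists_history (hW : AdaptedAt U Z N W) [Nonempty Ω]
    (hN : ∀ n, MeasurableSet[history U Z n] {ω | N ω = n}) (n : ℕ) :
    ∃ Wn : Ω → δ, Measurable[history U Z n] Wn ∧ (∀ ω, N ω = n → W ω = Wn ω) ∧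
      ∀ ω, ∃ ω', Wn ω = W ω' := by
  classical
  obtain ⟨Wn, h1, h2⟩ := hW n
  set ω₁ : Ω := Classical.arbitrary Ω
  refine ⟨{ω | N ω = n}.piecewise Wn fun _ => W ω₁, ?_, fun ω hω => ?_, fun ω => ?_⟩
  · let _ : MeasurableSpace Ω := history U Z n
    exact Measurable.piecewise (hN n) h1 measurable_const
  · rw [Set.piecewise_eq_of_mem _ _ _ (by exact hω), h2 ω hω]
  · by_cases hω : N ω = n
    · exact ⟨ω, by rw [Set.piecewise_eq_of_mem _ _ _ (by exact hω), h2 ω hω]⟩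
    · exact ⟨ω₁, by rw [Set.piecewise_eq_of_notMem _ _ _ (by exact hω)]⟩

/-- On `N' = n'` with `K = k`, the earlier time is `n' - m k`. A representative is chosen for each
`k`, and the countably many choices are glued along the measurable `K`. -/
theorem AdaptedAt.step (hW : AdaptedAt U Z N W)
    (hU : ∀ n, history U Z n ≤ history U' Z n) {K : Ω → ℕ}
    (hK : ∀ n, Measurable[history U' Z n] K) {m : ℕ → ℕ} (hN' : ∀ ω, N' ω = N ω + m (K ω))
    {g : ℕ → ℕ → δ → Ω → ε}
    (hg : ∀ k n, ∀ Wn : Ω → δ, Measurable[history U' Z n] Wn →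
      Measurable[history U' Z (n + m k)] fun ω => g k n (Wn ω) ω)
    (hW' : ∀ ω, W' ω = g (K ω) (N ω) (W ω) ω) : AdaptedAt U' Z N' W' := by
  classical
  intro n'
  choose Wn h1 h2 using hW
  rcases isEmpty_or_nonempty Ω with hΩ | hΩ
  · exact ⟨W', fun s _ => by rw [Set.eq_empty_of_isEmpty (W' ⁻¹' s)]; exact @MeasurableSet.empty _ (history U' Z n'),
      fun _ _ => rfl⟩
  set w₀ : ε := W' (Classical.arbitrary Ω)
  -- The value `w₀` is a dummy: `m k > n'` cannot occur on the event `N' = n'`.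
  refine ⟨fun ω => (fun k ω => if m k ≤ n' then g k (n' - m k) (Wn (n' - m k) ω) ω else w₀)
    (K ω) ω, ?_, fun ω hω => ?_⟩
  · refine @measurable_select _ _ (history U' Z n') _ (fun k ω =>
      if m k ≤ n' then g k (n' - m k) (Wn (n' - m k) ω) ω else w₀) (fun k => ?_) _ (hK n')
    by_cases hk : m k ≤ n'
    · simp only [hk, if_true]
      have := hg k (n' - m k) (Wn (n' - m k)) ((h1 _).mono (hU _) le_rfl)
      rwa [Nat.sub_add_cancel hk] at this
    · simp only [hk, if_false]
      exact @measurable_const _ _ _ (history U' Z n') _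
  · have h3 := hN' ω
    have h4 : m (K ω) ≤ n' := by omega
    have h5 : n' - m (K ω) = N ω := by omega
    simp only [h4, if_true, h5, hW', ← h2 _ ω rfl]

variable [MeasurableSpace Ω] {P : Measure Ω} [IsProbabilityMeasure P]

theorem integral_le_of_fiberwise {h : Ω → ℝ} (hh : Integrable h P) (hN : Measurable N) {c : ℝ}
    (hle : ∀ n, ∫ ω in {ω | N ω = n}, h ω ∂P ≤ c * P.real {ω | N ω = n}) : ∫ ω, h ω ∂P ≤ c := by
  have hm : ∀ n, MeasurableSet {ω | N ω = n} := fun n => hN (measurableSet_singleton n)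
  have hd : Pairwise (Function.onFun Disjoint fun n => {ω | N ω = n}) := by
    intro i j hij
    refine Set.disjoint_left.2 fun ω hi hj => hij ?_
    exact (show N ω = i from hi).symm.trans hj
  have hu : (⋃ n, {ω | N ω = n}) = Set.univ := by ext ω; simp
  have h1 := hasSum_integral_iUnion hm hd (hh.integrableOn (s := ⋃ n, {ω | N ω = n}))
  have h2 := hasSum_integral_iUnion hm hd
    ((integrable_const c).integrableOn (s := ⋃ n, {ω | N ω = n}) (μ := P))
  rw [hu, setIntegral_univ] at h1 h2
  have h3 : ∫ _ω, c ∂P = c := by simp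
  rw [h3] at h2
  refine hasSum_le (fun n => ?_) h1 h2
  rw [setIntegral_const, smul_eq_mul, mul_comm]
  exact hle n

end Adapted

/-! ### Sums started at a random time -/

section RandomTime

variable {S Ω α δ : Type*} [MeasurableSpace S] [MeasurableSpace α] [MeasurableSpace δ]
  [MeasurableSpace Ω] {Z : ℕ → Ω → S} {U : Ω → α} {N : Ω → ℕ} {W : Ω → δ}
  {Q : Kernel S S} [IsMarkovKernel Q] {π : Measure S} [IsProbabilityMeasure π]
  {P : Measure Ω} [IsProbabilityMeasure P] {C τ : ℝ}

/-- On each event `N = n`, which belongs to the history at time `n`, the fixed-time bound applies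
with the mass of that event as a factor; the masses add up to one. -/
theorem IsStationaryMarkovChain.integral_sq_norm_sum_le (hZ : IsStationaryMarkovChain Q π Z P)
    (hQ : UniformlyGeometricallyErgodic Q π C τ) (hC : 0 ≤ C) (hτ : 1 ≤ τ)
    (hU : Measurable U) (hUZ : IndepFun U (fun ω n => Z n ω) P)
    (hN : ∀ n, MeasurableSet[history U Z n] {ω | N ω = n}) (hW : AdaptedAt U Z N W)
    {V : Type*} [NormedAddCommGroup V] [NormedSpace ℝ V] [FiniteDimensional ℝ V]
    [MeasurableSpace V] [BorelSpace V] [SecondCountableTopology V] {κ : ℝ} (hκ : 0 ≤ κ)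
    (hV : IsTwoSmooth V κ) {Y : δ × S → V} (hY : Measurable Y) {s : ℝ} (hs0 : 0 ≤ s)
    (hs : ∀ ω z, ‖Y (W ω, z)‖ ≤ s) (hπ : ∀ ω, ∫ z, Y (W ω, z) ∂π = 0) (m : ℕ) :
    ∫ ω, ‖∑ i ∈ Finset.range m, Y (W ω, Z (N ω + (i + 1)) ω)‖ ^ 2 ∂P
      ≤ 2 * κ * s ^ 2 * (1 + 16 * C * τ) * m := by
  have hΩ : Nonempty Ω := nonempty_of_isProbabilityMeasure P
  have hle := history_le hU hZ.measurable
  have hNm : Measurable N := measurable_to_countable' fun n => hle n _ (hN n)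
  have hWm : Measurable W := hW.measurable hle hNm
  have hZm := hZ.measurable
  have hsum : Measurable fun ω => ∑ i ∈ Finset.range m, Y (W ω, Z (N ω + (i + 1)) ω) :=
    Finset.measurable_fun_sum _ fun i _ => hY.comp (hWm.prodMk
      (measurable_select (g := fun n ω => Z (n + (i + 1)) ω) (fun n => hZm _) hNm))
  refine integral_le_of_fiberwise (N := N) ?_ hNm fun n => ?_
  · refine Integrable.of_bound (hsum.norm.pow_const 2).aestronglyMeasurable ((m * s) ^ 2)
      (Filter.Eventually.of_forall fun ω => ?_)
    rw [norm_pow, norm_norm]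
    exact pow_le_pow_left₀ (norm_nonneg _) (norm_sum_range_le (fun i => hs ω _) m) 2
  · obtain ⟨Wn, h1, h2, h3⟩ := hW.exists_history hN n
    have h4 := hZ.setIntegral_sq_norm_sum_le hQ hC hτ hU hUZ (hN n) h1 hκ hV hY hs0
      (fun ω z => by obtain ⟨ω', h⟩ := h3 ω; rw [h]; exact hs ω' z)
      (fun ω => by obtain ⟨ω', h⟩ := h3 ω; rw [h]; exact hπ ω') m
    refine le_trans (le_of_eq ?_) h4
    refine setIntegral_congr_fun (hle n _ (hN n)) fun ω hω => ?_
    have hω' : N ω = n := hω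
    simp only [h2 ω hω', hω']

theorem IsStationaryMarkovChain.abs_integral_sum_le (hZ : IsStationaryMarkovChain Q π Z P)
    (hQ : UniformlyGeometricallyErgodic Q π C τ) (hC : 0 ≤ C) (hτ : 1 ≤ τ)
    (hU : Measurable U) (hUZ : IndepFun U (fun ω n => Z n ω) P)
    (hN : ∀ n, MeasurableSet[history U Z n] {ω | N ω = n}) (hW : AdaptedAt U Z N W)
    {u : δ × S → ℝ} (hu : Measurable u) {b : ℝ} (hb0 : 0 ≤ b) (hb : ∀ ω z, |u (W ω, z)| ≤ b)
    (hπ : ∀ ω, ∫ z, u (W ω, z) ∂π = 0) (m : ℕ) :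
    |∫ ω, ∑ i ∈ Finset.range m, u (W ω, Z (N ω + (i + 1)) ω) ∂P| ≤ 4 * b * C * τ := by
  have hΩ : Nonempty Ω := nonempty_of_isProbabilityMeasure P
  have hle := history_le hU hZ.measurable
  have hNm : Measurable N := measurable_to_countable' fun n => hle n _ (hN n)
  have hWm : Measurable W := hW.measurable hle hNm
  have hZm := hZ.measurable
  have hsum : Measurable fun ω => ∑ i ∈ Finset.range m, u (W ω, Z (N ω + (i + 1)) ω) :=
    Finset.measurable_fun_sum _ fun i _ => hu.comp (hWm.prodMk
      (measurable_select (g := fun n ω => Z (n + (i + 1)) ω) (fun n => hZm _) hNm))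
  have hint : Integrable (fun ω => ∑ i ∈ Finset.range m, u (W ω, Z (N ω + (i + 1)) ω)) P :=
    Integrable.of_bound hsum.aestronglyMeasurable (m * b)
      (Filter.Eventually.of_forall fun ω => norm_sum_range_le (fun i => hb ω _) m)
  have key : ∀ n, |∫ ω in {ω | N ω = n}, ∑ i ∈ Finset.range m, u (W ω, Z (N ω + (i + 1)) ω) ∂P|
      ≤ 4 * b * C * τ * P.real {ω | N ω = n} := by
    intro n
    obtain ⟨Wn, h1, h2, h3⟩ := hW.exists_history hN n
    have h4 := hZ.abs_setIntegral_sum_le hQ hC hτ hU hUZ (hN n) h1 hu hb0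
      (fun ω z => by obtain ⟨ω', h⟩ := h3 ω; rw [h]; exact hb ω' z)
      (fun ω => by obtain ⟨ω', h⟩ := h3 ω; rw [h]; exact hπ ω') m
    refine le_trans (le_of_eq ?_) h4
    congr 1
    refine setIntegral_congr_fun (hle n _ (hN n)) fun ω hω => ?_
    have hω' : N ω = n := hω
    simp only [h2 ω hω', hω']
  refine abs_le'.2 ⟨integral_le_of_fiberwise hint hNm fun n => (le_abs_self _).trans (key n), ?_⟩
  rw [← integral_neg]
  refine integral_le_of_fiberwise hint.neg hNm fun n => ?_
  simp only [Pi.neg_apply]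
  rw [integral_neg]
  exact (neg_le_abs _).trans (key n)

end RandomTime

/-! ### Measurability of the oracle, the prox map and the iterates -/

theorem measurable_indicator_of_continuousOn {E V : Type*} [TopologicalSpace E] [MeasurableSpace E]
    [OpensMeasurableSpace E] {X : Set E} [TopologicalSpace V] [Zero V]
    [MeasurableSpace V] [BorelSpace V] {g : E → V} (hX : MeasurableSet X) (hg : ContinuousOn g X) :
    Measurable (X.indicator g) := by
  classical
  rw [← Set.piecewise_eq_indicator]
  exact hg.measurable_piecewise continuousOn_const hX

section StochGradOn

variable {E S : Type*} [NormedAddCommGroup E] [NormedSpace ℝ E] {X : Set E} {F : E → S → ℝ}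

open Classical in
/-- The stochastic gradient, extended by zero outside `X`. -/
noncomputable def stochGradOn (X : Set E) (F : E → S → ℝ) (q : E × S) : E →L[ℝ] ℝ :=
  if q.1 ∈ X then stochGrad F q.1 q.2 else 0

theorem batchGrad_eq (B : ℕ) (z : ℕ → S) (N : ℕ) {x : E} (hx : x ∈ X) (j : ℕ) :
    batchGrad F B z N x j = ((2 : ℝ) ^ j * B)⁻¹ •
      ∑ i ∈ Finset.range (2 ^ j * B), stochGradOn X F (x, z (N + (i + 1))) := by
  have h : ∀ s, stochGradOn X F (x, s) = stochGrad F x s := fun s => by simp [stochGradOn, hx]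
  simp only [batchGrad, h]
  rw [← Finset.Ico_add_one_right_eq_Icc, Finset.sum_Ico_eq_sum_range]
  simp [add_comm]

end StochGradOn

section OracleMeasurability

variable {E S : Type*} [NormedAddCommGroup E] [NormedSpace ℝ E] [FiniteDimensional ℝ E]
  [MeasurableSpace S] {X : Set E} {F : E → S → ℝ}

theorem measurable_dual_of_apply {β : Type*} [MeasurableSpace β] {φ : β → E →L[ℝ] ℝ}
    (h : ∀ v, Measurable fun a => φ a v) : Measurable φ := by
  let b := Module.finBasis ℝ E
  have e : φ = fun a => ∑ i, φ a (b i) • (LinearMap.toContinuousLinearMap (b.coord i)) := by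
    funext a
    ext v
    calc φ a v = φ a (∑ i, b.repr v i • b i) := by rw [b.sum_repr]
      _ = ∑ i, b.repr v i * φ a (b i) := by simp only [map_sum, map_smul, smul_eq_mul]
      _ = _ := by simp [mul_comm]
  have hc : Continuous fun c : Fin (Module.finrank ℝ E) → ℝ =>
      ∑ i, c i • (LinearMap.toContinuousLinearMap (b.coord i) : E →L[ℝ] ℝ) := by fun_prop
  rw [e]
  exact hc.measurable.comp (measurable_pi_lambda _ fun i => h (b i))

variable [MeasurableSpace E] [BorelSpace E]

/-- Each directional derivative is a pointwise limit of the difference quotients `n(F(x + v/n) -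
F(x))`, and finitely many directions determine the functional. -/
theorem measurable_stochGradOn (hX : MeasurableSet X)
    (hF : Measurable fun q : E × S => F q.1 q.2)
    (hd : ∀ x ∈ X, ∀ z, DifferentiableAt ℝ (fun u => F u z) x) : Measurable (stochGradOn X F) := by
  classical
  refine measurable_dual_of_apply fun v => ?_
  refine measurable_of_tendsto_metrizable (f := fun n (q : E × S) =>
    if q.1 ∈ X then (n : ℝ) • (F (q.1 + (n : ℝ)⁻¹ • v) q.2 - F q.1 q.2) else 0) (fun n => ?_) ?_
  · refine Measurable.ite (measurable_fst hX) ?_ measurable_const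
    have h : Measurable fun q : E × S => F (q.1 + (n : ℝ)⁻¹ • v) q.2 :=
      hF.comp (f := fun q : E × S => (q.1 + (n : ℝ)⁻¹ • v, q.2)) (by fun_prop)
    exact (h.sub hF).const_smul (n : ℝ)
  · rw [tendsto_pi_nhds]
    intro q
    by_cases hq : q.1 ∈ X
    · simp only [hq, if_true, stochGradOn]
      exact ((hd _ hq q.2).hasFDerivAt.lim_real v).comp tendsto_natCast_atTop_atTop
    · simp [hq, stochGradOn]

end OracleMeasurability

section ProxMap

variable {E : Type*} [NormedAddCommGroup E] [NormedSpace ℝ E] {X : Set E} {w : E → ℝ}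
  {w' : E → E →L[ℝ] ℝ}

/-- Compactness gives a minimiser for every functional, and the stability estimate makes the
resulting map `1`-Lipschitz and forces every prox value to agree with it. -/
theorem exists_continuous_prox (hX : IsCompact X) (hne : X.Nonempty)
    (hw : IsDistanceGenerating X w w') :
    ∃ prox : (E →L[ℝ] ℝ) → E, Continuous prox ∧
      ∀ x ξ u, IsProx X w w' x ξ u → u = prox (ξ - w' x) := by
  have hex : ∀ ζ : E →L[ℝ] ℝ, ∃ u ∈ X, IsMinOn (fun v => w v + ζ v) X u := fun ζ =>
    hX.exists_isMinOn hne (hw.continuousOn_fun.add ζ.continuous.continuousOn)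
  choose prox h1 h2 using hex
  have hL : LipschitzWith 1 prox := LipschitzWith.of_dist_le_mul fun a b => by
    rw [dist_eq_norm, dist_eq_norm, NNReal.coe_one, one_mul]
    exact norm_sub_le_of_isMinOn hw (h1 a) (h2 a) (h1 b) (h2 b)
  refine ⟨prox, hL.continuous, fun x ξ u hu => ?_⟩
  rw [isProx_iff] at hu
  have := norm_sub_le_of_isMinOn hw hu.1 hu.2 (h1 _) (h2 (ξ - w' x))
  rw [sub_self, norm_zero] at this
  exact sub_eq_zero.1 (norm_eq_zero.1 (le_antisymm this (norm_nonneg _)))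

end ProxMap

section RunMeasurability

variable {E S Ω : Type*} [NormedAddCommGroup E] [NormedSpace ℝ E] [FiniteDimensional ℝ E]
  [MeasurableSpace E] [BorelSpace E] [MeasurableSpace S] {X : Set E} {w : E → ℝ}
  {w' : E → E →L[ℝ] ℝ} {F : E → S → ℝ} {γ β : ℕ → ℝ} {B : ℕ} {M : ℝ} {x0 : E}
  {Z : ℕ → Ω → S} {J : ℕ → Ω → ℕ} {x xg xf : ℕ → Ω → E}

/-- The levels drawn before step `t`. -/
def pastLevels (J : ℕ → Ω → ℕ) (t : ℕ) (ω : Ω) : Fin t → ℕ := fun s => J s ω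

theorem sampleCount_eq_sum (B : ℕ) (J : ℕ → ℕ) (t : ℕ) :
    sampleCount B J t = ∑ s : Fin t, 2 ^ J s * B := by
  induction t with
  | zero => rfl
  | succ t ih => rw [Fin.sum_univ_castSucc, sampleCount, ih]; rfl

theorem measurable_sampleCount {m : MeasurableSpace Ω} {t : ℕ}
    (hm : Measurable[m] (pastLevels J t)) :
    Measurable[m] fun ω => sampleCount B (fun s => J s ω) t := by
  have h : (fun ω => sampleCount B (fun s => J s ω) t)
      = (fun j : Fin t → ℕ => ∑ s, 2 ^ j s * B) ∘ pastLevels J t := by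
    funext ω; exact sampleCount_eq_sum _ _ _
  have hf : Measurable fun j : Fin t → ℕ => ∑ s, 2 ^ j s * B := measurable_of_countable _
  rw [h]
  exact hf.comp hm

theorem history_pastLevels_le (J : ℕ → Ω → ℕ) (Z : ℕ → Ω → S) (t n : ℕ) :
    history (pastLevels J t) Z n ≤ history (pastLevels J (t + 1)) Z n := by
  have hφ : Measurable fun q : (Fin (t + 1) → ℕ) × (Fin (n + 1) → S) =>
      ((fun s : Fin t => q.1 s.castSucc), q.2) := by fun_prop
  rintro _ ⟨R, hR, rfl⟩
  exact ⟨_, hφ hR, rfl⟩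

theorem measurable_history_block {V : Type*} [NormedAddCommGroup V] [NormedSpace ℝ V]
    [MeasurableSpace V] [BorelSpace V] [SecondCountableTopology V] {α δ : Type*}
    [MeasurableSpace α] [MeasurableSpace δ] {U : Ω → α} {n k j : ℕ} (hjk : j ≤ k) {Wn : Ω → δ}
    (hW : Measurable[history U Z n] Wn) {Y : δ × S → V} (hY : Measurable Y) (c : ℝ) :
    Measurable[history U Z (n + 2 ^ k * B)]
      fun ω => c • ∑ i ∈ Finset.range (2 ^ j * B), Y (Wn ω, Z (n + (i + 1)) ω) := by
  have h : 2 ^ j * B ≤ 2 ^ k * B := Nat.mul_le_mul_right _ (Nat.pow_le_pow_right two_pos hjk)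
  exact (measurable_history_sum hW hY (by omega)).const_smul c

open Classical in
theorem measurable_mirror_update {β : Type*} {m : MeasurableSpace β} {prox : (E →L[ℝ] ℝ) → E}
    (hprox : Continuous prox) (hw' : Measurable (X.indicator w')) (c r θ : ℝ) (q : Prop)
    {b₀ b₁ b₂ : β → E →L[ℝ] ℝ} {a : β → E × E} (h₀ : Measurable b₀) (h₁ : Measurable b₁)
    (h₂ : Measurable b₂) (ha : Measurable a) :
    Measurable fun ω =>
      (prox (c • (b₀ ω + if q then r • (b₁ ω - b₂ ω) else 0) - X.indicator w' (a ω).1),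
        θ • prox (c • (b₀ ω + if q then r • (b₁ ω - b₂ ω) else 0) - X.indicator w' (a ω).1) +
          (1 - θ) • (a ω).2) := by
  have hg : Measurable fun ω => b₀ ω + if q then r • (b₁ ω - b₂ ω) else 0 := by
    by_cases hq : q
    · simp only [hq, if_true]; fun_prop
    · simp only [hq, if_false]; fun_prop
  have hx : Measurable fun ω =>
      prox (c • (b₀ ω + if q then r • (b₁ ω - b₂ ω) else 0) - X.indicator w' (a ω).1) :=
    hprox.measurable.comp ((hg.const_smul c).sub (hw'.comp ha.fst))
  exact hx.prodMk ((hx.const_smul θ).add (ha.snd.const_smul (1 - θ)))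

/-- Step `t` uses samples with indices at most `N_t + 2^{J_t} B = N_{t+1}`, so by induction the new
iterates depend only on levels up to `J_t` and states up to `N_{t+1}`. -/
theorem adaptedAt_run (hXc : IsCompact X) (hX : Convex ℝ X) (hw : IsDistanceGenerating X w w')
    (hF : Measurable fun q : E × S => F q.1 q.2)
    (hd : ∀ x ∈ X, ∀ z, DifferentiableAt ℝ (fun u => F u z) x) (hx0 : x0 ∈ X)
    (hβ : ∀ t, 1 ≤ β t)
    (hrun : ∀ ω, IsRun X w w' F γ β B M x0 (fun n => Z n ω) (fun t => J t ω)
      (fun t => x t ω) (fun t => xg t ω) (fun t => xf t ω)) (t : ℕ) :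
    AdaptedAt (pastLevels J t) Z (fun ω => sampleCount B (fun s => J s ω) t)
      fun ω => (x t ω, xf t ω) := by
  classical
  obtain ⟨prox, hprox, hproxe⟩ := exists_continuous_prox hXc ⟨x0, hx0⟩ hw
  have hXm : MeasurableSet X := hXc.isClosed.measurableSet
  have hG := measurable_stochGradOn hXm hF hd
  have hw'm := measurable_indicator_of_continuousOn hXm hw.continuousOn
  induction t with
  | zero =>
    intro n
    refine ⟨fun _ => (x0, x0), @measurable_const _ _ _ (history _ Z n) _, fun ω _ => ?_⟩
    exact Prod.ext (hrun ω).x_zero (hrun ω).xf_zero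
  | succ t ih =>
    -- The update is rewritten with the gradient and `w'` set to zero outside `X`: these versions
    -- are measurable everywhere and agree with the originals along the run.
    let b : ℕ → ℕ → E → Ω → (E →L[ℝ] ℝ) := fun j n y ω => ((2 : ℝ) ^ j * B)⁻¹ •
      ∑ i ∈ Finset.range (2 ^ j * B), stochGradOn X F (y, Z (n + (i + 1)) ω)
    let y : E × E → E := fun a => (β t)⁻¹ • a.1 + (1 - (β t)⁻¹) • a.2
    have hy : Measurable y := by fun_prop
    let x' : ℕ → ℕ → E × E → Ω → E := fun k n a ω =>
      prox (γ t • (b 0 n (y a) ω + if (2 : ℝ) ^ k ≤ M then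
        (2 : ℝ) ^ k • (b k n (y a) ω - b (k - 1) n (y a) ω) else 0) - X.indicator w' a.1)
    refine ih.step (history_pastLevels_le J Z t) (K := J t) (m := fun k => 2 ^ k * B)
      (g := fun k n a ω => (x' k n a ω, (β t)⁻¹ • x' k n a ω + (1 - (β t)⁻¹) • a.2))
      (fun n => ?_) (fun ω => rfl) (fun k n Wn hWn => ?_) (fun ω => ?_)
    · exact (measurable_pi_apply (Fin.last t)).comp
        (measurable_history_fst (pastLevels J (t + 1)) Z n)
    · have hb : ∀ j ≤ k, Measurable[history (pastLevels J (t + 1)) Z (n + 2 ^ k * B)]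
          fun ω => b j n (y (Wn ω)) ω := fun j hj =>
        measurable_history_block hj (hy.comp hWn) hG _
      have hWn' : Measurable[history (pastLevels J (t + 1)) Z (n + 2 ^ k * B)] Wn :=
        hWn.mono (history_mono _ Z (Nat.le_add_right _ _)) le_rfl
      exact measurable_mirror_update hprox hw'm (γ t) _ _ _ (hb 0 (Nat.zero_le _)) (hb k le_rfl)
        (hb (k - 1) (Nat.sub_le _ _)) hWn'
    · obtain ⟨m1, m2, m3⟩ := (hrun ω).mem hX hx0 hβ t
      set N := sampleCount B (fun s => J s ω) t with hN
      have hyg : y (x t ω, xf t ω) = xg t ω := ((hrun ω).xg_eq t).symm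
      have hbg : ∀ j, b j N (xg t ω) ω = batchGrad F B (fun n => Z n ω) N (xg t ω) j :=
        fun j => (batchGrad_eq B (fun n => Z n ω) N m3 j).symm
      have hx' : x (t + 1) ω = x' (J t ω) N (x t ω, xf t ω) ω := by
        have h := hproxe _ _ _ ((hrun ω).x_succ t)
        simp only [multilevelGrad, ← hN, ← hbg] at h
        simp only [x', hyg, Set.indicator_of_mem m1]
        exact h
      have hxf' := (hrun ω).xf_succ t
      exact Prod.ext hx' (by rw [← hx']; exact hxf')

end RunMeasurability

/-! ### Independence of the levels -/

section Levels

variable {S Ω : Type*} [MeasurableSpace S] [MeasurableSpace Ω] {J : ℕ → Ω → ℕ} {Z : ℕ → Ω → S}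
  {P : Measure Ω}

theorem IsIndepGeometric.indepFun_pastLevels_chain (hJ : IsIndepGeometric J Z P) (t : ℕ) :
    IndepFun (pastLevels J t) (fun ω n => Z n ω) P := by
  have h : Measurable fun (j : ℕ → ℕ) (s : Fin t) => j s := by fun_prop
  exact hJ.indep_chain.comp h measurable_id

variable [IsProbabilityMeasure P]

/-- Regrouping a triple: the joint law factors as `(f, g)` times `h`, then as `f` times `g` times
`h`. It is needed because independence is given separately among levels and between levels and
chain. -/
theorem indepFun_prodMk_right {β₁ β₂ β₃ : Type*} [MeasurableSpace β₁] [MeasurableSpace β₂]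
    [MeasurableSpace β₃] {f : Ω → β₁} {g : Ω → β₂} {h : Ω → β₃} (hf : Measurable f)
    (hg : Measurable g) (hh : Measurable h) (hfg : IndepFun f g P)
    (hfgh : IndepFun (fun ω => (f ω, g ω)) h P) : IndepFun f (fun ω => (g ω, h ω)) P := by
  have := Measure.isProbabilityMeasure_map (μ := P) hf.aemeasurable
  have := Measure.isProbabilityMeasure_map (μ := P) hg.aemeasurable
  have := Measure.isProbabilityMeasure_map (μ := P) hh.aemeasurable
  have hgh : IndepFun g h P := hfgh.comp measurable_snd measurable_id
  rw [indepFun_iff_map_prod_eq_prod_map_map hf.aemeasurable (hg.prodMk hh).aemeasurable]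
  rw [indepFun_iff_map_prod_eq_prod_map_map hg.aemeasurable hh.aemeasurable] at hgh
  rw [indepFun_iff_map_prod_eq_prod_map_map hf.aemeasurable hg.aemeasurable] at hfg
  rw [indepFun_iff_map_prod_eq_prod_map_map (hf.prodMk hg).aemeasurable hh.aemeasurable] at hfgh
  rw [hgh, ← Measure.prodAssoc_prod, ← hfg, ← hfgh,
    Measure.map_map (MeasurableEquiv.measurable _) ((hf.prodMk hg).prodMk hh)]
  rfl

theorem IsIndepGeometric.indepFun_past (hJ : IsIndepGeometric J Z P) (hZ : ∀ n, Measurable (Z n))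
    (t : ℕ) : IndepFun (J t) (fun ω => (pastLevels J t ω, fun n => Z n ω)) P := by
  have hpast : Measurable (pastLevels J t) := measurable_pi_lambda _ fun s => hJ.measurable s
  refine indepFun_prodMk_right (hJ.measurable t) hpast (measurable_pi_lambda _ hZ) ?_ ?_
  · have h := hJ.iIndep.indepFun_finset {t} (Finset.range t) (by simp) hJ.measurable
    have h1 : Measurable fun a : ((i : ({t} : Finset ℕ)) → ℕ) => a ⟨t, by simp⟩ :=
      measurable_pi_apply _
    have h2 : Measurable fun (a : (i : Finset.range t) → ℕ) (s : Fin t) =>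
        a ⟨s, Finset.mem_range.2 s.2⟩ := by fun_prop
    exact h.comp h1 h2
  · have h : Measurable fun j : ℕ → ℕ => (j t, fun s : Fin t => j s) := by fun_prop
    exact hJ.indep_chain.comp h measurable_id

theorem IsIndepGeometric.integral_indicator_mul (hJ : IsIndepGeometric J Z P)
    (hZ : ∀ n, Measurable (Z n)) {t k : ℕ} (hk : 1 ≤ k) {h : Ω → ℝ}
    (hh : Measurable[MeasurableSpace.comap (fun ω => (pastLevels J t ω, fun n => Z n ω))
      inferInstance] h) :
    ∫ ω, (if J t ω = k then 1 else 0) * h ω ∂P = (1 / 2 : ℝ) ^ k * ∫ ω, h ω ∂P := by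
  have hpast : Measurable (pastLevels J t) := measurable_pi_lambda _ fun s => hJ.measurable s
  have hhm : Measurable h := hh.mono
    (Measurable.comap_le (hpast.prodMk (measurable_pi_lambda _ hZ))) le_rfl
  have hφ : Measurable fun j : ℕ => if j = k then (1 : ℝ) else 0 := measurable_from_top
  have hind : IndepFun (fun ω => if J t ω = k then (1 : ℝ) else 0) h P := by
    rw [IndepFun_iff_Indep]
    have h1 := (IndepFun_iff_Indep _ _ _).1 (hJ.indepFun_past hZ t)
    have h2 : Measurable[MeasurableSpace.comap (J t) inferInstance]
        (fun ω => if J t ω = k then (1 : ℝ) else 0) := hφ.comp (comap_measurable _)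
    exact indep_of_indep_of_le_left (indep_of_indep_of_le_right h1 hh.comap_le) h2.comap_le
  rw [hind.integral_fun_mul_eq_mul_integral (hφ.comp (hJ.measurable t)).aestronglyMeasurable
    hhm.aestronglyMeasurable]
  congr 1
  have hs : MeasurableSet {ω | J t ω = k} := hJ.measurable t (measurableSet_singleton k)
  have h3 : (fun ω => if J t ω = k then (1 : ℝ) else 0)
      = {ω | J t ω = k}.indicator fun _ => 1 := by
    funext ω; simp [Set.indicator]
  rw [h3, integral_indicator_const _ hs, smul_eq_mul, mul_one, Measure.real, hJ.law t k hk]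
  simp

end Levels

/-! ### The randomized multilevel combination -/

section Multilevel

open Classical in
/-- The multilevel combination of a sequence of estimators. -/
noncomputable def multilevel {V : Type*} [AddCommGroup V] [Module ℝ V] (M : ℝ) (ξ : ℕ → V)
    (J : ℕ) : V :=
  ξ 0 + if (2 : ℝ) ^ J ≤ M then (2 : ℝ) ^ J • (ξ J - ξ (J - 1)) else 0

theorem multilevelGrad_sub {E S : Type*} [NormedAddCommGroup E] [NormedSpace ℝ E] (F : E → S → ℝ)
    (B : ℕ) (M : ℝ) (z : ℕ → S) (N : ℕ) (x : E) (J : ℕ) (g : E →L[ℝ] ℝ) :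
    multilevelGrad F B M z N x J - g = multilevel M (fun j => batchGrad F B z N x j - g) J := by
  simp only [multilevelGrad, multilevel, sub_sub_sub_cancel_right]
  abel

theorem two_pow_le_iff_le_log {M : ℝ} (hM : 1 ≤ M) (J : ℕ) :
    (2 : ℝ) ^ J ≤ M ↔ J ≤ Nat.log 2 ⌊M⌋₊ := by
  have h0 : ⌊M⌋₊ ≠ 0 := (Nat.floor_pos.2 hM).ne'
  rw [Nat.le_log_iff_pow_le one_lt_two h0, Nat.le_floor_iff (by linarith)]
  norm_cast

theorem multilevel_eq_sum {V : Type*} [AddCommGroup V] [Module ℝ V] {M : ℝ} (hM : 1 ≤ M)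
    (ξ : ℕ → V) (J : ℕ) :
    multilevel M ξ J = ξ 0 + ∑ k ∈ Finset.range (Nat.log 2 ⌊M⌋₊),
      (if J = k + 1 then (1 : ℝ) else 0) • (2 : ℝ) ^ (k + 1) • (ξ (k + 1) - ξ k) := by
  unfold multilevel
  congr 1
  simp only [two_pow_le_iff_le_log hM, ite_smul, one_smul, zero_smul]
  cases J with
  | zero => simp
  | succ j =>
    by_cases hj : j + 1 ≤ Nat.log 2 ⌊M⌋₊
    · rw [if_pos hj, Finset.sum_eq_single j]
      · simp
      · intro b _ hb
        rw [if_neg (by omega)]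
      · intro hj'
        simp only [Finset.mem_range] at hj'; omega
    · rw [if_neg hj, Finset.sum_eq_zero]
      intro b hb
      rw [Finset.mem_range] at hb
      rw [if_neg (by omega)]

/-- At most one indicator is active, so squaring the correction produces no cross terms between
levels. -/
theorem sq_norm_multilevel_le {V : Type*} [NormedAddCommGroup V] [NormedSpace ℝ V] {M : ℝ}
    (hM : 1 ≤ M) (ξ : ℕ → V) (J : ℕ) :
    ‖multilevel M ξ J‖ ^ 2 ≤ 2 * ‖ξ 0‖ ^ 2 + 2 * ∑ k ∈ Finset.range (Nat.log 2 ⌊M⌋₊),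
      (if J = k + 1 then (1 : ℝ) else 0) * (4 ^ (k + 1) * ‖ξ (k + 1) - ξ k‖ ^ 2) := by
  have h1 : ∀ a b : V, ‖a + b‖ ^ 2 ≤ 2 * ‖a‖ ^ 2 + 2 * ‖b‖ ^ 2 := fun a b => by
    have := norm_add_le a b
    nlinarith [norm_nonneg (a + b), sq_nonneg (‖a‖ - ‖b‖)]
  refine (h1 _ _).trans ?_
  gcongr
  simp only [two_pow_le_iff_le_log hM]
  have hnn : ∀ k, 0 ≤ (if J = k + 1 then (1 : ℝ) else 0) * (4 ^ (k + 1) * ‖ξ (k + 1) - ξ k‖ ^ 2) :=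
    fun k => mul_nonneg (by split_ifs <;> norm_num) (by positivity)
  have hs := Finset.sum_nonneg fun k (_ : k ∈ Finset.range (Nat.log 2 ⌊M⌋₊)) => hnn k
  cases J with
  | zero => simp
  | succ j =>
    by_cases hj : j + 1 ≤ Nat.log 2 ⌊M⌋₊
    · rw [if_pos hj]
      refine le_trans ?_ (Finset.single_le_sum (fun k _ => hnn k) (Finset.mem_range.2 hj))
      rw [if_pos rfl, one_mul, Nat.add_sub_cancel, norm_smul, mul_pow,
        Real.norm_of_nonneg (by positivity), ← pow_mul, mul_comm (j + 1) 2, pow_mul]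
      norm_num
    · rw [if_neg hj]; simpa using hs

variable {S Ω : Type*} [MeasurableSpace S] {J : ℕ → Ω → ℕ} {Z : ℕ → Ω → S}

/-- The information contained in the past levels and in the whole chain. -/
@[reducible] def pastAndChain (J : ℕ → Ω → ℕ) (Z : ℕ → Ω → S) (t : ℕ) : MeasurableSpace Ω :=
  MeasurableSpace.comap (fun ω => (pastLevels J t ω, fun n => Z n ω)) inferInstance

theorem history_le_pastAndChain (J : ℕ → Ω → ℕ) (Z : ℕ → Ω → S) (t n : ℕ) :
    history (pastLevels J t) Z n ≤ pastAndChain J Z t := by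
  have hφ : Measurable fun q : (Fin t → ℕ) × (ℕ → S) =>
      (q.1, fun i : Fin (n + 1) => q.2 i) := by fun_prop
  rintro _ ⟨R, hR, rfl⟩
  exact ⟨_, hφ hR, rfl⟩

variable [MeasurableSpace Ω] {P : Measure Ω} [IsProbabilityMeasure P] {M : ℝ}

theorem pastAndChain_le (hJ : ∀ t, Measurable (J t)) (hZ : ∀ n, Measurable (Z n)) (t : ℕ) :
    pastAndChain J Z t ≤ ‹MeasurableSpace Ω› :=
  Measurable.comap_le ((measurable_pi_lambda (pastLevels J t) fun s => hJ s).prodMk (measurable_pi_lambda _ hZ))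

variable {V : Type*} [NormedAddCommGroup V] [NormedSpace ℝ V] [MeasurableSpace V] [BorelSpace V]
  [SecondCountableTopology V]

theorem measurable_multilevel (hM : 1 ≤ M) {ξ : ℕ → Ω → V} (hξ : ∀ k, Measurable (ξ k))
    {I : Ω → ℕ} (hI : Measurable I) : Measurable fun ω => multilevel M (fun k => ξ k ω) (I ω) := by
  simp only [multilevel_eq_sum hM]
  refine (hξ 0).add (Finset.measurable_fun_sum _ fun k _ => ?_)
  have hφ : Measurable fun j : ℕ => if j = k + 1 then (1 : ℝ) else 0 := measurable_from_top
  exact (hφ.comp hI).smul (((hξ _).sub (hξ _)).const_smul _)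

/-- The weight `2^{k+1}` cancels the probability that `J = k + 1`, so the sum over levels telescopes
to the top one. -/
theorem IsIndepGeometric.integral_multilevel (hJ : IsIndepGeometric J Z P)
    (hZ : ∀ n, Measurable (Z n)) (hM : 1 ≤ M) {t : ℕ} {y : ℕ → Ω → ℝ}
    (hy : ∀ k, Measurable[pastAndChain J Z t] (y k)) {b : ℝ} (hb : ∀ k ω, |y k ω| ≤ b) :
    Integrable (fun ω => multilevel M (fun k => y k ω) (J t ω)) P ∧
    ∫ ω, multilevel M (fun k => y k ω) (J t ω) ∂P = ∫ ω, y (Nat.log 2 ⌊M⌋₊) ω ∂P := by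
  have hle := pastAndChain_le hJ.measurable hZ t
  have hym : ∀ k, Measurable (y k) := fun k => (hy k).mono hle le_rfl
  have hyi : ∀ k, Integrable (y k) P := fun k =>
    Integrable.of_bound (hym k).aestronglyMeasurable b (Filter.Eventually.of_forall (hb k))
  have hφ : ∀ k, Measurable fun j : ℕ => if j = k + 1 then (1 : ℝ) else 0 :=
    fun k => measurable_from_top
  have hti : ∀ k, Integrable (fun ω => (if J t ω = k + 1 then (1 : ℝ) else 0) *
      ((2 : ℝ) ^ (k + 1) * (y (k + 1) ω - y k ω))) P := by
    intro k
    refine Integrable.bdd_mul (c := 1) (((hyi (k + 1)).sub (hyi k)).const_mul _)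
      ((hφ k).comp (hJ.measurable t)).aestronglyMeasurable (Filter.Eventually.of_forall fun ω => ?_)
    split_ifs <;> simp
  simp only [multilevel_eq_sum hM, smul_eq_mul]
  refine ⟨(hyi 0).add (integrable_finsetSum _ fun k _ => hti k), ?_⟩
  rw [integral_add (hyi 0) (integrable_finsetSum _ fun k _ => hti k),
    integral_finsetSum _ fun k _ => hti k]
  have hterm : ∀ k, ∫ ω, (if J t ω = k + 1 then (1 : ℝ) else 0) *
      ((2 : ℝ) ^ (k + 1) * (y (k + 1) ω - y k ω)) ∂P = ∫ ω, y (k + 1) ω ∂P - ∫ ω, y k ω ∂P := by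
    intro k
    have hφ2 : Measurable fun q : ℝ × ℝ => (2 : ℝ) ^ (k + 1) * (q.1 - q.2) := by fun_prop
    rw [hJ.integral_indicator_mul hZ (Nat.le_add_left 1 k)
      (h := fun ω => (2 : ℝ) ^ (k + 1) * (y (k + 1) ω - y k ω))
      (hφ2.comp ((hy (k + 1)).prodMk (hy k))),
      integral_const_mul, integral_sub (hyi _) (hyi _), ← mul_assoc, ← mul_pow]
    norm_num
  rw [Finset.sum_congr rfl fun k _ => hterm k, Finset.sum_range_sub fun k => ∫ ω, y k ω ∂P]
  ring

/-- Probability times squared weight is `2^{k+1}`, against a second moment of the difference of at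
most `2c/2^{k+1} + 2c/2^k`: each level costs `6c`, whatever `k`. -/
theorem IsIndepGeometric.integral_sq_norm_multilevel_le (hJ : IsIndepGeometric J Z P)
    (hZ : ∀ n, Measurable (Z n)) (hM : 1 ≤ M) {t : ℕ} {ξ : ℕ → Ω → V}
    (hξ : ∀ k, Measurable[pastAndChain J Z t] (ξ k)) {b : ℝ} (hb : ∀ k ω, ‖ξ k ω‖ ≤ b) {c : ℝ}
    (hc : ∀ k, ∫ ω, ‖ξ k ω‖ ^ 2 ∂P ≤ c / 2 ^ k) :
    Integrable (fun ω => ‖multilevel M (fun k => ξ k ω) (J t ω)‖ ^ 2) P ∧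
    ∫ ω, ‖multilevel M (fun k => ξ k ω) (J t ω)‖ ^ 2 ∂P
      ≤ (2 + 12 * Nat.log 2 ⌊M⌋₊) * c := by
  have hle := pastAndChain_le hJ.measurable hZ t
  have hξm : ∀ k, Measurable (ξ k) := fun k => (hξ k).mono hle le_rfl
  have hsqb : ∀ k ω, ‖‖ξ k ω‖ ^ 2‖ ≤ b ^ 2 := fun k ω => by
    rw [norm_pow, norm_norm]; exact pow_le_pow_left₀ (norm_nonneg _) (hb k ω) 2
  have hξi : ∀ k, Integrable (fun ω => ‖ξ k ω‖ ^ 2) P := fun k =>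
    Integrable.of_bound ((hξm k).norm.pow_const 2).aestronglyMeasurable (b ^ 2)
      (Filter.Eventually.of_forall (hsqb k))
  have hdle : ∀ k ω, ‖ξ (k + 1) ω - ξ k ω‖ ^ 2 ≤ 2 * ‖ξ (k + 1) ω‖ ^ 2 + 2 * ‖ξ k ω‖ ^ 2 := by
    intro k ω
    have := norm_sub_le (ξ (k + 1) ω) (ξ k ω)
    nlinarith [norm_nonneg (ξ (k + 1) ω - ξ k ω), sq_nonneg (‖ξ (k + 1) ω‖ - ‖ξ k ω‖)]
  have hdm : ∀ k, Measurable[pastAndChain J Z t]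
      fun ω => 4 ^ (k + 1) * ‖ξ (k + 1) ω - ξ k ω‖ ^ 2 := by
    intro k
    have h : Measurable fun q : V × V => 4 ^ (k + 1) * ‖q.1 - q.2‖ ^ 2 := by fun_prop
    exact h.comp ((hξ (k + 1)).prodMk (hξ k))
  have hdi : ∀ k, Integrable (fun ω => ‖ξ (k + 1) ω - ξ k ω‖ ^ 2) P := by
    intro k
    refine Integrable.mono' (((hξi (k + 1)).const_mul 2).add ((hξi k).const_mul 2))
      (((hξm (k + 1)).sub (hξm k)).norm.pow_const 2).aestronglyMeasurable
      (Filter.Eventually.of_forall fun ω => ?_)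
    rw [Real.norm_of_nonneg (by positivity)]
    exact hdle k ω
  have hφ : ∀ k, Measurable fun j : ℕ => if j = k + 1 then (1 : ℝ) else 0 :=
    fun k => measurable_from_top
  have hti : ∀ k, Integrable (fun ω => (if J t ω = k + 1 then (1 : ℝ) else 0) *
      (4 ^ (k + 1) * ‖ξ (k + 1) ω - ξ k ω‖ ^ 2)) P := by
    intro k
    refine Integrable.bdd_mul (c := 1) ((hdi k).const_mul _)
      ((hφ k).comp (hJ.measurable t)).aestronglyMeasurable (Filter.Eventually.of_forall fun ω => ?_)
    split_ifs <;> simp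
  have hsum := integrable_finsetSum (Finset.range (Nat.log 2 ⌊M⌋₊)) fun k _ => hti k
  have hdom := ((hξi 0).const_mul 2).add (hsum.const_mul 2)
  have hint : Integrable (fun ω => ‖multilevel M (fun k => ξ k ω) (J t ω)‖ ^ 2) P :=
    Integrable.mono' hdom
      ((measurable_multilevel hM hξm (hJ.measurable t)).norm.pow_const 2).aestronglyMeasurable
      (Filter.Eventually.of_forall fun ω => by
        rw [Real.norm_of_nonneg (by positivity)]
        exact sq_norm_multilevel_le hM _ _)
  refine ⟨hint, ?_⟩
  have h1 : ∫ ω, ‖multilevel M (fun k => ξ k ω) (J t ω)‖ ^ 2 ∂P ≤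
      ∫ ω, (2 * ‖ξ 0 ω‖ ^ 2 + 2 * ∑ k ∈ Finset.range (Nat.log 2 ⌊M⌋₊),
      (if J t ω = k + 1 then (1 : ℝ) else 0) * (4 ^ (k + 1) * ‖ξ (k + 1) ω - ξ k ω‖ ^ 2)) ∂P :=
    integral_mono hint hdom fun ω => sq_norm_multilevel_le hM _ _
  rw [integral_add ((hξi 0).const_mul 2) (hsum.const_mul 2), integral_const_mul,
    integral_const_mul, integral_finsetSum _ fun k _ => hti k] at h1
  have hterm : ∀ k, ∫ ω, (if J t ω = k + 1 then (1 : ℝ) else 0) *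
      (4 ^ (k + 1) * ‖ξ (k + 1) ω - ξ k ω‖ ^ 2) ∂P ≤ 6 * c := by
    intro k
    rw [hJ.integral_indicator_mul hZ (Nat.le_add_left 1 k) (hdm k), integral_const_mul, ← mul_assoc,
      ← mul_pow]
    have h2 : ∫ ω, ‖ξ (k + 1) ω - ξ k ω‖ ^ 2 ∂P
        ≤ ∫ ω, (2 * ‖ξ (k + 1) ω‖ ^ 2 + 2 * ‖ξ k ω‖ ^ 2) ∂P :=
      integral_mono (hdi k) (((hξi (k + 1)).const_mul 2).add ((hξi k).const_mul 2)) (hdle k)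
    rw [integral_add ((hξi _).const_mul 2) ((hξi _).const_mul 2), integral_const_mul,
      integral_const_mul] at h2
    have h3 := hc (k + 1)
    have h4 := hc k
    have h5 : (2 : ℝ) ^ (k + 1) * (2 * (c / 2 ^ (k + 1)) + 2 * (c / 2 ^ k)) = 6 * c := by
      rw [pow_succ]; field_simp; ring
    have h6 : (1 / 2 * 4 : ℝ) ^ (k + 1) = 2 ^ (k + 1) := by norm_num
    rw [h6, ← h5]
    gcongr
    linarith
  have h7 := Finset.sum_le_sum fun k (_ : k ∈ Finset.range (Nat.log 2 ⌊M⌋₊)) => hterm k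
  rw [Finset.sum_const, Finset.card_range, nsmul_eq_mul] at h7
  have h8 := hc 0
  rw [pow_zero, div_one] at h8
  nlinarith

end Multilevel

/-! ### Gradient noise and batch averages -/

section Noise

variable {E S : Type*} [NormedAddCommGroup E] [NormedSpace ℝ E] {X : Set E} {F : E → S → ℝ}
  {f : E → ℝ} {σ L : ℝ}

/-- The gradient noise `∇F(x, z) - ∇f(x)`, extended by zero outside `X`. -/
noncomputable def noiseOn (X : Set E) (F : E → S → ℝ) (f : E → ℝ) (q : E × S) : E →L[ℝ] ℝ :=
  stochGradOn X F q - X.indicator (fderiv ℝ f) q.1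

theorem noiseOn_apply {x : E} (hx : x ∈ X) (z : S) :
    noiseOn X F f (x, z) = stochGrad F x z - fderiv ℝ f x := by
  simp [noiseOn, stochGradOn, hx]

theorem IsSmoothOn.continuousOn_fderiv (hf : IsSmoothOn X f L) :
    ContinuousOn (fderiv ℝ f) X := by
  have : LipschitzOnWith L.toNNReal (fderiv ℝ f) X := LipschitzOnWith.of_dist_le_mul
    fun x hx y hy => by
      rw [dist_eq_norm, dist_eq_norm]
      exact (hf.2 x hx y hy).trans
        (mul_le_mul_of_nonneg_right (Real.le_coe_toNNReal L) (norm_nonneg _))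
  exact this.continuousOn

theorem batchGrad_sub_eq {B : ℕ} (hB : 1 ≤ B) (z : ℕ → S) (N : ℕ) {x : E} (hx : x ∈ X) (j : ℕ) :
    batchGrad F B z N x j - fderiv ℝ f x = ((2 : ℝ) ^ j * B)⁻¹ •
      ∑ i ∈ Finset.range (2 ^ j * B), noiseOn X F f (x, z (N + (i + 1))) := by
  have hB0 : (B : ℝ) ≠ 0 := by positivity
  rw [batchGrad_eq (X := X) B z N hx]
  simp only [noiseOn, Finset.sum_sub_distrib, smul_sub, Finset.sum_const, Finset.card_range,
    Set.indicator_of_mem hx]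
  congr 1
  rw [← Nat.cast_smul_eq_nsmul ℝ, smul_smul]
  push_cast
  rw [inv_mul_cancel₀ (by positivity), one_smul]

variable [MeasurableSpace E] [MeasurableSpace S] {π : Measure S}

theorem IsOracle.norm_noiseOn_le (ho : IsOracle X π F f σ) {x : E} (hx : x ∈ X) (z : S) :
    ‖noiseOn X F f (x, z)‖ ≤ |σ| := by
  rw [noiseOn_apply hx]
  exact abs_le_of_sq_le_sq' (by rw [sq_abs]; exact ho.noise x hx z) (abs_nonneg _) |>.2

theorem norm_batch_sub_le (ho : IsOracle X π F f σ) {B : ℕ} (hB : 1 ≤ B) (z : ℕ → S) (n : ℕ) {x : E}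
    (hx : x ∈ X) (j : ℕ) : ‖batchGrad F B z n x j - fderiv ℝ f x‖ ≤ |σ| := by
  have hB0 : (0 : ℝ) < B := by exact_mod_cast hB
  rw [batchGrad_sub_eq hB _ _ hx, norm_smul, Real.norm_of_nonneg (by positivity)]
  have := norm_sum_range_le (fun i => ho.norm_noiseOn_le hx (z (n + (i + 1)))) (2 ^ j * B)
  rw [inv_mul_le_iff₀ (by positivity)]
  push_cast at this
  exact this

variable [FiniteDimensional ℝ E] [BorelSpace E]

theorem IsOracle.measurable_noiseOn (ho : IsOracle X π F f σ) (hX : MeasurableSet X)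
    (hf : IsSmoothOn X f L) : Measurable (noiseOn X F f) :=
  (measurable_stochGradOn hX ho.measurable ho.differentiable).sub
    ((measurable_indicator_of_continuousOn hX hf.continuousOn_fderiv).comp measurable_fst)

theorem measurable_batch_sub {Ω : Type*} {m : MeasurableSpace Ω} {N : Ω → ℕ} {y : Ω → E}
    {Z : ℕ → Ω → S} {B : ℕ} (ho : IsOracle X π F f σ)
    (hX : MeasurableSet X) (hf : IsSmoothOn X f L) (hB : 1 ≤ B) (hyX : ∀ ω, y ω ∈ X)
    (hy : Measurable[m] y) (hN : Measurable[m] N) (hZ : ∀ n, Measurable[m] (Z n)) (j : ℕ) :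
    Measurable[m] fun ω =>
      batchGrad F B (fun n => Z n ω) (N ω) (y ω) j - fderiv ℝ f (y ω) := by
  have hm := ho.measurable_noiseOn hX hf
  simp only [fun ω => batchGrad_sub_eq (F := F) (f := f) hB (fun n => Z n ω) (N ω) (hyX ω) j]
  have hsum : Measurable[m] fun ω => ∑ i ∈ Finset.range (2 ^ j * B),
      noiseOn X F f (y ω, Z (N ω + (i + 1)) ω) :=
    Finset.measurable_fun_sum _ fun i _ => hm.comp (hy.prodMk
      (measurable_select (g := fun n ω => Z (n + (i + 1)) ω) (fun n => hZ _) hN))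
  exact hsum.const_smul ((2 : ℝ) ^ j * B)⁻¹

theorem IsOracle.integral_noiseOn [IsProbabilityMeasure π] (ho : IsOracle X π F f σ)
    (hX : MeasurableSet X) {x : E} (hx : x ∈ X) : ∫ z, noiseOn X F f (x, z) ∂π = 0 := by
  have hm : Measurable fun z => stochGrad F x z := by
    have h := (measurable_stochGradOn hX ho.measurable ho.differentiable).comp
      (measurable_prodMk_left (x := x))
    have e : stochGradOn X F ∘ Prod.mk x = fun z => stochGrad F x z := by
      funext z; simp [stochGradOn, hx]
    rwa [e] at h
  have hi : Integrable (fun z => stochGrad F x z) π := by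
    refine Integrable.of_bound hm.aestronglyMeasurable (|σ| + ‖fderiv ℝ f x‖)
      (Filter.Eventually.of_forall fun z => ?_)
    have h := ho.norm_noiseOn_le hx z
    rw [noiseOn_apply hx] at h
    have := norm_le_norm_sub_add (stochGrad F x z) (fderiv ℝ f x)
    linarith
  simp only [noiseOn_apply hx]
  rw [integral_sub hi (integrable_const _), ho.unbiased x hx]
  simp

end Noise

section Estimates

variable {E S Ω V : Type*} [NormedAddCommGroup E] [NormedSpace ℝ E] [FiniteDimensional ℝ E]
  [MeasurableSpace E] [BorelSpace E] [MeasurableSpace S] [MeasurableSpace Ω] {X : Set E}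
  {F : E → S → ℝ} {f : E → ℝ} {σ L C τ κ : ℝ}
  [NormedAddCommGroup V] [NormedSpace ℝ V] [FiniteDimensional ℝ V]
  [MeasurableSpace V] [BorelSpace V] [SecondCountableTopology V]
  {Q : Kernel S S} [IsMarkovKernel Q] {π : Measure S} [IsProbabilityMeasure π]
  {P : Measure Ω} [IsProbabilityMeasure P] {Z : ℕ → Ω → S} {α : Type*} [MeasurableSpace α]
  {U : Ω → α} {N : Ω → ℕ} {y : Ω → E} {B : ℕ}

/-- The noise is sent by `A` into the smooth space `V`, where the sum bound holds. Returning costs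
nothing by `hA1`, and the noise size grows by the factor `a`. Dividing a bound linear in `m = 2^j B`
by `m²` leaves `1/m`. -/
theorem integral_sq_norm_batch_le (hZ : IsStationaryMarkovChain Q π Z P)
    (hQ : UniformlyGeometricallyErgodic Q π C τ) (hC : 0 ≤ C) (hτ : 1 ≤ τ)
    (hU : Measurable U) (hUZ : IndepFun U (fun ω n => Z n ω) P)
    (hN : ∀ n, MeasurableSet[history U Z n] {ω | N ω = n}) (hy : AdaptedAt U Z N y)
    (hyX : ∀ ω, y ω ∈ X) (hX : MeasurableSet X) (hf : IsSmoothOn X f L)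
    (ho : IsOracle X π F f σ) (hB : 1 ≤ B) (hκ : 0 ≤ κ) (hV : IsTwoSmooth V κ)
    (A : (E →L[ℝ] ℝ) →L[ℝ] V) {a : ℝ} (ha : 0 ≤ a) (hA1 : ∀ φ, ‖φ‖ ≤ ‖A φ‖)
    (hA2 : ∀ φ, ‖A φ‖ ≤ a * ‖φ‖) (j : ℕ) :
    ∫ ω, ‖batchGrad F B (fun n => Z n ω) (N ω) (y ω) j - fderiv ℝ f (y ω)‖ ^ 2 ∂P
      ≤ 2 * κ * (a ^ 2 * σ ^ 2) * (1 + 16 * C * τ) / B / 2 ^ j := by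
  have hB0 : (0 : ℝ) < B := by exact_mod_cast hB
  have hm := ho.measurable_noiseOn hX hf
  have h1 := hZ.integral_sq_norm_sum_le hQ hC hτ hU hUZ hN hy hκ hV
    (Y := fun q => A (noiseOn X F f q)) (A.continuous.measurable.comp hm)
    (s := a * |σ|) (by positivity)
    (fun ω z => (hA2 _).trans (mul_le_mul_of_nonneg_left (ho.norm_noiseOn_le (hyX ω) z) ha))
    (fun ω => by
      rw [ContinuousLinearMap.integral_comp_comm A, ho.integral_noiseOn hX (hyX ω), map_zero]
      exact Integrable.of_bound (hm.comp measurable_prodMk_left).aestronglyMeasurable |σ|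
        (Filter.Eventually.of_forall fun z => ho.norm_noiseOn_le (hyX ω) z)) (2 ^ j * B)
  have h2 : ∫ ω, ‖batchGrad F B (fun n => Z n ω) (N ω) (y ω) j - fderiv ℝ f (y ω)‖ ^ 2 ∂P ≤
      ∫ ω, (((2 : ℝ) ^ j * B)⁻¹) ^ 2 * ‖∑ i ∈ Finset.range (2 ^ j * B),
        A (noiseOn X F f (y ω, Z (N ω + (i + 1)) ω))‖ ^ 2 ∂P := by
    refine integral_mono_of_nonneg (Filter.Eventually.of_forall fun ω => by positivity) ?_
      (Filter.Eventually.of_forall fun ω => ?_)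
    · have hle := history_le hU hZ.measurable
      have hNm : Measurable N := measurable_to_countable' fun n => hle n _ (hN n)
      have hym : Measurable y := hy.measurable hle hNm
      have hsum : Measurable fun ω => ∑ i ∈ Finset.range (2 ^ j * B),
          A (noiseOn X F f (y ω, Z (N ω + (i + 1)) ω)) :=
        Finset.measurable_fun_sum _ fun i _ => A.continuous.measurable.comp (hm.comp (hym.prodMk
          (measurable_select (g := fun n ω => Z (n + (i + 1)) ω)
            (fun n => hZ.measurable _) hNm)))
      refine Integrable.const_mul (Integrable.of_bound
        (hsum.norm.pow_const 2).aestronglyMeasurable (((2 ^ j * B : ℕ) * (a * |σ|)) ^ 2)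
        (Filter.Eventually.of_forall fun ω => ?_)) _
      rw [norm_pow, norm_norm]
      exact pow_le_pow_left₀ (norm_nonneg _) (norm_sum_range_le (fun i => (hA2 _).trans
        (mul_le_mul_of_nonneg_left (ho.norm_noiseOn_le (hyX ω) _) ha)) _) 2
    · simp only
      rw [batchGrad_sub_eq hB _ _ (hyX ω), ← map_sum, ← mul_pow, norm_smul,
        Real.norm_of_nonneg (by positivity)]
      gcongr
      exact hA1 _
  rw [integral_const_mul] at h2
  refine h2.trans ((mul_le_mul_of_nonneg_left h1 (by positivity)).trans (le_of_eq ?_))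
  rw [mul_pow a, sq_abs]
  push_cast
  field_simp

theorem abs_integral_batch_apply_le (hZ : IsStationaryMarkovChain Q π Z P)
    (hQ : UniformlyGeometricallyErgodic Q π C τ) (hC : 0 ≤ C) (hτ : 1 ≤ τ)
    (hU : Measurable U) (hUZ : IndepFun U (fun ω n => Z n ω) P)
    (hN : ∀ n, MeasurableSet[history U Z n] {ω | N ω = n}) {v : Ω → E}
    (hy : AdaptedAt U Z N fun ω => (y ω, v ω))
    (hyX : ∀ ω, y ω ∈ X) (hX : MeasurableSet X) (hf : IsSmoothOn X f L)
    (ho : IsOracle X π F f σ) (hB : 1 ≤ B) {R : ℝ} (hR0 : 0 ≤ R) (hR : ∀ ω, ‖v ω‖ ≤ R) (j : ℕ) :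
    |∫ ω, (batchGrad F B (fun n => Z n ω) (N ω) (y ω) j - fderiv ℝ f (y ω)) (v ω) ∂P|
      ≤ |σ| * R * (4 * C * τ / (2 ^ j * B)) := by
  have hB0 : (0 : ℝ) < B := by exact_mod_cast hB
  have hm := ho.measurable_noiseOn hX hf
  have hc : Continuous fun q : (E →L[ℝ] ℝ) × E => q.1 q.2 := by fun_prop
  have h1 := hZ.abs_integral_sum_le hQ hC hτ hU hUZ hN hy
    (u := fun q : (E × E) × S => noiseOn X F f (q.1.1, q.2) q.1.2)
    (hc.measurable.comp (f := fun q : (E × E) × S => (noiseOn X F f (q.1.1, q.2), q.1.2))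
      ((hm.comp (by fun_prop)).prodMk (by fun_prop)))
    (b := |σ| * R) (by positivity)
    (fun ω z => (ContinuousLinearMap.le_opNorm _ _).trans
      (mul_le_mul (ho.norm_noiseOn_le (hyX ω) z) (hR ω) (norm_nonneg _) (abs_nonneg _)))
    (fun ω => by
      have hi : Integrable (fun z => noiseOn X F f (y ω, z)) π :=
        Integrable.of_bound (hm.comp measurable_prodMk_left).aestronglyMeasurable |σ|
          (Filter.Eventually.of_forall fun z => ho.norm_noiseOn_le (hyX ω) z)
      have := ContinuousLinearMap.integral_apply hi (v ω)
      rw [ho.integral_noiseOn hX (hyX ω)] at this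
      simpa using this.symm) (2 ^ j * B)
  have h2 : ∀ ω, (batchGrad F B (fun n => Z n ω) (N ω) (y ω) j - fderiv ℝ f (y ω)) (v ω) =
      ((2 : ℝ) ^ j * B)⁻¹ * ∑ i ∈ Finset.range (2 ^ j * B),
        noiseOn X F f (y ω, Z (N ω + (i + 1)) ω) (v ω) := by
    intro ω
    rw [batchGrad_sub_eq hB _ _ (hyX ω), smul_apply, sum_apply, smul_eq_mul]
  simp_rw [h2]
  rw [integral_const_mul, abs_mul, abs_of_nonneg (by positivity)]
  refine (mul_le_mul_of_nonneg_left h1 (by positivity)).trans (le_of_eq ?_)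
  field_simp

end Estimates

theorem multilevel_apply {E : Type*} [NormedAddCommGroup E] [NormedSpace ℝ E] (M : ℝ)
    (ξ : ℕ → E →L[ℝ] ℝ) (J : ℕ) (v : E) :
    multilevel M ξ J v = multilevel M (fun k => ξ k v) J := by
  unfold multilevel
  split_ifs <;> simp

theorem UniformlyGeometricallyErgodic.prefactor_nonneg {S : Type*} [MeasurableSpace S]
    {Q : Kernel S S} {π : Measure S} [IsProbabilityMeasure π] {C τ : ℝ}
    (hQ : UniformlyGeometricallyErgodic Q π C τ) : 0 ≤ C := by
  have hS : Nonempty S := nonempty_of_isProbabilityMeasure π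
  have h := (abs_nonneg _).trans (hQ 1 one_pos hS.some ∅ MeasurableSet.empty)
  exact nonneg_of_mul_nonneg_left h (Real.rpow_pos_of_pos (by norm_num) _)

/-! ### Expected gap -/

section Convergence

variable {E S Ω V : Type*} [NormedAddCommGroup E] [NormedSpace ℝ E] [FiniteDimensional ℝ E]
  [MeasurableSpace E] [BorelSpace E] [MeasurableSpace S] [MeasurableSpace Ω] {X : Set E}
  {F : E → S → ℝ} {f : E → ℝ} {σ L C τ κ : ℝ}
  [NormedAddCommGroup V] [NormedSpace ℝ V] [FiniteDimensional ℝ V]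
  [MeasurableSpace V] [BorelSpace V] [SecondCountableTopology V]
  {Q : Kernel S S} [IsMarkovKernel Q] {π : Measure S} [IsProbabilityMeasure π]
  {P : Measure Ω} [IsProbabilityMeasure P] {Z : ℕ → Ω → S} {J : ℕ → Ω → ℕ}
  {w : E → ℝ} {w' : E → E →L[ℝ] ℝ} {γ β : ℕ → ℝ} {B : ℕ} {M : ℝ} {x0 : E}
  {x xg xf : ℕ → Ω → E}

/-- The estimation error of the randomized multilevel gradient at step `t`: its second moment, and
its correlation with a bounded quantity known at step `t`. -/
theorem multilevelGrad_error (hZ : IsStationaryMarkovChain Q π Z P)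
    (hQ : UniformlyGeometricallyErgodic Q π C τ) (hτ : 1 ≤ τ) (hJ : IsIndepGeometric J Z P)
    {t : ℕ} {y v : Ω → E}
    (hyv : AdaptedAt (pastLevels J t) Z (fun ω => sampleCount B (fun s => J s ω) t)
      fun ω => (y ω, v ω))
    (hyX : ∀ ω, y ω ∈ X) {R : ℝ} (hR0 : 0 ≤ R) (hR : ∀ ω, ‖v ω‖ ≤ R)
    (hX : MeasurableSet X) (hf : IsSmoothOn X f L) (ho : IsOracle X π F f σ) (hB : 1 ≤ B)
    (hM : 1 ≤ M) (hκ : 0 ≤ κ) (hV : IsTwoSmooth V κ) (A : (E →L[ℝ] ℝ) →L[ℝ] V) {a : ℝ}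
    (ha : 0 ≤ a) (hA1 : ∀ φ, ‖φ‖ ≤ ‖A φ‖) (hA2 : ∀ φ, ‖A φ‖ ≤ a * ‖φ‖) :
    (Integrable (fun ω => ‖multilevelGrad F B M (fun n => Z n ω) (sampleCount B (fun s => J s ω) t)
        (y ω) (J t ω) - fderiv ℝ f (y ω)‖ ^ 2) P ∧
      ∫ ω, ‖multilevelGrad F B M (fun n => Z n ω) (sampleCount B (fun s => J s ω) t)
        (y ω) (J t ω) - fderiv ℝ f (y ω)‖ ^ 2 ∂P ≤ (2 + 12 * Nat.log 2 ⌊M⌋₊) *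
          (2 * κ * (a ^ 2 * σ ^ 2) * (1 + 16 * C * τ) / B)) ∧
    (Integrable (fun ω => (multilevelGrad F B M (fun n => Z n ω)
        (sampleCount B (fun s => J s ω) t) (y ω) (J t ω) - fderiv ℝ f (y ω)) (v ω)) P ∧
      |∫ ω, (multilevelGrad F B M (fun n => Z n ω) (sampleCount B (fun s => J s ω) t)
        (y ω) (J t ω) - fderiv ℝ f (y ω)) (v ω) ∂P| ≤
          |σ| * R * min 1 (4 * C * τ / (2 ^ (Nat.log 2 ⌊M⌋₊) * B))) := by
  have hC := hQ.prefactor_nonneg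
  have hU : Measurable (pastLevels J t) := measurable_pi_lambda _ fun s => hJ.measurable s
  have hUZ := hJ.indepFun_pastLevels_chain t
  set N : Ω → ℕ := fun ω => sampleCount B (fun s => J s ω) t with hNdef
  have hN : ∀ n, MeasurableSet[history (pastLevels J t) Z n] {ω | N ω = n} := fun n =>
    measurable_sampleCount (measurable_history_fst (pastLevels J t) Z n) (measurableSet_singleton n)
  have hpair : Measurable[pastAndChain J Z t] fun ω => (pastLevels J t ω, fun n => Z n ω) :=
    comap_measurable _
  have hNm : Measurable[pastAndChain J Z t] N := measurable_sampleCount hpair.fst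
  have hZm : ∀ n, Measurable[pastAndChain J Z t] (Z n) := fun n =>
    (measurable_pi_apply n).comp hpair.snd
  have hyvm : Measurable[pastAndChain J Z t] fun ω => (y ω, v ω) :=
    hyv.measurable (history_le_pastAndChain J Z t) hNm
  set ξ : ℕ → Ω → E →L[ℝ] ℝ := fun j ω =>
    batchGrad F B (fun n => Z n ω) (N ω) (y ω) j - fderiv ℝ f (y ω) with hξdef
  have hξ : ∀ j, Measurable[pastAndChain J Z t] (ξ j) := fun j =>
    measurable_batch_sub ho hX hf hB hyX hyvm.fst hNm hZm j
  have hξb : ∀ j ω, ‖ξ j ω‖ ≤ |σ| := fun j ω => norm_batch_sub_le ho hB _ _ (hyX ω) j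
  simp only [multilevelGrad_sub]
  constructor
  · exact hJ.integral_sq_norm_multilevel_le hZ.measurable hM hξ hξb fun j =>
      integral_sq_norm_batch_le hZ hQ hC hτ hU hUZ hN (hyv.comp measurable_fst) hyX hX hf ho hB
        hκ hV A ha hA1 hA2 j
  · simp only [multilevel_apply]
    have hc : Continuous fun q : (E →L[ℝ] ℝ) × E => q.1 q.2 := by fun_prop
    have hb : ∀ k ω, |ξ k ω (v ω)| ≤ |σ| * R := fun k ω =>
      ((ξ k ω).le_opNorm _).trans (mul_le_mul (hξb k ω) (hR ω) (norm_nonneg _) (abs_nonneg _))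
    obtain ⟨h1, h2⟩ := hJ.integral_multilevel hZ.measurable hM (t := t)
      (y := fun k ω => ξ k ω (v ω)) (fun k => hc.measurable.comp ((hξ k).prodMk hyvm.snd)) hb
    refine ⟨h1, ?_⟩
    change |∫ ω, multilevel M (fun k => ξ k ω (v ω)) (J t ω) ∂P| ≤ _
    rw [h2, mul_min_of_nonneg _ _ (by positivity), mul_one]
    -- The crude bound by `|σ|R` is kept beside the mixing bound; the minimum with `1` later makes
    -- its square at most linear in `τ`.
    refine le_min ?_ (abs_integral_batch_apply_le hZ hQ hC hτ hU hUZ hN hyv hyX hX hf ho hB hR0 hR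
      _)
    rw [← Real.norm_eq_abs]
    refine (norm_integral_le_of_norm_le_const (Filter.Eventually.of_forall
      (hb (Nat.log 2 ⌊M⌋₊)))).trans ?_
    simp

/-- Expectations are taken in the pathwise bound. One `D²` is the initial Bregman distance; the
second pays for the bias over all `T` steps. -/
theorem integral_gap_le (hXc : IsCompact X) (hX : Convex ℝ X) (hw : IsDistanceGenerating X w w')
    {D : ℝ} (hD : IsLUB {v : ℝ | ∃ x ∈ X, ∃ y ∈ X, v = bregman w w' x y} (D ^ 2))
    (hZ : IsStationaryMarkovChain Q π Z P) (hQ : UniformlyGeometricallyErgodic Q π C τ)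
    (hτ : 1 ≤ τ) (hJ : IsIndepGeometric J Z P) (hf : IsSmoothOn X f L) (hc : IsGradConvexOn X f)
    (ho : IsOracle X π F f σ) {fstar : ℝ} (hstar : IsLeast (f '' X) fstar) (hB : 1 ≤ B)
    (hM : 1 ≤ M) (hx0 : x0 ∈ X) (hγ : ∀ t, 0 < γ t) (hβ0 : β 0 = 1)
    (hβγ : ∀ t, 0 ≤ (β (t + 1) - 1) * γ (t + 1) ∧ (β (t + 1) - 1) * γ (t + 1) ≤ β t * γ t)
    (hL : ∀ t, 2 * γ t * L ≤ β t)
    (hrun : ∀ ω, IsRun X w w' F γ β B M x0 (fun n => Z n ω) (fun t => J t ω)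
      (fun t => x t ω) (fun t => xg t ω) (fun t => xf t ω))
    (hκ : 0 ≤ κ) (hV : IsTwoSmooth V κ) (A : (E →L[ℝ] ℝ) →L[ℝ] V) {a : ℝ}
    (ha : 0 ≤ a) (hA1 : ∀ φ, ‖φ‖ ≤ ‖A φ‖) (hA2 : ∀ φ, ‖A φ‖ ≤ a * ‖φ‖) (T : ℕ) :
    Integrable (fun ω => f (xf T ω) - fstar) P ∧
    (β T - 1) * γ T * ∫ ω, (f (xf T ω) - fstar) ∂P ≤ 2 * D ^ 2 +
      (2 * ((2 + 12 * Nat.log 2 ⌊M⌋₊) * (2 * κ * (a ^ 2 * σ ^ 2) * (1 + 16 * C * τ) / B)) +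
        T * σ ^ 2 * (2 * C * τ / (2 ^ (Nat.log 2 ⌊M⌋₊) * B))) * ∑ t ∈ Finset.range T, γ t ^ 2 := by
  have hC := hQ.prefactor_nonneg
  have hB0 : (0 : ℝ) < B := by exact_mod_cast hB
  have hXm : MeasurableSet X := hXc.isClosed.measurableSet
  have hβ : ∀ t, 1 ≤ β t := by
    intro t
    cases t with
    | zero => rw [hβ0]
    | succ t => linarith [nonneg_of_mul_nonneg_left (hβγ t).1 (hγ (t + 1))]
  obtain ⟨⟨u, hu, rfl⟩, hmin⟩ := hstar
  have hmin' : ∀ y ∈ X, f u ≤ f y := fun y hy => hmin ⟨y, hy, rfl⟩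
  have hVD : ∀ y ∈ X, ∀ z ∈ X, bregman w w' y z ≤ D ^ 2 := fun y hy z hz => hD.1 ⟨y, hy, z, hz, rfl⟩
  have hmem : ∀ ω t, x t ω ∈ X ∧ xf t ω ∈ X ∧ xg t ω ∈ X := fun ω t => (hrun ω).mem hX hx0 hβ t
  have hadapt := adaptedAt_run hXc hX hw ho.measurable ho.differentiable hx0 hβ hrun
  -- Strong convexity turns `V ≤ D²` into `‖x - u‖ ≤ √2 D`.
  set R := Real.sqrt (2 * D ^ 2) with hRdef
  have hR2 : R ^ 2 = 2 * D ^ 2 := Real.sq_sqrt (by positivity)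
  have hR : ∀ ω t, ‖x t ω - u‖ ≤ R := by
    intro ω t
    refine Real.le_sqrt_of_sq_le ?_
    have := (half_sq_norm_le_bregman hw hu (hmem ω t).1).trans (hVD _ hu _ (hmem ω t).1)
    linarith
  have hxfm : Measurable (xf T) := by
    have hle := history_le (U := pastLevels J T) (Z := Z)
      (measurable_pi_lambda _ fun s => hJ.measurable s) hZ.measurable
    exact ((hadapt T).measurable hle (measurable_sampleCount
      (measurable_pi_lambda _ fun s => hJ.measurable s))).snd
  have hfc : ContinuousOn f X := fun y hy => (hf.1 y hy).continuousAt.continuousWithinAt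
  have hint : Integrable (fun ω => f (xf T ω) - f u) P := by
    obtain ⟨c, hc⟩ := hXc.exists_bound_of_continuousOn hfc
    have hm : Measurable fun ω => f (xf T ω) := by
      have h := (measurable_indicator_of_continuousOn hXm hfc).comp hxfm
      have e : X.indicator f ∘ xf T = fun ω => f (xf T ω) := by
        funext ω; simp [Set.indicator_of_mem (hmem ω T).2.1]
      rwa [e] at h
    exact (Integrable.of_bound hm.aestronglyMeasurable c
      (Filter.Eventually.of_forall fun ω => hc _ (hmem ω T).2.1)).sub (integrable_const _)
  refine ⟨hint, ?_⟩
  have herr : ∀ t, _ := fun t => multilevelGrad_error (M := M) hZ hQ hτ hJ (t := t) (B := B)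
    (y := xg t) (v := fun ω => x t ω - u)
    (by
      have h := (hadapt t).comp (g := fun q : E × E =>
        ((β t)⁻¹ • q.1 + (1 - (β t)⁻¹) • q.2, q.1 - u)) (by fun_prop)
      have e : (fun ω => (xg t ω, x t ω - u)) = fun ω =>
          ((β t)⁻¹ • x t ω + (1 - (β t)⁻¹) • xf t ω, x t ω - u) := by
        funext ω; rw [(hrun ω).xg_eq t]
      rw [e]; exact h)
    (fun ω => (hmem ω t).2.2) (Real.sqrt_nonneg _) (fun ω => hR ω t) hXm hf ho hB hM hκ hV A ha
    hA1 hA2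
  set c₁ := (2 + 12 * Nat.log 2 ⌊M⌋₊) * (2 * κ * (a ^ 2 * σ ^ 2) * (1 + 16 * C * τ) / B)
  set q := 4 * C * τ / (2 ^ (Nat.log 2 ⌊M⌋₊) * B) with hq
  have hq0 : 0 ≤ q := by positivity
  set Ξ : ℕ → Ω → E →L[ℝ] ℝ := fun t ω => multilevelGrad F B M (fun n => Z n ω)
    (sampleCount B (fun s => J s ω) t) (xg t ω) (J t ω) - fderiv ℝ f (xg t ω) with hΞ
  have hpath : ∀ ω, (β T - 1) * γ T * (f (xf T ω) - f u) ≤ D ^ 2 + ∑ t ∈ Finset.range T,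
      (2 * γ t ^ 2 * ‖Ξ t ω‖ ^ 2 - γ t * Ξ t ω (x t ω - u)) := by
    intro ω
    have h := (hrun ω).gap_le hX hw hf hc hx0 hγ hβ hβ0 (fun t => (hβγ t).2) hL hu hmin' T
    refine h.trans (add_le_add (hVD _ hx0 _ hu) (Finset.sum_le_sum fun t _ => le_of_eq ?_))
    rw [← neg_sub (multilevelGrad F B M (fun n => Z n ω) (sampleCount B (fun s => J s ω) t)
      (xg t ω) (J t ω)) (fderiv ℝ f (xg t ω)), neg_apply]
    ring
  have hti : ∀ t, Integrable (fun ω => 2 * γ t ^ 2 * ‖Ξ t ω‖ ^ 2 - γ t * Ξ t ω (x t ω - u)) P :=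
    fun t => ((herr t).1.1.const_mul _).sub ((herr t).2.1.const_mul _)
  have hle : (β T - 1) * γ T * ∫ ω, (f (xf T ω) - f u) ∂P ≤ D ^ 2 + ∑ t ∈ Finset.range T,
      (2 * γ t ^ 2 * ∫ ω, ‖Ξ t ω‖ ^ 2 ∂P - γ t * ∫ ω, Ξ t ω (x t ω - u) ∂P) := by
    have h := integral_mono (hint.const_mul ((β T - 1) * γ T))
      ((integrable_const (μ := P) (D ^ 2)).add
        (integrable_finsetSum (Finset.range T) fun t _ => hti t)) hpath
    have e1 := integral_add (integrable_const (μ := P) (D ^ 2))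
      (integrable_finsetSum (Finset.range T) fun t _ => hti t)
    have e2 := integral_finsetSum (Finset.range T) fun t _ => hti t
    have e3 : ∀ t, ∫ ω, (2 * γ t ^ 2 * ‖Ξ t ω‖ ^ 2 - γ t * Ξ t ω (x t ω - u)) ∂P =
        2 * γ t ^ 2 * ∫ ω, ‖Ξ t ω‖ ^ 2 ∂P - γ t * ∫ ω, Ξ t ω (x t ω - u) ∂P := fun t => by
      rw [integral_sub ((herr t).1.1.const_mul _) ((herr t).2.1.const_mul _), integral_const_mul,
        integral_const_mul]
    have e4 : ∫ _ω, D ^ 2 ∂P = D ^ 2 := by simp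
    rw [integral_const_mul] at h
    simp only [Pi.add_apply] at h
    rw [e1, e2, e4, Finset.sum_congr rfl fun t _ => e3 t] at h
    exact h
  have hterm : ∀ t ∈ Finset.range T,
      2 * γ t ^ 2 * ∫ ω, ‖Ξ t ω‖ ^ 2 ∂P - γ t * ∫ ω, Ξ t ω (x t ω - u) ∂P ≤
        D ^ 2 / T + (2 * c₁ + T * σ ^ 2 * (q / 2)) * γ t ^ 2 := by
    intro t ht
    have hT : (0 : ℝ) < T := by
      rw [Finset.mem_range] at ht
      exact_mod_cast (Nat.zero_le t).trans_lt ht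
    have h1 := mul_le_mul_of_nonneg_left (herr t).1.2 (by positivity : 0 ≤ 2 * γ t ^ 2)
    have h2 := mul_le_mul_of_nonneg_left ((neg_le_abs _).trans (herr t).2.2) (hγ t).le
    have hq2 : min 1 q ^ 2 ≤ q := by
      rcases le_total 1 q with h | h
      · rw [min_eq_left h]; linarith
      · rw [min_eq_right h]; nlinarith
    -- Young's inequality with weight `T` allots `D²/T` to each step. The remainder contains `min(1,
    -- q)²`, bounded by `q` so as to stay linear in `τ/(2^K B)`.
    have h3 : γ t * (|σ| * R * min 1 q) ≤ D ^ 2 / T + T * σ ^ 2 * (q / 2) * γ t ^ 2 := by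
      have e : D ^ 2 / T = R ^ 2 / (2 * T) := by rw [hR2]; field_simp
      have h4 : γ t * (|σ| * R * min 1 q) ≤
          R ^ 2 / (2 * T) + T * (γ t * |σ| * min 1 q) ^ 2 / 2 := by
        have : R ^ 2 / (2 * T) + T * (γ t * |σ| * min 1 q) ^ 2 / 2 - γ t * (|σ| * R * min 1 q)
            = (R - T * (γ t * |σ| * min 1 q)) ^ 2 / (2 * T) := by field_simp; ring
        have h5 : 0 ≤ (R - T * (γ t * |σ| * min 1 q)) ^ 2 / (2 * T) := by positivity
        linarith
      rw [e]
      refine h4.trans ?_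
      gcongr
      rw [mul_pow, mul_pow, sq_abs]
      have := mul_le_mul_of_nonneg_left hq2
        (by positivity : 0 ≤ T * (γ t ^ 2 * σ ^ 2) / 2)
      linarith
    linarith
  have hsum := Finset.sum_le_sum hterm
  rw [Finset.sum_add_distrib, ← Finset.mul_sum, Finset.sum_const, Finset.card_range,
    nsmul_eq_mul] at hsum
  have hTD : (T : ℝ) * (D ^ 2 / T) ≤ D ^ 2 := by
    rcases (Nat.cast_nonneg (α := ℝ) T).eq_or_lt with h | h
    · rw [← h]; simp; positivity
    · rw [mul_div_cancel₀ _ h.ne']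
  have hq2 : q / 2 = 2 * C * τ / (2 ^ (Nat.log 2 ⌊M⌋₊) * B) := by rw [hq]; ring
  rw [hq2] at hsum
  linarith

end Convergence

/-- With `2^K ≤ M < 2^{K+1}`, the level count is at most `(3/2) log M` and `2^{-K} ≤ 2/M`. The
additive constant is absorbed by `θ ≥ 1`, which follows from `T ≥ 1` and `log M ≥ 1 - 1/M`. -/
theorem error_coefficient_le {C τ κ ℓ σ M b : ℝ} {T : ℕ} (hT : 1 ≤ T) (hC : 0 ≤ C) (hτ : 1 ≤ τ)
    (hκ : 0 ≤ κ) (hκℓ : κ ≤ 12 * ℓ) (hℓ : 1 / 2 ≤ ℓ) (hM : 1 ≤ M) (hb : 0 < b) :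
    2 * ((2 + 12 * Nat.log 2 ⌊M⌋₊) * (2 * κ * (Real.exp 1 ^ 2 * σ ^ 2) * (1 + 16 * C * τ) / b)) +
      T * σ ^ 2 * (2 * C * τ / (2 ^ (Nat.log 2 ⌊M⌋₊) * b)) ≤
      8000 * (1 + 16 * C) * (ℓ * (τ * b⁻¹ * (T / M + Real.log M) * σ ^ 2)) := by
  have hM0 : 0 < M := by linarith
  set K := Nat.log 2 ⌊M⌋₊ with hK
  set θ := T / M + Real.log M with hθ
  have hT' : (1 : ℝ) ≤ T := by exact_mod_cast hT
  have hlogM : 0 ≤ Real.log M := Real.log_nonneg hM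
  have hTM : T / M ≤ θ := by linarith
  have hlogθ : Real.log M ≤ θ := by
    have : 0 ≤ (T : ℝ) / M := by positivity
    linarith
  have hθ1 : 1 ≤ θ := by
    have h1 := Real.one_sub_inv_le_log_of_pos hM0
    have h2 : M⁻¹ ≤ T / M := by rw [inv_eq_one_div]; gcongr
    linarith
  have hlog2 := Real.log_two_gt_d9
  have hKθ : (K : ℝ) ≤ 3 / 2 * θ := by
    have h1 : (2 : ℝ) ^ K ≤ M := (two_pow_le_iff_le_log hM K).2 le_rfl
    have h2 := Real.log_le_log (by positivity) h1
    rw [Real.log_pow] at h2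
    have h3 : (0 : ℝ) ≤ K := Nat.cast_nonneg _
    nlinarith
  have hMK : M ≤ 2 * 2 ^ K := by
    have h1 : ¬ (2 : ℝ) ^ (K + 1) ≤ M := by
      rw [two_pow_le_iff_le_log hM]; omega
    rw [pow_succ] at h1
    linarith
  have he : Real.exp 1 ^ 2 ≤ 8 := by
    have h1 := Real.exp_one_lt_d9
    have h2 := Real.exp_pos 1
    nlinarith
  have h1 : 2 * κ * (Real.exp 1 ^ 2 * σ ^ 2) * (1 + 16 * C * τ) / b ≤
      192 * (1 + 16 * C) * (ℓ * (τ * b⁻¹ * σ ^ 2)) := by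
    have h2 : 1 + 16 * C * τ ≤ (1 + 16 * C) * τ := by linarith
    calc 2 * κ * (Real.exp 1 ^ 2 * σ ^ 2) * (1 + 16 * C * τ) / b
        ≤ 2 * (12 * ℓ) * (8 * σ ^ 2) * ((1 + 16 * C) * τ) / b := by gcongr
      _ = _ := by field_simp; ring
  have h2 : (2 + 12 * (K : ℝ)) ≤ 20 * θ := by linarith
  have h3 : 2 * C * τ / (2 ^ K * b) ≤ 4 * C * τ / (M * b) := by
    rw [div_le_div_iff₀ (by positivity) (by positivity)]
    have : 0 ≤ 2 * C * τ * b := by positivity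
    nlinarith [mul_le_mul_of_nonneg_left hMK this]
  have h4 : T * σ ^ 2 * (2 * C * τ / (2 ^ K * b)) ≤ 8 * C * (ℓ * (τ * b⁻¹ * θ * σ ^ 2)) := by
    calc T * σ ^ 2 * (2 * C * τ / (2 ^ K * b)) ≤ T * σ ^ 2 * (4 * C * τ / (M * b)) := by gcongr
      _ = 8 * C * (1 / 2 * (τ * b⁻¹ * (T / M) * σ ^ 2)) := by field_simp; ring
      _ ≤ _ := by gcongr
  have h5 : 2 * ((2 + 12 * (K : ℝ)) *
      (2 * κ * (Real.exp 1 ^ 2 * σ ^ 2) * (1 + 16 * C * τ) / b)) ≤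
      7680 * (1 + 16 * C) * (ℓ * (τ * b⁻¹ * θ * σ ^ 2)) := by
    calc _ ≤ 2 * (20 * θ * (192 * (1 + 16 * C) * (ℓ * (τ * b⁻¹ * σ ^ 2)))) := by gcongr
      _ = _ := by ring
  have h6 : 0 ≤ ℓ * (τ * b⁻¹ * θ * σ ^ 2) := by positivity
  nlinarith [mul_nonneg hC h6]

end MAMD

theorem theorem2 (C : ℝ) :
    ∃ K : ℝ, 0 < K ∧
      ∀ (d : ℕ) (p : ℝ≥0∞) [Fact (1 ≤ p)], p ≤ 2 →
      -- the feasible set `X` in `ℝ^d` with the `ℓ_p` norm, and the Bregman divergence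
      ∀ (X : Set (PiLp p (fun _ : Fin d => ℝ))) (w : PiLp p (fun _ : Fin d => ℝ) → ℝ)
        (w' : PiLp p (fun _ : Fin d => ℝ) → PiLp p (fun _ : Fin d => ℝ) →L[ℝ] ℝ) (D : ℝ),
      IsCompact X → Convex ℝ X → MAMD.IsDistanceGenerating X w w' →
      IsLUB {v : ℝ | ∃ x ∈ X, ∃ y ∈ X, v = MAMD.bregman w w' x y} (D ^ 2) →
      -- the noise: a stationary uniformly geometrically ergodic chain, and the random levels
      ∀ (S : Type*) [TopologicalSpace S] [PolishSpace S] [MeasurableSpace S] [BorelSpace S]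
        (Q : Kernel S S) [IsMarkovKernel Q] (π : Measure S) [IsProbabilityMeasure π] (τ : ℝ)
        (Ω : Type*) [MeasurableSpace Ω] (P : Measure Ω) [IsProbabilityMeasure P]
        (Z : ℕ → Ω → S) (J : ℕ → Ω → ℕ),
      1 ≤ τ → MAMD.UniformlyGeometricallyErgodic Q π C τ →
      MAMD.IsStationaryMarkovChain Q π Z P → MAMD.IsIndepGeometric J Z P →
      -- the objective and its stochastic oracle
      ∀ (F : PiLp p (fun _ : Fin d => ℝ) → S → ℝ) (f : PiLp p (fun _ : Fin d => ℝ) → ℝ)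
        (L σ fstar : ℝ),
      0 < L → MAMD.IsSmoothOn X f L → MAMD.IsGradConvexOn X f → MAMD.IsOracle X π F f σ →
      IsLeast (f '' X) fstar →
      -- the parameters and the iterates of the algorithm
      ∀ (γ β : ℕ → ℝ) (B : ℕ) (M : ℝ) (x0 : PiLp p (fun _ : Fin d => ℝ))
        (x xg xf : ℕ → Ω → PiLp p (fun _ : Fin d => ℝ)),
      1 ≤ B → 1 ≤ M → x0 ∈ X → (∀ t, 0 < γ t) → β 0 = 1 →
      (∀ t, 0 ≤ (β (t + 1) - 1) * γ (t + 1) ∧ (β (t + 1) - 1) * γ (t + 1) ≤ β t * γ t) →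
      (∀ t, 2 * γ t * L ≤ β t) →
      (∀ ω, MAMD.IsRun X w w' F γ β B M x0 (fun n => Z n ω) (fun t => J t ω)
        (fun t => x t ω) (fun t => xg t ω) (fun t => xf t ω)) →
      ∀ T : ℕ,
        Integrable (fun ω => f (xf T ω) - fstar) P ∧
        (β T - 1) * γ T * ∫ ω, (f (xf T ω) - fstar) ∂P ≤
          K * Real.log (T + 2) *
            (D ^ 2 + Real.log (d + 2) *
              (τ * (B : ℝ)⁻¹ * (T / M + Real.log M) * σ ^ 2 * ∑ t ∈ Finset.range T, γ t ^ 2)) := by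
  -- The factor `log(T + 2)` is used only through its lower bound `1/2`, which doubles `8000`. The
  -- absolute value keeps the constant positive before ergodicity is available to give `C ≥ 0`.
  refine ⟨16000 * (1 + 16 * |C|), by positivity, ?_⟩
  intro d p _ hp X w w' D hXc hX hw hD S _ _ _ _ Q _ π _ τ Ω _ P _ Z J hτ hQ hZ hJ F f L σ fstar
    _ hf hc ho hstar γ β B M x0 x xg xf hB hM hx0 hγ hβ0 hβγ hL hrun T
  obtain ⟨r, _, κ, hκ, hκℓ, hV, hA⟩ := MAMD.exists_isTwoSmooth_dual d p hp
  obtain ⟨hint, hle⟩ := MAMD.integral_gap_le hXc hX hw hD hZ hQ hτ hJ hf hc ho hstar hB hM hx0 hγ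
    hβ0 hβγ hL hrun hκ hV (MAMD.dualCoords p r d) (Real.exp_pos 1).le (fun φ => (hA φ).1)
    (fun φ => (hA φ).2) T
  refine ⟨hint, ?_⟩
  have hC := hQ.prefactor_nonneg
  rw [abs_of_nonneg hC]
  have hB0 : (0 : ℝ) < B := by exact_mod_cast hB
  have hlog2 := Real.log_two_gt_d9
  have hlog : ∀ n : ℕ, 1 / 2 ≤ Real.log (n + 2) := fun n => by
    have : Real.log 2 ≤ Real.log (n + 2) :=
      Real.log_le_log two_pos (by linarith [Nat.cast_nonneg (α := ℝ) n])
    linarith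
  have hbase : ∀ Θ : ℝ, 0 ≤ Θ → 8000 * (1 + 16 * C) * Θ ≤
      16000 * (1 + 16 * C) * Real.log (T + 2) * Θ := fun Θ hΘ => by
    have h : 8000 * (1 + 16 * C) ≤ 16000 * (1 + 16 * C) * Real.log (T + 2) := by
      nlinarith [hlog T]
    exact mul_le_mul_of_nonneg_right h hΘ
  have hD2 : 2 * D ^ 2 ≤ 8000 * (1 + 16 * C) * D ^ 2 :=
    mul_le_mul_of_nonneg_right (by linarith) (sq_nonneg D)
  -- At `T = 0` the left side vanishes because `β 0 = 1`; the coefficient estimate needs `T ≥ 1`.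
  rcases Nat.eq_zero_or_pos T with rfl | hT
  · rw [hβ0, sub_self, zero_mul, zero_mul]
    have := hlog 0
    simp only [Finset.range_zero, Finset.sum_empty, mul_zero, add_zero]
    positivity
  · have hcoef := MAMD.error_coefficient_le (σ := σ) hT hC hτ hκ hκℓ (hlog d) hM hB0
    set s := ∑ t ∈ Finset.range T, γ t ^ 2
    have hs : 0 ≤ s := Finset.sum_nonneg fun t _ => sq_nonneg _
    have hlogM := Real.log_nonneg hM
    have hd := hlog d
    have hnn : 0 ≤ D ^ 2 + Real.log (d + 2) *
        (τ * (B : ℝ)⁻¹ * (T / M + Real.log M) * σ ^ 2 * s) := by positivity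
    calc _ ≤ _ := hle
      _ ≤ 8000 * (1 + 16 * C) * D ^ 2 + 8000 * (1 + 16 * C) *
          (Real.log (d + 2) * (τ * (B : ℝ)⁻¹ * (T / M + Real.log M) * σ ^ 2)) * s :=
        add_le_add hD2 (mul_le_mul_of_nonneg_right hcoef hs)
      _ = 8000 * (1 + 16 * C) * (D ^ 2 + Real.log (d + 2) *
          (τ * (B : ℝ)⁻¹ * (T / M + Real.log M) * σ ^ 2 * s)) := by ring
      _ ≤ _ := hbase _ hnn
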